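/- Let $\Gamma$ be a finite non-empty (simple) graph with vertex set $V$, and let $W$ be its right-angled Coxeter group, generated by $V$ with relations $\gamma^2=1$ for all $\gamma\in V$, and $\gamma\delta=\delta\gamma$ for distinct non-adjacent $\gamma,\delta$. Two generators *commute* if they are distinct and non-adjacent (no generator commutes with itself). **Buildings.** A word $\gamma_1\cdots\gamma_n$ in $V$ is *reduced* if there are no $i\ne j$ with $\gamma_i=\gamma_j$ such that $\gamma_i$ commutes with every letter between them. A *building* for $(W,\Gamma)$ is a non-empty set $X$ with equivalence relations $\sim_\gamma$ ($\gamma\in V$), all of whose classes have at least two elements, such that for all $x,y\in X$ there is $g\in W$ such that, for every reduced word $w=\gamma_1\cdots\gamma_n$, the word $w$ represents $g$ if and only if there is a sequence $x=x_0,\dots,x_n=y$ with $x_{i-1}\neq x_i$ and $x_{i-1}\sim_{\gamma_i}x_i$ for all $i$. The *countable rich building* $\mathrm B_0(\Gamma)$ is a countable building all of whose $\sim_\gamma$-classes are infinite. Let $\sim^\gamma$ be the equivalence relation generated by all $\sim_\delta$ with $\delta\neq\gamma$. The coloured graph $\mathrm M_0(\Gamma)$ of $X=\mathrm B_0(\Gamma)$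 has as vertices of colour $\gamma$ the $\sim^\gamma$-classes of $X$ (for different $\gamma$ these are taken to be disjoint); a vertex $u$ of colour $\gamma$ and a vertex $v$ of colour $\delta$ are adjacent if $\gamma,\delta$ are adjacent in $\Gamma$ and some $z\in X$ lies in both classes $u$ and $v$. **$\Gamma$-spaces.** A *$\Gamma$-graph* is a graph each of whose vertices has exactly one colour in $V$, with no edges between vertices of colours $\gamma,\delta$ that are not adjacent in $\Gamma$ (in particular none between vertices of the same colour). A *flag* is a family $F=(f_\gamma)_{\gamma\in V}$ of vertices, $f_\gamma$ of colour $\gamma$, such that $\gamma\mapsto f_\gamma$ is an isomorphism of $\Gamma$ onto the induced subgraph. A *$\Gamma$-space* is a $\Gamma$-graph in which every vertex lies in a flag and any two adjacent vertices lie in a common flag. A *letter* is a non-empty connected subset of $V$; a *word* is a finite sequence of letters; two letters *commute* if every element of the one commutes with every element of the other. A word $s_1\cdots s_n$ is *reduced* if there are no $i\neq j$ with $s_i\subseteq s_j$ such that $s_i$ commutes with all letters between $s_i$ and $s_j$. A *weak flag path* with word $s_1\cdots s_n$ is a sequence of flags $F_0,\dots,F_n$ such that the set of colours at which $F_{i-1}$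 and $F_i$ differ is the letter $s_i$, for all $i$; it is a *flag path* if moreover, for no $i$, there is a weak flag path from $F_{i-1}$ to $F_i$ all of whose letters are proper subsets of $s_i$. It is *closed* if $F_0=F_n$, and *reduced* if its word is. A $\Gamma$-space is *simply connected* if it has no closed reduced flag path of length $n\geq 1$. **The theory.** In the language of graphs with a unary predicate for each colour, let $\mathrm{PS}_\Gamma$ be the theory of the non-empty simply connected $\Gamma$-spaces in which, for every flag $G$ and every colour $\gamma$, infinitely many flags agree with $G$ at all colours other than $\gamma$; that is, the set of all sentences true in all of them. A complete theory is *$\omega$-stable* if, for every $n$, there are only countably many complete $n$-types over each countable set of parameters in each of its models. A model of a theory is *prime* if it embeds elementarily into every model of the theory. **Corollary 4.16.** The (non-empty) models of $\mathrm{PS}_\Gamma$ are exactly the simply connected $\Gamma$-spaces just described, and $\mathrm{PS}_\Gamma$ is complete and $\omega$-stable. A countable rich building $\mathrm B_0(\Gamma)$ exists, and for every such building the coloured graph $\mathrm M_0(\Gamma)$ is a countable prime model of $\mathrm{PS}_\Gamma$, to which every prime model of $\mathrm{PS}_\Gamma$ is isomorphic. -/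

import Mathlib

open FirstOrder

universe u v w w'

namespace RABuilding

/-! ### Right-angled Coxeter groups, chamber systems and buildings -/

/-- The Coxeter matrix of the right-angled Coxeter group of `Γ`: distinct non-adjacent generators
commute, and adjacent generators satisfy no relation (the entry `0` stands for infinity). -/
noncomputable def coxeterMatrix {V : Type*} (Γ : SimpleGraph V) : CoxeterMatrix V := by
  classical
  exact
    { M := Matrix.of fun γ δ => if γ = δ then 1 else if Γ.Adj γ δ then 0 else 2
      isSymm := by
        ext γ δ
        simp [Matrix.transpose_apply, eq_comm, Γ.adj_comm]
      diagonal := by intro γ; simp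
      off_diagonal := by
        intro γ δ h
        by_cases h' : Γ.Adj γ δ <;> simp [h, h'] }

/-- Two generators commute if they are distinct and not adjacent (by convention, no generator
commutes with itself). -/
def GenCommute {V : Type*} (Γ : SimpleGraph V) (γ δ : V) : Prop :=
  γ ≠ δ ∧ ¬ Γ.Adj γ δ

/-- `k` lies strictly between `i` and `j`, in either order. -/
def StrictlyBetween (i j k : ℕ) : Prop :=
  (i < k ∧ k < j) ∨ (j < k ∧ k < i)

/-- A word in the generators is reduced if no letter occurs at two places `i ≠ j` and commutes
with all the letters in between. -/
def IsReducedGenWord {V : Type*} (Γ : SimpleGraph V) (w : List V) : Prop :=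
  ¬ ∃ i j : Fin w.length, i ≠ j ∧ w.get i = w.get j ∧
    ∀ k : Fin w.length, StrictlyBetween i j k → GenCommute Γ (w.get i) (w.get k)

/-- `HasPath step w x y`: there are `x = x₀, x₁, …, xₙ = y` with `step wᵢ xᵢ₋₁ xᵢ` for all `i`,
where `w = w₁ ⋯ wₙ`. -/
def HasPath {α X : Type*} (step : α → X → X → Prop) : List α → X → X → Prop
  | [], x, y => x = y
  | a :: w, x, y => ∃ z, step a x z ∧ HasPath step w z y

/-- Paths of type `w` in a chamber system: consecutive chambers are different and related by the
equivalence relation of the corresponding letter. -/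
def ChamberPath {V X : Type*} (r : V → Setoid X) (w : List V) (x y : X) : Prop :=
  HasPath (fun γ x y => x ≠ y ∧ r γ x y) w x y

/-- The chamber system `(X, r)` is a building for the right-angled Coxeter group `W` of `Γ`. -/
structure IsBuilding {V X : Type*} (Γ : SimpleGraph V) (r : V → Setoid X) : Prop where
  nonempty : Nonempty X
  /-- Every `∼_γ`-class has at least two elements. -/
  exists_ne : ∀ (γ : V) (x : X), ∃ y, y ≠ x ∧ r γ x y
  /-- Any two chambers have a distance in `W`. -/
  distance : ∀ x y : X, ∃ g : (coxeterMatrix Γ).Group, ∀ w : List V, IsReducedGenWord Γ w →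
    (ChamberPath r w x y ↔ (coxeterMatrix Γ).toCoxeterSystem.wordProd w = g)

/-- `(X, r)` is (a copy of) the countable rich building `B₀(Γ)`: a countable building all of whose
`∼_γ`-classes are infinite. -/
structure IsCountableRichBuilding {V X : Type*} (Γ : SimpleGraph V) (r : V → Setoid X) : Prop where
  isBuilding : IsBuilding Γ r
  countable : Countable X
  rich : ∀ (γ : V) (x : X), {y | r γ x y}.Infinite

/-- The relation `∼_s`: the equivalence relation generated by the `∼_γ` with `γ ∈ s`
(the diagonal if `s` is empty). -/
def residue {V X : Type*} (r : V → Setoid X) (s : Set V) : Setoid X :=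
  ⨆ γ ∈ s, r γ

/-- The relation `∼^γ` of the dual chamber system, i.e. `∼_{Γ ∖ {γ}}`. -/
def dual {V X : Type*} (r : V → Setoid X) (γ : V) : Setoid X :=
  residue r {γ}ᶜ

/-! ### Coloured graphs as first-order structures -/

/-- Relation symbols: one binary symbol for edges, one unary symbol for each colour. -/
inductive GraphRel (V : Type*) : ℕ → Type _
  | adj : GraphRel V 2
  | colour (γ : V) : GraphRel V 1

/-- The language of graphs with unary predicates for the colours in `V`. -/
def lang (V : Type*) : FirstOrder.Language :=
  ⟨fun _ => Empty, GraphRel V⟩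

section Structures

variable (V : Type*) {M : Type*} [(lang V).Structure M]

/-- Adjacency of vertices. -/
def Adj (x y : M) : Prop :=
  Language.Structure.RelMap (L := lang V) (GraphRel.adj : GraphRel V 2) ![x, y]

variable {V}

/-- The vertex `x` has colour `γ`. -/
def HasColour (γ : V) (x : M) : Prop :=
  Language.Structure.RelMap (L := lang V) (GraphRel.colour γ : GraphRel V 1) ![x]

end Structures

section GammaSpaces

variable {V : Type*} (Γ : SimpleGraph V) (M : Type*) [(lang V).Structure M]

/-- `M` is a `Γ`-graph: a coloured graph with no edges between vertices of non-adjacent colours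
(in particular, no edges between vertices of the same colour). -/
structure IsGammaGraph : Prop where
  symm : ∀ x y : M, Adj V x y → Adj V y x
  irrefl : ∀ x : M, ¬ Adj V x x
  colour : ∀ x : M, ∃! γ : V, HasColour γ x
  adj_colour : ∀ (x y : M) (γ δ : V), HasColour γ x → HasColour δ y → Adj V x y → Γ.Adj γ δ

/-- A flag of `M`: a family of vertices, one of each colour, such that `γ ↦ f_γ` is an
isomorphism from `Γ` onto the induced subgraph. -/
@[ext] structure Flag where
  vertex : V → M
  hasColour : ∀ γ, HasColour γ (vertex γ)
  adj_iff : ∀ γ δ, Adj V (vertex γ) (vertex δ) ↔ Γ.Adj γ δ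

/-- `M` is a `Γ`-space: a `Γ`-graph in which every vertex and every edge lies in a flag. -/
structure IsGammaSpace : Prop where
  isGammaGraph : IsGammaGraph Γ M
  vertex_mem_flag : ∀ x : M, ∃ (F : Flag Γ M) (γ : V), F.vertex γ = x
  edge_mem_flag : ∀ x y : M, Adj V x y →
    ∃ (F : Flag Γ M) (γ δ : V), F.vertex γ = x ∧ F.vertex δ = y

/-- A letter is a non-empty connected subset of `Γ`. -/
def IsLetter (s : Set V) : Prop :=
  (Γ.induce s).Connected

/-- Letters commute if all their elements do. -/
def LetterCommute (s t : Set V) : Prop :=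
  ∀ γ ∈ s, ∀ δ ∈ t, GenCommute Γ γ δ

/-- A word `s₁ ⋯ sₙ` is reduced if there are no `i ≠ j` such that `sᵢ ⊆ sⱼ` and `sᵢ` commutes with
all the letters between `sᵢ` and `sⱼ`. -/
def IsReducedWord (u : List (Set V)) : Prop :=
  ¬ ∃ i j : Fin u.length, i ≠ j ∧ u.get i ⊆ u.get j ∧
    ∀ k : Fin u.length, StrictlyBetween i j k → LetterCommute Γ (u.get i) (u.get k)

variable {Γ M}

/-- The set of colours at which two flags differ. -/
def diffColours (F G : Flag Γ M) : Set V :=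
  {γ | F.vertex γ ≠ G.vertex γ}

/-- The colours at which `F` and `G` differ form the letter `s`. -/
def WeakStep (s : Set V) (F G : Flag Γ M) : Prop :=
  IsLetter Γ s ∧ diffColours F G = s

/-- There is a weak flag path from `F` to `G` with word `u`. -/
def WeakFlagPath (u : List (Set V)) (F G : Flag Γ M) : Prop :=
  HasPath WeakStep u F G

/-- The colours at which `F` and `G` differ form the letter `s`, and no weak flag path from `F` to
`G` has as its word a splitting of `s`, i.e. a (possibly trivial) word whose letters are proper
subsets of `s`. -/
def FlagStep (s : Set V) (F G : Flag Γ M) : Prop :=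
  WeakStep s F G ∧ ¬ ∃ u : List (Set V), (∀ t ∈ u, t ⊂ s) ∧ WeakFlagPath u F G

/-- There is a flag path from `F` to `G` with word `u`. -/
def FlagPath (u : List (Set V)) (F G : Flag Γ M) : Prop :=
  HasPath FlagStep u F G

variable (Γ M)

/-- There are no non-trivial closed reduced flag paths. -/
def SimplyConnected : Prop :=
  ∀ (F : Flag Γ M) (u : List (Set V)), IsReducedWord Γ u → FlagPath u F F → u = []

/-- `M` is a simply connected `Γ`-space in which, for every colour `γ` and every flag `G`, there
are infinitely many flags which agree with `G` at all colours other than `γ`. -/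
structure IsRichSimplyConnected : Prop where
  isGammaSpace : IsGammaSpace Γ M
  simplyConnected : SimplyConnected Γ M
  rich : ∀ (γ : V) (G : Flag Γ M), {F : Flag Γ M | diffColours F G ⊆ {γ}}.Infinite

end GammaSpaces

/-- The theory `PS_Γ` of the simply connected `Γ`-spaces with infinite `∼_γ`-classes of flags: the
set of all the sentences that hold in each of them. -/
def PS {V : Type u} (Γ : SimpleGraph V) : (lang V).Theory :=
  {φ | ∀ (M : Type u) [Nonempty M] [(lang V).Structure M], IsRichSimplyConnected Γ M → M ⊨ φ}

/-! ### The coloured graph of a chamber system -/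

/-- The vertices of colour `γ` are the classes of `∼^γ`; different colours have disjoint sets of
vertices. The graph `Γ` is a parameter because the edges depend on it. -/
def ColouredGraph {V X : Type*} (_Γ : SimpleGraph V) (r : V → Setoid X) : Type _ :=
  Σ γ : V, Quotient (dual r γ)

/-- Vertices `u` and `v` are adjacent if their colours are and some chamber belongs to both of the
classes `u` and `v`. -/
instance colouredGraphStructure {V X : Type*} (Γ : SimpleGraph V) (r : V → Setoid X) :
    (lang V).Structure (ColouredGraph Γ r) where
  funMap := fun f => nomatch f
  RelMap := fun R x => match R, x with
    | GraphRel.adj, x => Γ.Adj (x 0).1 (x 1).1 ∧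
        ∃ z : X, Quotient.mk _ z = (x 0).2 ∧ Quotient.mk _ z = (x 1).2
    | GraphRel.colour γ, x => (x 0).1 = γ

/-! ### Stability and prime models -/

/-- A complete theory is `ω`-stable if, in every model, there are only countably many complete
`n`-types over every countable set of parameters, for all `n`. -/
def IsOmegaStable {L : FirstOrder.Language.{u, v}} (T : L.Theory) : Prop :=
  T.IsComplete ∧ ∀ (M : FirstOrder.Language.Theory.ModelType.{u, v, w} T) (A : Set M), A.Countable →
    ∀ n : ℕ, Countable ((L[[A]].completeTheory M).CompleteType (Fin n))

/-- `M` is a prime model of `T`: it embeds elementarily into every model of `T`. -/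
def IsPrimeModel {L : FirstOrder.Language.{u, v}} (T : L.Theory) (M : Type w') [L.Structure M] :
    Prop :=
  Nonempty M ∧ M ⊨ T ∧
    ∀ N : FirstOrder.Language.Theory.ModelType.{u, v, w} T, Nonempty (M ↪ₑ[L] N)

end RABuilding

namespace RABuilding

/-! ### Words and paths -/

section Paths

variable {α X : Type*} {step : α → X → X → Prop}

/-! The proof rests on a calculus of reduced words. Galleries in a building and flag paths in a
`Γ`-space obey the same rules: neighbouring steps with commuting letters can be exchanged, a step is
absorbed by a neighbouring step with a larger letter, and two steps with the same letter merge into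
one or split into smaller ones. `StepSystem` records these rules. Each reduction lowers the multiset
of letter sizes, so every path can be reduced. Where no non-trivial closed reduced path exists,
reduced paths with the same end points differ only by commutations (`StepSystem.swaps_of_red`). For
the Coxeter group this hypothesis is verified by means of an action on integer valued functions; the
resulting solution of the word problem turns the definition of a building into `IsGallerySystem`.

The flags of the coloured graph of a building are exactly its chambers
(`IsGallerySystem.exists_common_chamber`), and its flag paths have only singletons as letters. Thus
a rich building gives a rich simply connected space in which all flags are connected by changes of
single vertices. A countable rich building is found inside the Coxeter group of the graph that has
infinitely many non-adjacent copies of each vertex.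

Simple connectedness refers to splittings of unbounded length. By `simplyConnected_iff` it is enough
to exclude splittings up to a bound that depends only on the length of the word, so the rich simply
connected spaces form an elementary class (`forall_isAxiom_iff`).

Completeness is a back-and-forth argument with partial isomorphisms `NiceIso`, in whose domain any
two flags are joined by a reduced path that is matched on the other side. A flag outside of the
domain is reached by a path of smallest rank; its first step is free over the domain, and free
extensions stay nice (`IsFree.niceIso`). Free copies over countable sets exist in ultrapowers,
because by `exists_far` there are flags arbitrarily far from finitely many given ones. Hence
countable nice partial isomorphisms preserve all formulas (`NiceIso.realize_iff`), first between
ultrapowers and then everywhere. Relating two single flags gives completeness, and with it the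
description of the models.

For `ω`-stability, types over a countable set are realised in an ultrapower, and a countable set
closed under chosen free extensions contains equivalents of all tuples
(`Saturated.exists_countable_representatives`). For primeness, if all letters are singletons, a free
flag need only avoid finitely many flags, so every model contains it. Enumerating the graph of the
building then gives an elementary embedding, and going back and forth gives an isomorphism between
any two countable spaces of this kind (`exists_elementaryEmbedding`, `exists_equiv`). Prime models
are of this kind as they embed elementarily into the graph of the building. -/

theorem hasPath_append {u v : List α} {x z : X} :
    HasPath step (u ++ v) x z ↔ ∃ y, HasPath step u x y ∧ HasPath step v y z := by
  induction u generalizing x with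
  | nil => simp [HasPath]
  | cons a u ih =>
    simp only [List.cons_append, HasPath, ih]
    constructor
    · rintro ⟨y, h1, y', h2, h3⟩; exact ⟨y', ⟨y, h1, h2⟩, h3⟩
    · rintro ⟨y', ⟨y, h1, h2⟩, h3⟩; exact ⟨y, h1, y', h2, h3⟩

theorem hasPath_singleton {a : α} {x y : X} : HasPath step [a] x y ↔ step a x y := by
  simp [HasPath]

theorem hasPath_reverse (hs : ∀ a x y, step a x y → step a y x) {u : List α} {x y : X}
    (h : HasPath step u x y) : HasPath step u.reverse y x := by
  induction u generalizing x with
  | nil => exact h.symm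
  | cons a u ih =>
    obtain ⟨z, h1, h2⟩ := h
    rw [List.reverse_cons, hasPath_append]
    exact ⟨z, ih h2, hasPath_singleton.2 (hs _ _ _ h1)⟩

theorem HasPath.mono {step' : α → X → X → Prop} (hs : ∀ a x y, step a x y → step' a x y)
    {u : List α} {x y : X} (h : HasPath step u x y) : HasPath step' u x y := by
  induction u generalizing x with
  | nil => exact h
  | cons a u ih =>
    obtain ⟨z, h1, h2⟩ := h
    exact ⟨z, hs _ _ _ h1, ih h2⟩

theorem HasPath.congr_middle {x u u' y : List α} {p q : X}
    (h : HasPath step (x ++ u ++ y) p q)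
    (hu : ∀ p q, HasPath step u p q → HasPath step u' p q) :
    HasPath step (x ++ u' ++ y) p q := by
  rw [hasPath_append] at h ⊢
  obtain ⟨r, h1, h2⟩ := h
  rw [hasPath_append] at h1
  obtain ⟨r', h1, h3⟩ := h1
  exact ⟨r, hasPath_append.2 ⟨r', h1, hu _ _ h3⟩, h2⟩

/-- The relation `step` allows to exchange consecutive steps with commuting letters. -/
def Swappable (comm : α → α → Prop) (step : α → X → X → Prop) : Prop :=
  ∀ a b x y z, comm a b → step a x y → step b y z → ∃ y', step b x y' ∧ step a y' z

theorem Swappable.move_right {comm : α → α → Prop} (hs : Swappable comm step) {a : α}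
    {y : List α} (hy : ∀ c ∈ y, comm a c) {p q : X} (h : HasPath step (a :: y) p q) :
    HasPath step (y ++ [a]) p q := by
  induction y generalizing p with
  | nil => exact h
  | cons c y ih =>
    obtain ⟨r, h1, r', h2, h3⟩ := h
    obtain ⟨s, h4, h5⟩ := hs _ _ _ _ _ (hy c (by simp)) h1 h2
    exact ⟨s, h4, ih (fun d hd => hy d (by simp [hd])) ⟨r', h5, h3⟩⟩

theorem Swappable.move_left {comm : α → α → Prop} (hs : Swappable comm step) {a : α}
    {y : List α} (hy : ∀ c ∈ y, comm c a) {p q : X} (h : HasPath step (y ++ [a]) p q) :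
    HasPath step (a :: y) p q := by
  induction y generalizing p with
  | nil => exact h
  | cons c y ih =>
    obtain ⟨r, h1, h2⟩ := h
    obtain ⟨r', h2, h3⟩ := ih (fun d hd => hy d (by simp [hd])) h2
    obtain ⟨s, h4, h5⟩ := hs _ _ _ _ _ (hy c (by simp)) h1 h2
    exact ⟨s, h4, r', h5, h3⟩

end Paths

/-! ### Reduced words and commutation of letters -/

section Words

variable {α : Type*}

/-- A word is reduced for the relations `le` and `comm` on letters if no letter can be moved next
to another letter containing it. -/
def Red (le comm : α → α → Prop) (u : List α) : Prop :=
  ∀ x a y b z, u = x ++ a :: (y ++ b :: z) →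
    ¬ ((le a b ∧ ∀ c ∈ y, comm a c) ∨ (le b a ∧ ∀ c ∈ y, comm b c))

variable {le comm : α → α → Prop}

theorem red_nil : Red le comm [] := by
  intro x a y b z h; simp at h

theorem Red.infix {x u y : List α} (h : Red le comm (x ++ u ++ y)) : Red le comm u := by
  intro x' a y' b z' hu
  refine h (x ++ x') a y' b (z' ++ y) ?_
  simp [hu]

theorem Red.left {u v : List α} (h : Red le comm (u ++ v)) : Red le comm u :=
  Red.infix (x := []) (y := v) (by simpa using h)

theorem Red.right {u v : List α} (h : Red le comm (u ++ v)) : Red le comm v :=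
  Red.infix (x := u) (y := []) (by simpa using h)

/-- Reducedness is a condition on two positions, so a failure lies within `u`, within `v`, or has
one letter on each side of the cut. -/
theorem red_append_cases {u v : List α} (h : ¬ Red le comm (u ++ v)) :
    ¬ Red le comm u ∨ ¬ Red le comm v ∨ ∃ x a y y' b z, u = x ++ a :: y ∧ v = y' ++ b :: z ∧
      ((le a b ∧ ∀ c ∈ y ++ y', comm a c) ∨ (le b a ∧ ∀ c ∈ y ++ y', comm b c)) := by
  simp only [Red, not_forall, not_not] at h
  obtain ⟨x, a, y, b, z, he, h⟩ := h
  rcases List.append_eq_append_iff.1 he with ⟨a', rfl, hv⟩ | ⟨c', rfl, hw⟩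
  · exact Or.inr (Or.inl fun hr => hr a' a y b z hv h)
  · rcases c' with _ | ⟨c, c'⟩
    · exact Or.inr (Or.inl fun hr => hr [] a y b z (by simpa using hw.symm) h)
    · simp only [List.cons_append, List.cons.injEq] at hw
      obtain ⟨rfl, hw⟩ := hw
      rcases List.append_eq_append_iff.1 hw with ⟨d, rfl, hd⟩ | ⟨d, rfl, hd⟩
      · rcases d with _ | ⟨e, d⟩
        · simp only [List.nil_append] at hd
          exact Or.inr (Or.inr ⟨x, a, y, [], b, z, by simp, by simp [hd], by simpa using h⟩)
        · simp only [List.cons_append, List.cons.injEq] at hd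
          obtain ⟨rfl, rfl⟩ := hd
          exact Or.inl fun hr => hr x a y b d rfl h
      · exact Or.inr (Or.inr ⟨x, a, c', d, b, z, rfl, hd, h⟩)

theorem Red.reverse {u : List α} (h : Red le comm u) : Red le comm u.reverse := by
  intro x a y b z hu hc
  have : u = z.reverse ++ b :: (y.reverse ++ a :: x.reverse) := by
    rw [← List.reverse_reverse u, hu]; simp
  refine h _ _ _ _ _ this ?_
  rcases hc with hc | hc
  · exact Or.inr (by simpa using hc)
  · exact Or.inl (by simpa using hc)

/-- One commutation of neighbouring letters. -/
inductive SwapStep (comm : α → α → Prop) : List α → List α → Prop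
  | mk (x y : List α) (a b : α) : comm a b → SwapStep comm (x ++ a :: b :: y) (x ++ b :: a :: y)

/-- Words that differ by commutations. -/
def Swaps (comm : α → α → Prop) : List α → List α → Prop :=
  Relation.ReflTransGen (SwapStep comm)

theorem SwapStep.context {u v : List α} (h : SwapStep comm u v) (x y : List α) :
    SwapStep comm (x ++ u ++ y) (x ++ v ++ y) := by
  obtain ⟨x', y', a, b, hab⟩ := h
  have := SwapStep.mk (x ++ x') (y' ++ y) a b hab
  simpa using this

theorem Swaps.context {u v : List α} (h : Swaps comm u v) (x y : List α) :
    Swaps comm (x ++ u ++ y) (x ++ v ++ y) := by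
  induction h with
  | refl => exact .refl
  | tail _ h ih => exact ih.tail (h.context x y)

theorem Swaps.append_right {u v : List α} (h : Swaps comm u v) (y : List α) :
    Swaps comm (u ++ y) (v ++ y) := by
  simpa using h.context [] y

theorem Swaps.refl (u : List α) : Swaps comm u u := Relation.ReflTransGen.refl

theorem Swaps.trans {u v w : List α} (h : Swaps comm u v) (h' : Swaps comm v w) :
    Swaps comm u w := Relation.ReflTransGen.trans h h'

theorem Swaps.symm (hc : ∀ a b, comm a b → comm b a) {u v : List α} (h : Swaps comm u v) :
    Swaps comm v u := by
  induction h with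
  | refl => exact .refl _
  | tail _ h ih =>
    obtain ⟨x, y, a, b, hab⟩ := h
    exact Relation.ReflTransGen.head (SwapStep.mk x y b a (hc _ _ hab)) ih

theorem swaps_move_right {a : α} {y : List α} (hy : ∀ c ∈ y, comm a c) (x z : List α) :
    Swaps comm (x ++ a :: y ++ z) (x ++ y ++ a :: z) := by
  induction y generalizing x with
  | nil => simpa using Swaps.refl _
  | cons c y ih =>
    have h1 : SwapStep comm (x ++ a :: c :: (y ++ z)) (x ++ c :: a :: (y ++ z)) :=
      SwapStep.mk _ _ _ _ (hy c (by simp))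
    have h2 := ih (fun d hd => hy d (by simp [hd])) (x ++ [c])
    refine Swaps.trans (v := x ++ c :: a :: (y ++ z)) (.single (by simpa using h1)) ?_
    simpa using h2

theorem SwapStep.perm {u v : List α} (h : SwapStep comm u v) : u.Perm v := by
  obtain ⟨x, y, a, b, hab⟩ := h
  exact List.Perm.append_left _ (List.Perm.swap _ _ _)

theorem Swaps.perm {u v : List α} (h : Swaps comm u v) : u.Perm v := by
  induction h with
  | refl => exact .refl _
  | tail _ h ih => exact ih.trans h.perm

theorem Swaps.hasPath {X : Type*} {step : α → X → X → Prop} (hs : Swappable comm step)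
    {u v : List α} (h : Swaps comm u v) {p q : X} (hp : HasPath step u p q) :
    HasPath step v p q := by
  induction h with
  | refl => exact hp
  | tail _ h ih =>
    obtain ⟨x, y, a, b, hab⟩ := h
    have := HasPath.congr_middle (x := x) (u := [a, b]) (u' := [b, a]) (y := y) (by simpa using ih)
      (by
        rintro p q ⟨r, h1, r', h2, h3⟩
        obtain ⟨s, h4, h5⟩ := hs _ _ _ _ _ hab h1 h2
        exact ⟨s, h4, r', h5, h3⟩)
    simpa using this

end Words

/-- The combinatorial conditions on a set of letters, ordered by inclusion. -/
structure LetterSystem (α : Type*) [PartialOrder α] (comm : α → α → Prop) (rank : α → ℕ) :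
    Prop where
  symm : ∀ a b, comm a b → comm b a
  irrefl : ∀ a, ¬ comm a a
  mono : ∀ a b c, a ≤ b → comm b c → comm a c
  rank_lt : ∀ a b, a < b → rank a < rank b

/-- Otherwise `mono` would make `a` commute with itself. -/
theorem LetterSystem.not_le {α : Type*} [PartialOrder α] {comm : α → α → Prop} {rank : α → ℕ}
    (L : LetterSystem α comm rank) {a b : α} (h : comm a b) : ¬ a ≤ b := fun hab =>
  L.irrefl a (L.mono _ _ _ hab (L.symm _ _ h))

section
variable {α : Type*} [PartialOrder α] {comm : α → α → Prop} {rank : α → ℕ}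
  (L : LetterSystem α comm rank)
include L

/-- `a` and some letter of `v` can be moved next to each other and are comparable. -/
def Meets (comm : α → α → Prop) (a : α) (v : List α) : Prop :=
  ∃ y b z, v = y ++ b :: z ∧ ((a ≤ b ∧ ∀ c ∈ y, comm a c) ∨ (b ≤ a ∧ ∀ c ∈ y, comm b c))

omit L in
theorem red_cons {a : α} {v : List α} :
    Red (· ≤ ·) comm (a :: v) ↔ Red (· ≤ ·) comm v ∧ ¬ Meets comm a v := by
  constructor
  · intro h
    refine ⟨Red.right (u := [a]) h, ?_⟩
    rintro ⟨y, b, z, rfl, h'⟩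
    exact h [] a y b z rfl h'
  · rintro ⟨h, h'⟩ x c y b z he hc
    rcases x with _ | ⟨d, x⟩
    · simp only [List.nil_append, List.cons.injEq] at he
      obtain ⟨rfl, rfl⟩ := he
      exact h' ⟨y, b, z, rfl, hc⟩
    · simp only [List.cons_append, List.cons.injEq] at he
      exact h x c y b z he.2 hc

/-- The only delicate case is that the letter met by `a` jumps over its neighbour; by `mono` the
smaller of the two comparable letters commutes with that neighbour as well. -/
theorem SwapStep.meets {u v : List α} (h : SwapStep comm u v) {a : α} (ha : Meets comm a v) :
    Meets comm a u := by
  obtain ⟨x, y, c, d, hcd⟩ := h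
  obtain ⟨y1, b, z, he, hb⟩ := ha
  rcases List.append_eq_append_iff.1 he with ⟨e, rfl, hv⟩ | ⟨e, rfl, hv⟩
  · rcases e with _ | ⟨f, e⟩
    · simp only [List.nil_append, List.cons.injEq] at hv
      obtain ⟨rfl, rfl⟩ := hv
      refine ⟨x ++ [c], d, y, by simp, ?_⟩
      rcases hb with ⟨h1, h2⟩ | ⟨h1, h2⟩
      · refine Or.inl ⟨h1, fun e he => ?_⟩
        simp only [List.mem_append, List.mem_singleton] at he
        rcases he with he | rfl
        · exact h2 e (by simpa using he)
        · exact L.mono _ _ _ h1 (L.symm _ _ hcd)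
      · refine Or.inr ⟨h1, fun e he => ?_⟩
        simp only [List.mem_append, List.mem_singleton] at he
        rcases he with he | rfl
        · exact h2 e (by simpa using he)
        · exact L.symm _ _ hcd
    · simp only [List.cons_append, List.cons.injEq] at hv
      obtain ⟨rfl, hv⟩ := hv
      rcases e with _ | ⟨f, e⟩
      · simp only [List.nil_append, List.cons.injEq] at hv
        obtain ⟨rfl, rfl⟩ := hv
        refine ⟨x, c, d :: y, by simp, ?_⟩
        rcases hb with ⟨h1, h2⟩ | ⟨h1, h2⟩
        · exact Or.inl ⟨h1, fun e he => h2 e (by simp [he])⟩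
        · exact Or.inr ⟨h1, fun e he => h2 e (by simp [he])⟩
      · simp only [List.cons_append, List.cons.injEq] at hv
        obtain ⟨rfl, rfl⟩ := hv
        refine ⟨x ++ c :: d :: e, b, z, by simp, ?_⟩
        rcases hb with ⟨h1, h2⟩ | ⟨h1, h2⟩
        · refine Or.inl ⟨h1, fun g hg => h2 g ?_⟩
          simp only [List.mem_append, List.mem_cons] at hg ⊢; tauto
        · refine Or.inr ⟨h1, fun g hg => h2 g ?_⟩
          simp only [List.mem_append, List.mem_cons] at hg ⊢; tauto
  · rcases e with _ | ⟨f, e⟩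
    · simp only [List.nil_append, List.cons.injEq] at hv
      obtain ⟨rfl, rfl⟩ := hv
      refine ⟨y1 ++ [c], b, y, by simp, ?_⟩
      rcases hb with ⟨h1, h2⟩ | ⟨h1, h2⟩
      · refine Or.inl ⟨h1, fun e he => ?_⟩
        simp only [List.mem_append, List.mem_singleton] at he
        rcases he with he | rfl
        · exact h2 e he
        · exact L.mono _ _ _ h1 (L.symm _ _ hcd)
      · refine Or.inr ⟨h1, fun e he => ?_⟩
        simp only [List.mem_append, List.mem_singleton] at he
        rcases he with he | rfl
        · exact h2 e he
        · exact L.symm _ _ hcd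
    · simp only [List.cons_append, List.cons.injEq] at hv
      obtain ⟨rfl, rfl⟩ := hv
      exact ⟨y1, b, e ++ c :: d :: y, by simp, hb⟩

theorem SwapStep.red {u v : List α} (h : SwapStep comm u v) (hu : Red (· ≤ ·) comm u) :
    Red (· ≤ ·) comm v := by
  obtain ⟨x, y, c, d, hcd⟩ := h
  induction x with
  | nil =>
    simp only [List.nil_append, red_cons] at hu ⊢
    obtain ⟨⟨h1, h2⟩, h3⟩ := hu
    refine ⟨⟨h1, fun ⟨y1, b, z, he, hb⟩ => h3 ⟨d :: y1, b, z, by simp [he], ?_⟩⟩,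
      fun ⟨y1, b, z, he, hb⟩ => ?_⟩
    · rcases hb with ⟨h4, h5⟩ | ⟨h4, h5⟩
      · exact Or.inl ⟨h4, by simpa [hcd] using h5⟩
      · exact Or.inr ⟨h4, by simpa [L.mono _ _ _ h4 hcd] using h5⟩
    · rcases y1 with _ | ⟨e, y1⟩
      · simp only [List.nil_append, List.cons.injEq] at he
        obtain ⟨rfl, rfl⟩ := he
        rcases hb with ⟨h4, h5⟩ | ⟨h4, h5⟩
        · exact L.not_le (L.symm _ _ hcd) h4
        · exact L.not_le hcd h4
      · simp only [List.cons_append, List.cons.injEq] at he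
        obtain ⟨rfl, rfl⟩ := he
        refine h2 ⟨y1, b, z, rfl, ?_⟩
        rcases hb with ⟨h4, h5⟩ | ⟨h4, h5⟩
        · exact Or.inl ⟨h4, fun e he => h5 e (by simp [he])⟩
        · exact Or.inr ⟨h4, fun e he => h5 e (by simp [he])⟩
  | cons e x ih =>
    simp only [List.cons_append, red_cons] at hu ⊢
    refine ⟨ih hu.1, fun h => hu.2 ?_⟩
    exact SwapStep.meets L (SwapStep.mk x y c d hcd) h

theorem Swaps.red {u v : List α} (h : Swaps comm u v) (hu : Red (· ≤ ·) comm u) :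
    Red (· ≤ ·) comm v := by
  induction h with
  | refl => exact hu
  | tail _ h ih => exact h.red L ih

end

/-! ### The multiset order on words, and replacing letters by smaller ones -/

/-- The multiset of the ranks of the letters of a word. -/
def wordRank {α : Type*} (rank : α → ℕ) (u : List α) : Multiset ℕ := (u.map rank : List ℕ)

/-- The multiset ordering. -/
def RankLT (M N : Multiset ℕ) : Prop := Multiset.IsDershowitzMannaLT M N

theorem wellFounded_rankLT : WellFounded RankLT := Multiset.wellFounded_isDershowitzMannaLT

/-- Among the objects with a given property there is one of smallest rank. -/
theorem exists_rank_min {β : Type*} (P : β → Prop) (f : β → Multiset ℕ)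
    (h : ∃ b, P b) : ∃ b, P b ∧ ∀ c, P c → ¬ RankLT (f c) (f b) := by
  obtain ⟨b, hb⟩ := h
  obtain ⟨m, ⟨c, hc, rfl⟩, h2⟩ := wellFounded_rankLT.has_min (f '' {b | P b}) ⟨_, b, hb, rfl⟩
  exact ⟨c, hc, fun d hd => h2 _ ⟨d, hd, rfl⟩⟩

theorem RankLT.trans {M N P : Multiset ℕ} (h : RankLT M N) (h' : RankLT N P) : RankLT M P :=
  Multiset.IsDershowitzMannaLT.trans h h'

theorem RankLT.add_right {M N : Multiset ℕ} (h : RankLT M N) (K : Multiset ℕ) :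
    RankLT (M + K) (N + K) := by
  obtain ⟨A, Y, Z, hZ, rfl, rfl, h⟩ := h
  exact ⟨A + K, Y, Z, hZ, add_right_comm _ _ _, add_right_comm _ _ _, h⟩

theorem RankLT.add_left {M N : Multiset ℕ} (h : RankLT M N) (K : Multiset ℕ) :
    RankLT (K + M) (K + N) := by
  simpa only [add_comm K] using h.add_right K

section
variable {α : Type*} {rank : α → ℕ}

@[simp] theorem wordRank_append (u v : List α) :
    wordRank rank (u ++ v) = wordRank rank u + wordRank rank v := by
  simp [wordRank]

@[simp] theorem wordRank_cons (a : α) (v : List α) :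
    wordRank rank (a :: v) = {rank a} + wordRank rank v := by
  simp [wordRank]

@[simp] theorem wordRank_nil : wordRank rank ([] : List α) = 0 := by
  simp [wordRank]

theorem rankLT_single {z : List α} {n : ℕ} (h : ∀ c ∈ z, rank c < n) :
    RankLT (wordRank rank z) {n} := by
  refine ⟨0, wordRank rank z, {n}, by simp, by simp, by simp, ?_⟩
  intro y hy
  simp only [wordRank, Multiset.mem_coe, List.mem_map] at hy
  obtain ⟨c, hc, rfl⟩ := hy
  exact ⟨n, by simp, h c hc⟩

theorem rankLT_replace {x y z : List α} {b : α} (h : ∀ c ∈ z, rank c < rank b) :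
    RankLT (wordRank rank (x ++ z ++ y)) (wordRank rank (x ++ b :: y)) := by
  simp only [wordRank_append, wordRank_cons, ← add_assoc]
  exact ((rankLT_single h).add_left _).add_right _

theorem rankLT_delete {x y : List α} {b : α} :
    RankLT (wordRank rank (x ++ y)) (wordRank rank (x ++ b :: y)) := by
  simpa using rankLT_replace (rank := rank) (x := x) (y := y) (z := []) (b := b) (by simp)

end

/-- Replace a letter by a word of smaller letters. -/
inductive ShrinkStep {α : Type*} [LE α] : List α → List α → Prop
  | mk (x : List α) (b : α) (z y : List α) (h : ∀ c ∈ z, c ≤ b) :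
      ShrinkStep (x ++ b :: y) (x ++ z ++ y)

/-- Repeatedly replace letters by words of smaller letters. -/
def Shrinks {α : Type*} [LE α] : List α → List α → Prop := Relation.ReflTransGen ShrinkStep

theorem shrinkStep_delete {α : Type*} [LE α] (x : List α) (b : α) (y : List α) :
    ShrinkStep (x ++ b :: y) (x ++ y) := by
  simpa using ShrinkStep.mk x b [] y (by simp)

theorem Shrinks.forall {α : Type*} [LE α] {P : α → Prop} (hP : ∀ a b, a ≤ b → P b → P a)
    {u v : List α} (h : Shrinks u v) (hu : ∀ a ∈ u, P a) : ∀ a ∈ v, P a := by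
  induction h with
  | refl => exact hu
  | tail _ h ih =>
    obtain ⟨x, b, z, y, hz⟩ := h
    intro a ha
    simp only [List.mem_append] at ha
    rcases ha with (ha | ha) | ha
    · exact ih a (by simp [ha])
    · exact hP _ _ (hz a ha) (ih b (by simp))
    · exact ih a (by simp [ha])

/-- The word `w` is a product of words `wᵢ` with letters satisfying `Pᵢ`. -/
def Blocked {α : Type*} : List (α → Prop) → List α → Prop
  | [], w => w = []
  | P :: Ps, w => ∃ w₁ w₂, w = w₁ ++ w₂ ∧ (∀ c ∈ w₁, P c) ∧ Blocked Ps w₂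

/-- The replaced letter lies in one block, and its replacement stays there because the conditions
pass to smaller letters. Thus reducing a path respects any coarse division of it. -/
theorem ShrinkStep.blocked {α : Type*} [LE α] {Ps : List (α → Prop)}
    (hP : ∀ P ∈ Ps, ∀ a b, a ≤ b → P b → P a) {u v : List α} (h : ShrinkStep u v)
    (hu : Blocked Ps u) : Blocked Ps v := by
  obtain ⟨x, b, z, y, hz⟩ := h
  induction Ps generalizing x with
  | nil => simp [Blocked] at hu
  | cons P Ps ih =>
    obtain ⟨w₁, w₂, he, h1, h2⟩ := hu
    rcases List.append_eq_append_iff.1 he with ⟨e, rfl, hv⟩ | ⟨e, rfl, hv⟩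
    · rcases e with _ | ⟨f, e⟩
      · simp only [List.nil_append] at hv
        rw [← hv] at h2
        have := ih (fun Q hQ => hP Q (by simp [hQ])) [] h2
        exact ⟨x, z ++ y, by simp, by simpa using h1, by simpa using this⟩
      · simp only [List.cons_append, List.cons.injEq] at hv
        obtain ⟨rfl, rfl⟩ := hv
        refine ⟨x ++ z ++ e, w₂, by simp, fun c hc => ?_, h2⟩
        simp only [List.mem_append] at hc
        rcases hc with (hc | hc) | hc
        · exact h1 c (by simp [hc])
        · exact hP P (by simp) _ _ (hz c hc) (h1 b (by simp))
        · exact h1 c (by simp [hc])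
    · rw [hv] at h2
      exact ⟨w₁, e ++ z ++ y, by simp, h1, ih (fun Q hQ => hP Q (by simp [hQ])) e h2⟩

theorem Shrinks.blocked {α : Type*} [LE α] {Ps : List (α → Prop)}
    (hP : ∀ P ∈ Ps, ∀ a b, a ≤ b → P b → P a) {u v : List α} (h : Shrinks u v)
    (hu : Blocked Ps u) : Blocked Ps v := by
  induction h with
  | refl => exact hu
  | tail _ h ih => exact h.blocked hP ih

/-! ### Step systems: reduction of paths and uniqueness of reduced words -/

/-- A set with a step relation for each letter, with the rules that hold for flag paths in
`Γ`-spaces and for galleries in chamber systems. -/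
structure StepSystem {α X : Type*} [PartialOrder α] (comm : α → α → Prop) (rank : α → ℕ)
    (step : α → X → X → Prop) : Prop extends LetterSystem α comm rank where
  step_symm : ∀ a x y, step a x y → step a y x
  swap : Swappable comm step
  absorb : ∀ a b x y z, a < b → step a x y → step b y z → step b x z
  merge : ∀ a x y z, step a x y → step a y z →
    step a x z ∨ ∃ u, (∀ c ∈ u, c < a) ∧ HasPath step u x z

namespace StepSystem

variable {α X : Type*} [PartialOrder α] {comm : α → α → Prop} {rank : α → ℕ}
  {step : α → X → X → Prop} (S : StepSystem comm rank step)
include S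

theorem absorb_right {x y : List α} {a b : α} (hab : a < b) (hy : ∀ c ∈ x, comm a c) {p q : X}
    (h : HasPath step (a :: (x ++ b :: y)) p q) : HasPath step (x ++ b :: y) p q := by
  rw [← List.cons_append, hasPath_append] at h
  obtain ⟨r, h1, h2⟩ := h
  have h1 := S.swap.move_right hy h1
  rw [hasPath_append] at h1 ⊢
  obtain ⟨r', h1, h3⟩ := h1
  obtain ⟨r'', h2, h4⟩ := h2
  exact ⟨r', h1, r'', S.absorb _ _ _ _ _ hab (hasPath_singleton.1 h3) h2, h4⟩

theorem absorb_left {x y : List α} {a b : α} (hab : a < b) (hy : ∀ c ∈ y, comm a c) {p q : X}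
    (h : HasPath step (x ++ b :: (y ++ [a])) p q) : HasPath step (x ++ b :: y) p q := by
  have h' := hasPath_reverse S.step_symm h
  simp only [List.reverse_append, List.reverse_cons, List.reverse_nil, List.nil_append,
    List.append_assoc, List.cons_append] at h'
  have := hasPath_reverse S.step_symm (S.absorb_right hab (by simpa using hy) h')
  simpa using this

theorem cancel {y : List α} {a : α} (hy : ∀ c ∈ y, comm a c) {p q : X}
    (h : HasPath step (a :: (y ++ [a])) p q) : HasPath step (y ++ [a]) p q ∨
      ∃ z, (∀ c ∈ z, c < a) ∧ HasPath step (y ++ z) p q := by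
  rw [← List.cons_append, hasPath_append] at h
  obtain ⟨r, h1, h2⟩ := h
  have h1 := S.swap.move_right hy h1
  rw [hasPath_append] at h1
  obtain ⟨r', h1, h3⟩ := h1
  rcases S.merge _ _ _ _ (hasPath_singleton.1 h3) (hasPath_singleton.1 h2) with h | ⟨u, hu, h⟩
  · exact Or.inl (hasPath_append.2 ⟨r', h1, hasPath_singleton.2 h⟩)
  · exact Or.inr ⟨u, hu, hasPath_append.2 ⟨r', h1, h⟩⟩

/-- The smaller of the two offending letters can be moved next to the larger one. A strictly smaller
letter is absorbed, two equal letters are merged or split; in each case the rank drops. -/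
theorem reduce {u : List α} (hu : ¬ Red (· ≤ ·) comm u) {p q : X} (h : HasPath step u p q) :
    ∃ u', HasPath step u' p q ∧ RankLT (wordRank rank u') (wordRank rank u) ∧ Shrinks u u' := by
  simp only [Red, not_forall, not_not] at hu
  obtain ⟨x, a, y, b, z, rfl, hc⟩ := hu
  have key : (a = b ∧ ∀ c ∈ y, comm a c) ∨ (a < b ∧ ∀ c ∈ y, comm a c) ∨
      (b < a ∧ ∀ c ∈ y, comm b c) := by
    rcases hc with ⟨h1, h2⟩ | ⟨h1, h2⟩
    · rcases h1.eq_or_lt with h1 | h1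
      · exact Or.inl ⟨h1, h2⟩
      · exact Or.inr (Or.inl ⟨h1, h2⟩)
    · rcases h1.eq_or_lt with h1 | h1
      · exact Or.inl ⟨h1.symm, h1 ▸ h2⟩
      · exact Or.inr (Or.inr ⟨h1, h2⟩)
  rcases key with ⟨rfl, h2⟩ | ⟨h1, h2⟩ | ⟨h1, h2⟩
  · rw [hasPath_append] at h
    obtain ⟨r, h3, h4⟩ := h
    rw [show a :: (y ++ a :: z) = (a :: (y ++ [a])) ++ z by simp, hasPath_append] at h4
    obtain ⟨r', h4, h5⟩ := h4
    rcases S.cancel h2 h4 with h6 | ⟨v, hv, h6⟩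
    · refine ⟨x ++ (y ++ a :: z), ?_, rankLT_delete, .single (shrinkStep_delete _ _ _)⟩
      rw [show x ++ (y ++ a :: z) = x ++ ((y ++ [a]) ++ z) by simp]
      exact hasPath_append.2 ⟨r, h3, hasPath_append.2 ⟨r', h6, h5⟩⟩
    · have h8 : RankLT (wordRank rank (x ++ y ++ v ++ z)) (wordRank rank (x ++ y ++ a :: z)) :=
        rankLT_replace fun c hc => S.rank_lt _ _ (hv c hc)
      refine ⟨x ++ y ++ v ++ z, ?_, h8.trans ?_, ?_⟩
      · rw [show x ++ y ++ v ++ z = x ++ ((y ++ v) ++ z) by simp]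
        exact hasPath_append.2 ⟨r, h3, hasPath_append.2 ⟨r', h6, h5⟩⟩
      · rw [List.append_assoc]; exact rankLT_delete
      · refine Relation.ReflTransGen.head (shrinkStep_delete x a (y ++ a :: z))
          (.single ?_)
        rw [← List.append_assoc]
        exact ShrinkStep.mk _ _ _ _ fun c hc => (hv c hc).le
  · refine ⟨x ++ (y ++ b :: z), ?_, rankLT_delete, .single (shrinkStep_delete _ _ _)⟩
    rw [hasPath_append] at h ⊢
    obtain ⟨r, h3, h4⟩ := h
    exact ⟨r, h3, S.absorb_right h1 h2 h4⟩
  · refine ⟨(x ++ a :: y) ++ z, ?_, ?_, ?_⟩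
    · rw [show x ++ a :: (y ++ b :: z) = (x ++ a :: (y ++ [b])) ++ z by simp, hasPath_append] at h
      obtain ⟨r, h3, h4⟩ := h
      exact hasPath_append.2 ⟨r, S.absorb_left h1 h2 h3, h4⟩
    · rw [show x ++ a :: (y ++ b :: z) = (x ++ a :: y) ++ b :: z by simp]
      exact rankLT_delete
    · rw [show x ++ a :: (y ++ b :: z) = (x ++ a :: y) ++ b :: z by simp]
      exact .single (shrinkStep_delete _ _ _)

theorem exists_red {u : List α} {p q : X} (h : HasPath step u p q) :
    ∃ u', HasPath step u' p q ∧ Red (· ≤ ·) comm u' ∧ Shrinks u u' := by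
  induction hn : wordRank rank u using wellFounded_rankLT.induction generalizing u with
  | _ n ih =>
    by_cases hu : Red (· ≤ ·) comm u
    · exact ⟨u, h, hu, .refl⟩
    · obtain ⟨u', h1, h2, h3⟩ := S.reduce hu h
      obtain ⟨u'', h4, h5, h6⟩ := ih _ (hn ▸ h2) h1 rfl
      exact ⟨u'', h4, h5, h3.trans h6⟩

/-- Reduced paths with the same endpoints differ by commutations if there are no non-trivial
closed reduced paths. -/
theorem swaps_of_red (hsc : ∀ (u : List α) (x : X), Red (· ≤ ·) comm u → HasPath step u x x → u = [])
    {u v : List α} {p q : X} (hu : Red (· ≤ ·) comm u) (hv : Red (· ≤ ·) comm v)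
    (hpu : HasPath step u p q) (hpv : HasPath step v p q) : Swaps comm u v := by
  -- The argument shortens sometimes one word and sometimes the other, hence the sum of the ranks.
  induction hn : wordRank rank u + wordRank rank v using wellFounded_rankLT.induction
    generalizing u v q with
  | _ n ih =>
  subst hn
  by_cases hnil : u ++ v.reverse = []
  · simp only [List.append_eq_nil_iff, List.reverse_eq_nil_iff] at hnil
    obtain ⟨rfl, rfl⟩ := hnil
    exact .refl _
  have hclosed : HasPath step (u ++ v.reverse) p p :=
    hasPath_append.2 ⟨q, hpu, hasPath_reverse S.step_symm hpv⟩
  have hnr : ¬ Red (· ≤ ·) comm (u ++ v.reverse) := fun h => hnil (hsc _ _ h hclosed)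
  -- the case in which a letter at the end of one word is strictly smaller
  have key : ∀ {u v : List α} (hu : Red (· ≤ ·) comm u) (hv : Red (· ≤ ·) comm v)
      (hpu : HasPath step u p q) (hpv : HasPath step v p q)
      (hsum : ∀ u' v' : List α, RankLT (wordRank rank u' + wordRank rank v')
        (wordRank rank u + wordRank rank v) → ∀ q', Red (· ≤ ·) comm u' → Red (· ≤ ·) comm v' →
        HasPath step u' p q' → HasPath step v' p q' → Swaps comm u' v') {x y z w : List α} {a b : α},
      u = x ++ a :: y → v = z ++ b :: w → a < b → (∀ c ∈ y, comm a c) → (∀ c ∈ w, comm a c) →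
      False := by
    intro u v hu hv hpu hpv hsum x y z w a b hxu hzv hab hy hw
    have hs1 : Swaps comm u (x ++ y ++ [a]) := by
      have := swaps_move_right hy x []
      rw [hxu]; simpa using this
    have hr1 := hs1.red S.toLetterSystem hu
    obtain ⟨A, h1, h2⟩ := hasPath_append.1 (hs1.hasPath S.swap hpu)
    -- The last `a`-step of `u`, run backwards, is absorbed by `b`, so `v` leads to `A` as well.
    have h3 : HasPath step v p A := by
      have h4 : HasPath step (v ++ [a]) p A :=
        hasPath_append.2 ⟨q, hpv, hasPath_reverse S.step_symm h2⟩
      rw [hzv] at h4 ⊢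
      exact S.absorb_left hab hw (by simpa using h4)
    have h5 : Swaps comm (x ++ y) v := by
      refine hsum _ _ ?_ A hr1.left hv h1 h3
      rw [hxu]
      exact rankLT_delete.add_right _
    -- As a rearrangement of `u` this word is reduced, but its last letter can be moved next to the
    -- larger letter `b`.
    have h6 : Red (· ≤ ·) comm (v ++ [a]) :=
      (hs1.trans (h5.append_right [a])).red S.toLetterSystem hu
    rw [hzv] at h6
    exact h6 z b w a [] (by simp) (Or.inr ⟨hab.le, hw⟩)
  rcases red_append_cases hnr with h | h | ⟨x, a, y, y', b, z, hxu, hzv, hab⟩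
  · exact absurd hu h
  · exact absurd hv.reverse h
  have hzv' : v = z.reverse ++ b :: y'.reverse := by
    rw [← List.reverse_reverse v, hzv]; simp
  have hcases : (a = b ∧ ∀ c ∈ y ++ y', comm a c) ∨ (a < b ∧ ∀ c ∈ y ++ y', comm a c) ∨
      (b < a ∧ ∀ c ∈ y ++ y', comm b c) := by
    rcases hab with ⟨h1, h2⟩ | ⟨h1, h2⟩
    · rcases h1.eq_or_lt with h1 | h1
      · exact Or.inl ⟨h1, h2⟩
      · exact Or.inr (Or.inl ⟨h1, h2⟩)
    · rcases h1.eq_or_lt with h1 | h1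
      · exact Or.inl ⟨h1.symm, h1 ▸ h2⟩
      · exact Or.inr (Or.inr ⟨h1, h2⟩)
  rcases hcases with ⟨rfl, hc⟩ | ⟨hlt, hc⟩ | ⟨hlt, hc⟩
  · have hs1 : Swaps comm u (x ++ y ++ [a]) := by
      have := swaps_move_right (fun c hcy => hc c (List.mem_append_left _ hcy)) x []
      rw [hxu]; simpa using this
    have hs2 : Swaps comm v (z.reverse ++ y'.reverse ++ [a]) := by
      have := swaps_move_right (comm := comm) (a := a) (y := y'.reverse)
        (fun c hcy => hc c (List.mem_append_right _ (by simpa using hcy))) z.reverse []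
      rw [hzv']; simpa using this
    set u₁ := x ++ y with hu₁
    set v₁ := z.reverse ++ y'.reverse with hv₁
    have hru := hs1.red S.toLetterSystem hu
    have hrv := hs2.red S.toLetterSystem hv
    obtain ⟨A, h1, h2⟩ := hasPath_append.1 (hs1.hasPath S.swap hpu)
    obtain ⟨B, h3, h4⟩ := hasPath_append.1 (hs2.hasPath S.swap hpv)
    rw [hasPath_singleton] at h2 h4
    have hrk1 : wordRank rank u = wordRank rank u₁ + {rank a} := by
      rw [hxu, hu₁]; simp only [wordRank_append, wordRank_cons]; abel
    have hrk2 : wordRank rank v = wordRank rank v₁ + {rank a} := by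
      rw [hzv', hv₁]; simp only [wordRank_append, wordRank_cons]; abel
    have hltv : RankLT (wordRank rank v₁) (wordRank rank v) := by
      have := rankLT_delete (rank := rank) (x := v₁) (y := []) (b := a)
      rw [hrk2]; simpa using this
    -- If the two `a`-steps merge into one, `u` leads to `B`, as `v₁` does; then `v` is a
    -- rearrangement of `u₁` followed by two letters `a`, which is not reduced.
    rcases S.merge _ _ _ _ h2 (S.step_symm _ _ _ h4) with h5 | ⟨w, hw, h5⟩
    · have h6 : HasPath step u p B :=
        (hs1.symm S.symm).hasPath S.swap (hasPath_append.2 ⟨A, h1, hasPath_singleton.2 h5⟩)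
      have h7 := ih _ (hltv.add_left _) hu hrv.left h6 h3 rfl
      have h8 : Swaps comm v (u₁ ++ [a] ++ [a]) :=
        hs2.trans (((h7.symm S.symm).trans hs1).append_right [a])
      exact absurd (Or.inl ⟨le_rfl, by simp⟩)
        (h8.red S.toLetterSystem hv u₁ a [] a [] (by simp))
    -- Otherwise `B` is reached from `u₁` by letters below `a`. The choice of smallest rank makes
    -- `u₁ ++ z'` reduced, so that it can be compared with `v₁`.
    · obtain ⟨z', ⟨hz1, hz2⟩, hmin⟩ := exists_rank_min
        (fun z' : List α => (∀ c ∈ z', c < a) ∧ HasPath step (u₁ ++ z') p B) (wordRank rank)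
        ⟨w, hw, hasPath_append.2 ⟨A, h1, h5⟩⟩
      have hred : Red (· ≤ ·) comm (u₁ ++ z') := by
        by_contra hnr
        rcases red_append_cases hnr with h | h | ⟨x', c, y1, z1, d, z2, hx', hz', hcd⟩
        · exact h hru.left
        · obtain ⟨r, h6, h7⟩ := hasPath_append.1 hz2
          obtain ⟨z'', h8, h9, h10⟩ := S.reduce h h7
          exact hmin z'' ⟨h10.forall (fun _ _ => lt_of_le_of_lt) hz1,
            hasPath_append.2 ⟨r, h6, h8⟩⟩ h9
        · have hda : d < a := hz1 d (by simp [hz'])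
          by_cases hcd' : c ≤ d ∧ ∀ e ∈ y1 ++ z1, comm c e
          · refine hru x' c y1 a [] (by simp [hx']) (Or.inl ⟨hcd'.1.trans hda.le, ?_⟩)
            exact fun e he => hcd'.2 e (List.mem_append_left _ he)
          · rcases hcd with hcd | ⟨h6, h7⟩
            · exact hcd' hcd
            have h8 : d < c := lt_of_le_of_ne h6 fun h => hcd' (by subst h; exact ⟨le_rfl, h7⟩)
            refine hmin (z1 ++ z2) ⟨fun e he => hz1 e ?_, ?_⟩ ?_
            · rw [hz']; simp only [List.mem_append, List.mem_cons] at he ⊢; tauto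
            · rw [hx', hz', show (x' ++ c :: y1) ++ (z1 ++ d :: z2) =
                (x' ++ c :: ((y1 ++ z1) ++ [d])) ++ z2 by simp, hasPath_append] at hz2
              obtain ⟨r, h9, h10⟩ := hz2
              rw [hx', show (x' ++ c :: y1) ++ (z1 ++ z2) = (x' ++ c :: (y1 ++ z1)) ++ z2 by simp]
              exact hasPath_append.2 ⟨r, S.absorb_left h8 h7 h9, h10⟩
            · rw [hz']; exact rankLT_delete
      have h6 : RankLT (wordRank rank (u₁ ++ z')) (wordRank rank u) := by
        rw [hrk1, wordRank_append]
        exact (rankLT_single fun c hc => S.rank_lt _ _ (hz1 c hc)).add_left _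
      have h7 := ih _ ((h6.add_right _).trans (hltv.add_left _)) hred hrv.left hz2 h3 rfl
      have h8 : Swaps comm v (u₁ ++ z' ++ [a]) := hs2.trans ((h7.symm S.symm).append_right [a])
      -- A last letter of `z'` would stand next to the larger letter `a` in a rearrangement of `v`;
      -- so `z'` is empty.
      rcases List.eq_nil_or_concat z' with rfl | ⟨z'', c, rfl⟩
      · exact hs1.trans ((by simpa using h8 : Swaps comm v (u₁ ++ [a])).symm S.symm)
      · exact absurd (Or.inl ⟨(hz1 c (by simp)).le, by simp⟩)
          (h8.red S.toLetterSystem hv (u₁ ++ z'') c [] a [] (by simp))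
  · refine (key hu hv hpu hpv ?_ hxu hzv' hlt (fun c h => hc c (List.mem_append_left _ h))
      (fun c h => hc c (List.mem_append_right _ (by simpa using h)))).elim
    intro u' v' h q' h1 h2 h3 h4
    exact ih _ h h1 h2 h3 h4 rfl
  · refine (key hv hu hpv hpu ?_ hzv' hxu hlt
      (fun c h => hc c (List.mem_append_right _ (by simpa using h)))
      (fun c h => hc c (List.mem_append_left _ h))).elim
    intro u' v' h q' h1 h2 h3 h4
    exact ih _ (by rwa [add_comm (wordRank rank u)]) h1 h2 h3 h4 rfl

end StepSystem

/-! ### Reducedness in terms of positions and in terms of subwords -/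

theorem exists_decomposition {β : Type*} (u : List β) (i j : ℕ) (hij : i < j) (hj : j < u.length) :
    ∃ x y z, u = x ++ u[i] :: (y ++ u[j] :: z) ∧
      ∀ c ∈ y, ∃ k, ∃ hk : k < u.length, i < k ∧ k < j ∧ u[k] = c := by
  refine ⟨u.take i, (u.drop (i + 1)).take (j - (i + 1)), u.drop (j + 1), ?_, ?_⟩
  · have h1 : u.drop (i + 1) = (u.drop (i + 1)).take (j - (i + 1)) ++ u.drop j := by
      conv_lhs => rw [← List.take_append_drop (j - (i + 1)) (u.drop (i + 1)), List.drop_drop]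
      congr 2; omega
    rw [List.getElem_cons_drop, ← h1, List.getElem_cons_drop, List.take_append_drop]
  · intro c hc
    obtain ⟨k, hk, rfl⟩ := List.getElem_of_mem hc
    simp only [List.length_take, List.length_drop] at hk
    refine ⟨i + 1 + k, by omega, by omega, by omega, ?_⟩
    simp [List.getElem_take, List.getElem_drop]

theorem red_iff_fin {β : Type*} {le comm : β → β → Prop} {u : List β} :
    Red le comm u ↔ ¬ ∃ i j : Fin u.length, i ≠ j ∧ le (u.get i) (u.get j) ∧
      ∀ k : Fin u.length, StrictlyBetween i j k → comm (u.get i) (u.get k) := by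
  constructor
  · rintro h ⟨i, j, hij, hle, hc⟩
    simp only [List.get_eq_getElem] at hle hc
    rcases Nat.lt_or_ge i j with hlt | hge
    · obtain ⟨x, y, z, he, hy⟩ := exists_decomposition u i j hlt j.2
      refine h _ _ _ _ _ he (Or.inl ⟨hle, fun c hcy => ?_⟩)
      obtain ⟨k, hk, h1, h2, rfl⟩ := hy c hcy
      exact hc ⟨k, hk⟩ (Or.inl ⟨h1, h2⟩)
    · have hlt : (j : ℕ) < i := lt_of_le_of_ne hge fun h => hij (Fin.ext h.symm)
      obtain ⟨x, y, z, he, hy⟩ := exists_decomposition u j i hlt i.2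
      refine h _ _ _ _ _ he (Or.inr ⟨hle, fun c hcy => ?_⟩)
      obtain ⟨k, hk, h1, h2, rfl⟩ := hy c hcy
      exact hc ⟨k, hk⟩ (Or.inr ⟨h1, h2⟩)
  · rintro h x a y b z rfl hc
    have hb : (x ++ a :: (y ++ b :: z))[x.length + 1 + y.length]'(by simp; omega) = b := by
      rw [List.getElem_append_right (by omega)]
      simp only [show x.length + 1 + y.length - x.length = y.length + 1 by omega,
        List.getElem_cons_succ]
      rw [List.getElem_append_right (by omega)]
      simp
    have hk : ∀ k (hk : k < (x ++ a :: (y ++ b :: z)).length), x.length < k →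
        k < x.length + 1 + y.length → (x ++ a :: (y ++ b :: z))[k] ∈ y := by
      intro k hk h1 h2
      rw [List.getElem_append_right (by omega)]
      obtain ⟨m, hm⟩ : ∃ m, k - x.length = m + 1 := ⟨k - x.length - 1, by omega⟩
      simp only [hm, List.getElem_cons_succ]
      rw [List.getElem_append_left (by omega)]
      exact List.getElem_mem _
    refine h ?_
    rcases hc with ⟨h1, h2⟩ | ⟨h1, h2⟩
    · refine ⟨⟨x.length, by simp⟩, ⟨x.length + 1 + y.length, by simp; omega⟩, ?_, ?_, ?_⟩
      · simp only [ne_eq, Fin.mk.injEq]; omega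
      · simp only [List.get_eq_getElem, hb]; simpa using h1
      · rintro ⟨k, hk'⟩ hb'
        simp only [StrictlyBetween] at hb'
        have := h2 _ (hk k hk' (by omega) (by omega))
        simpa using this
    · refine ⟨⟨x.length + 1 + y.length, by simp; omega⟩, ⟨x.length, by simp⟩, ?_, ?_, ?_⟩
      · simp only [ne_eq, Fin.mk.injEq]; omega
      · simp only [List.get_eq_getElem, hb]; simpa using h1
      · rintro ⟨k, hk'⟩ hb'
        simp only [StrictlyBetween] at hb'
        have := h2 _ (hk k hk' (by omega) (by omega))
        simp only [List.get_eq_getElem, hb]; exact this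

theorem isReducedWord_iff {V : Type*} {Γ : SimpleGraph V} {u : List (Set V)} :
    IsReducedWord Γ u ↔ Red (· ⊆ ·) (LetterCommute Γ) u := red_iff_fin.symm

theorem isReducedGenWord_iff {V : Type*} {Γ : SimpleGraph V} {u : List V} :
    IsReducedGenWord Γ u ↔ Red (· = ·) (GenCommute Γ) u := red_iff_fin.symm

/-- Any set is partially ordered by equality. -/
abbrev discreteOrder (V : Type*) : PartialOrder V where
  le := Eq
  le_refl := Eq.refl
  le_trans _ _ _ := Eq.trans
  le_antisymm _ _ h _ := h

section
attribute [local instance] discreteOrder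

theorem GenCommute.symm {V : Type*} {Γ : SimpleGraph V} {γ δ : V} (h : GenCommute Γ γ δ) :
    GenCommute Γ δ γ := ⟨h.1.symm, fun h' => h.2 h'.symm⟩

theorem letterSystem_gen {V : Type*} (Γ : SimpleGraph V) :
    LetterSystem V (GenCommute Γ) (fun _ => 0) where
  symm _ _ h := h.symm
  irrefl _ h := h.1 rfl
  mono a b c h h' := by obtain rfl : a = b := h; exact h'
  rank_lt a b h := absurd h.le h.ne

end

/-! ### Right-angled Coxeter groups -/

section Coxeter

variable {V : Type*} (Γ : SimpleGraph V)

/-- The reflection that belongs to a generator in the action of a right-angled Coxeter group on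
integer valued functions. -/
noncomputable def reflect (γ : V) (f : V → ℤ) : V → ℤ := by
  classical
  exact fun δ => if δ = γ then - f γ else if Γ.Adj γ δ then f δ + 2 * f γ else f δ

variable {Γ}

theorem reflect_self (γ : V) (f : V → ℤ) : reflect Γ γ f γ = - f γ := by simp [reflect]

theorem reflect_adj {γ δ : V} (h : Γ.Adj γ δ) (f : V → ℤ) :
    reflect Γ γ f δ = f δ + 2 * f γ := by simp [reflect, h, h.ne']

theorem reflect_comm {γ δ : V} (h : GenCommute Γ γ δ) (f : V → ℤ) :
    reflect Γ γ f δ = f δ := by simp [reflect, h.2, h.1.symm]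

theorem trichotomy (Γ : SimpleGraph V) (γ δ : V) : δ = γ ∨ Γ.Adj γ δ ∨ GenCommute Γ γ δ := by
  by_cases h : δ = γ
  · exact Or.inl h
  · by_cases h' : Γ.Adj γ δ
    · exact Or.inr (Or.inl h')
    · exact Or.inr (Or.inr ⟨Ne.symm h, h'⟩)

theorem reflect_reflect (γ : V) (f : V → ℤ) : reflect Γ γ (reflect Γ γ f) = f := by
  funext δ
  rcases trichotomy Γ γ δ with rfl | h | h
  · simp [reflect_self]
  · rw [reflect_adj h, reflect_adj h, reflect_self]; ring
  · rw [reflect_comm h, reflect_comm h]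

theorem reflect_commute {γ δ : V} (h : GenCommute Γ γ δ) (f : V → ℤ) :
    reflect Γ γ (reflect Γ δ f) = reflect Γ δ (reflect Γ γ f) := by
  funext ε
  rcases trichotomy Γ γ ε with rfl | h1 | h1
  · rw [reflect_self, reflect_comm h.symm, reflect_comm h.symm, reflect_self]
  · rw [reflect_adj h1, reflect_comm h.symm]
    rcases trichotomy Γ δ ε with rfl | h2 | h2
    · exact absurd h1 h.2
    · rw [reflect_adj h2, reflect_adj h2, reflect_adj h1, reflect_comm h]; ring
    · rw [reflect_comm h2, reflect_comm h2, reflect_adj h1]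
  · rw [reflect_comm h1]
    rcases trichotomy Γ δ ε with rfl | h2 | h2
    · rw [reflect_self, reflect_self, reflect_comm h]
    · rw [reflect_adj h2, reflect_adj h2, reflect_comm h1, reflect_comm h]
    · rw [reflect_comm h2, reflect_comm h2, reflect_comm h1]

/-- The reflections as permutations. -/
noncomputable def reflectPerm (Γ : SimpleGraph V) (γ : V) : Equiv.Perm (V → ℤ) :=
  Function.Involutive.toPerm (reflect Γ γ) (reflect_reflect γ)

theorem isLiftable_reflectPerm : (coxeterMatrix Γ).IsLiftable (reflectPerm Γ) := by
  intro γ δ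
  have hsq : ∀ γ, reflectPerm Γ γ * reflectPerm Γ γ = 1 :=
    fun γ => Equiv.ext fun f => reflect_reflect γ f
  rcases trichotomy Γ γ δ with rfl | h | h
  · rw [hsq, one_pow]
  · have : (coxeterMatrix Γ).M γ δ = 0 := by simp [coxeterMatrix, h, h.ne]
    rw [show (coxeterMatrix Γ) γ δ = 0 from this, pow_zero]
  · have : (coxeterMatrix Γ).M γ δ = 2 := by simp [coxeterMatrix, h.2, h.1]
    rw [show (coxeterMatrix Γ) γ δ = 2 from this]
    have hc : Commute (reflectPerm Γ γ) (reflectPerm Γ δ) :=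
      Equiv.ext fun f => reflect_commute h f
    rw [hc.mul_pow, pow_two, pow_two, hsq, hsq, one_mul]

/-- The right action of the right-angled Coxeter group on integer valued functions. -/
noncomputable def act (g : (coxeterMatrix Γ).Group) (f : V → ℤ) : V → ℤ :=
  ((coxeterMatrix Γ).toCoxeterSystem.lift ⟨_, isLiftable_reflectPerm⟩ g⁻¹) f

theorem act_one (f : V → ℤ) : act (1 : (coxeterMatrix Γ).Group) f = f := by
  unfold act
  rw [inv_one, map_one]; rfl

theorem act_mul (g h : (coxeterMatrix Γ).Group) (f : V → ℤ) : act (g * h) f = act h (act g f) := by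
  unfold act
  rw [mul_inv_rev, map_mul]; rfl

theorem act_simple (γ : V) (f : V → ℤ) :
    act ((coxeterMatrix Γ).toCoxeterSystem.simple γ) f = reflect Γ γ f := by
  unfold act
  rw [CoxeterSystem.inv_simple, CoxeterSystem.lift_apply_simple]; rfl

/-- The functions that occur in the orbit of the constant function `1`. -/
def Positive (Γ : SimpleGraph V) (f : V → ℤ) : Prop :=
  (∀ γ, f γ ≠ 0) ∧ ∀ γ δ, f γ < 0 → Γ.Adj γ δ → 0 < f δ + f γ

/-- A neighbour `δ` of `γ` receives `f δ + 2 * f γ`, and the inequality in `Positive` makes this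
positive even if `f δ` is negative. So besides `γ` only coordinates that commute with `γ` can be
negative afterwards. -/
theorem Positive.reflect {f : V → ℤ} (hf : Positive Γ f) {γ : V} (hγ : 0 < f γ) :
    Positive Γ (reflect Γ γ f) ∧
      ∀ δ, reflect Γ γ f δ < 0 → δ = γ ∨ (GenCommute Γ γ δ ∧ f δ < 0) := by
  have hneg : ∀ δ, RABuilding.reflect Γ γ f δ < 0 → δ = γ ∨ (GenCommute Γ γ δ ∧ f δ < 0) := by
    intro δ hδ
    rcases trichotomy Γ γ δ with rfl | h | h
    · exact Or.inl rfl
    · rw [reflect_adj h] at hδ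
      have := hf.2 δ γ (by omega) h.symm
      omega
    · rw [reflect_comm h] at hδ
      exact Or.inr ⟨h, hδ⟩
  refine ⟨⟨fun δ => ?_, fun δ ε hδ hadj => ?_⟩, hneg⟩
  · rcases trichotomy Γ γ δ with rfl | h | h
    · rw [reflect_self]; omega
    · rw [reflect_adj h]
      rcases lt_or_ge (f δ) 0 with h1 | h1
      · have := hf.2 δ γ h1 h.symm
        omega
      · omega
    · rw [reflect_comm h]; exact hf.1 δ
  · rcases hneg δ hδ with rfl | ⟨h, h1⟩
    · rw [reflect_self, reflect_adj hadj]
      rcases lt_or_ge (f ε) 0 with h1 | h1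
      · have := hf.2 ε δ h1 hadj.symm
        omega
      · have := hf.1 ε
        omega
    · have h2 := hf.2 δ ε h1 hadj
      rw [reflect_comm h]
      rcases trichotomy Γ γ ε with rfl | h3 | h3
      · exact absurd hadj.symm h.2
      · rw [reflect_adj h3]; omega
      · rw [reflect_comm h3]; exact h2

/-- The letter `δ` occurs in `w` and commutes with all the letters after its last occurrence. -/
def IsFinal (Γ : SimpleGraph V) (δ : V) (w : List V) : Prop :=
  ∃ x y, w = x ++ δ :: y ∧ ∀ c ∈ y, GenCommute Γ δ c

theorem IsFinal.concat {δ γ : V} {w : List V} (h : IsFinal Γ δ w) (hc : GenCommute Γ γ δ) :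
    IsFinal Γ δ (w ++ [γ]) := by
  obtain ⟨x, y, rfl, hy⟩ := h
  refine ⟨x, y ++ [γ], by simp, fun c hcy => ?_⟩
  simp only [List.mem_append, List.mem_singleton] at hcy
  rcases hcy with hcy | rfl
  · exact hy c hcy
  · exact hc.symm

theorem isFinal_concat (γ : V) (w : List V) : IsFinal Γ γ (w ++ [γ]) :=
  ⟨w, [], by simp, by simp⟩

theorem not_isFinal_of_red {γ : V} {w : List V} (h : Red (· = ·) (GenCommute Γ) (w ++ [γ])) :
    ¬ IsFinal Γ γ w := by
  rintro ⟨x, y, rfl, hy⟩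
  exact h x γ y γ [] (by simp) (Or.inl ⟨rfl, hy⟩)

/-- Appending `γ` to a word makes `γ` final and leaves final only letters that commute with it; a
reflection does the same to negative signs. Reducedness means that `γ` was not final before, so the
reflection is applied at a positive coordinate. -/
theorem act_wordProd_red (w : List V) (hw : Red (· = ·) (GenCommute Γ) w) :
    Positive Γ (act ((coxeterMatrix Γ).toCoxeterSystem.wordProd w) 1) ∧
      ∀ δ, act ((coxeterMatrix Γ).toCoxeterSystem.wordProd w) 1 δ < 0 ↔ IsFinal Γ δ w := by
  induction w using List.reverseRecOn with
  | nil =>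
    rw [CoxeterSystem.wordProd_nil, act_one]
    refine ⟨⟨by simp, by simp⟩, fun δ => ⟨fun h => absurd h (by simp), ?_⟩⟩
    rintro ⟨x, y, h, -⟩
    simp at h
  | append_singleton w γ ih =>
    obtain ⟨h1, h2⟩ := ih hw.left
    rw [CoxeterSystem.wordProd_append, CoxeterSystem.wordProd_singleton, act_mul, act_simple]
    set f := act ((coxeterMatrix Γ).toCoxeterSystem.wordProd w) 1
    have hpos : 0 < f γ := by
      rcases lt_trichotomy (f γ) 0 with h | h | h
      · exact absurd ((h2 γ).1 h) (not_isFinal_of_red hw)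
      · exact absurd h (h1.1 γ)
      · exact h
    obtain ⟨h3, h4⟩ := h1.reflect hpos
    refine ⟨h3, fun δ => ⟨fun h => ?_, fun h => ?_⟩⟩
    · rcases h4 δ h with rfl | ⟨h5, h6⟩
      · exact isFinal_concat _ _
      · exact ((h2 δ).1 h6).concat h5
    · obtain ⟨x, y, he, hy⟩ := h
      rcases List.eq_nil_or_concat y with rfl | ⟨y, c, rfl⟩
      · obtain ⟨-, he⟩ := List.append_inj' he (by simp)
        simp only [List.cons.injEq, and_true] at he
        subst he
        rw [reflect_self]; omega
      · rw [List.concat_eq_append, ← List.cons_append, ← List.append_assoc] at he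
        obtain ⟨he1, he'⟩ := List.append_inj' he (by simp)
        simp only [List.cons.injEq, and_true] at he'
        subst he'
        have hcomm := hy γ (by simp)
        rw [reflect_comm hcomm.symm]
        exact (h2 δ).2 ⟨x, y, he1, fun c hc => hy c (by simp [hc])⟩

/-- Reduced words represent non-trivial elements. -/
theorem wordProd_ne_one {w : List V} (hw : Red (· = ·) (GenCommute Γ) w)
    (h1 : (coxeterMatrix Γ).toCoxeterSystem.wordProd w = 1) : w = [] := by
  rcases List.eq_nil_or_concat w with rfl | ⟨w, γ, rfl⟩
  · rfl
  rw [List.concat_eq_append] at hw h1 ⊢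
  -- The last letter has a negative coordinate, while the constant function `1` has none.
  have := ((act_wordProd_red _ hw).2 γ).2 (isFinal_concat γ w)
  rw [h1, act_one] at this
  simp at this

theorem simple_mul_comm {γ δ : V} (h : GenCommute Γ γ δ) :
    (coxeterMatrix Γ).toCoxeterSystem.simple γ * (coxeterMatrix Γ).toCoxeterSystem.simple δ =
    (coxeterMatrix Γ).toCoxeterSystem.simple δ * (coxeterMatrix Γ).toCoxeterSystem.simple γ := by
  have h2 := (coxeterMatrix Γ).toCoxeterSystem.simple_mul_simple_pow γ δ
  have : (coxeterMatrix Γ).M γ δ = 2 := by simp [coxeterMatrix, h.2, h.1]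
  rw [show (coxeterMatrix Γ) γ δ = 2 from this, pow_two] at h2
  have h3 := eq_inv_of_mul_eq_one_left h2
  rw [mul_inv_rev, CoxeterSystem.inv_simple, CoxeterSystem.inv_simple] at h3
  rw [h3]

end Coxeter

/-! ### The word problem in a right-angled Coxeter group -/

section
attribute [local instance] discreteOrder
variable {V : Type*} (Γ : SimpleGraph V)

/-- The galleries in the right-angled Coxeter group. -/
theorem stepSystem_group : StepSystem (GenCommute Γ) (fun _ => 0)
    (fun (γ : V) (x y : (coxeterMatrix Γ).Group) =>
      y = x * (coxeterMatrix Γ).toCoxeterSystem.simple γ) where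
  toLetterSystem := letterSystem_gen Γ
  step_symm γ x y h := by rw [h, CoxeterSystem.simple_mul_simple_cancel_right]
  swap := by
    rintro γ δ x y z h rfl rfl
    exact ⟨_, rfl, by dsimp only; rw [mul_assoc, mul_assoc, simple_mul_comm h]⟩
  absorb a b x y z h := absurd h.le h.ne
  merge := by
    rintro γ x y z rfl rfl
    exact Or.inr ⟨[], by simp, by
      simp only [HasPath, CoxeterSystem.simple_mul_simple_cancel_right]⟩

theorem hasPath_group {w : List V} {x y : (coxeterMatrix Γ).Group} :
    HasPath (fun (γ : V) (x y : (coxeterMatrix Γ).Group) =>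
      y = x * (coxeterMatrix Γ).toCoxeterSystem.simple γ) w x y ↔
    y = x * (coxeterMatrix Γ).toCoxeterSystem.wordProd w := by
  induction w generalizing x with
  | nil => simp [HasPath, eq_comm]
  | cons γ w ih =>
    simp only [HasPath, ih, CoxeterSystem.wordProd_cons, mul_assoc, exists_eq_left]

/-- Paths in the Cayley graph form a step system, and by `wordProd_ne_one` none that is reduced and
non-trivial is closed. -/
theorem swaps_of_wordProd_eq {u v : List V} (hu : Red (· = ·) (GenCommute Γ) u)
    (hv : Red (· = ·) (GenCommute Γ) v)
    (h : (coxeterMatrix Γ).toCoxeterSystem.wordProd u =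
      (coxeterMatrix Γ).toCoxeterSystem.wordProd v) : Swaps (GenCommute Γ) u v := by
  refine (stepSystem_group Γ).swaps_of_red (p := 1) (fun w x hw hp => wordProd_ne_one hw ?_) hu hv
    ((hasPath_group Γ).2 rfl) ((hasPath_group Γ).2 (by rw [h]))
  have := (hasPath_group Γ).1 hp
  simpa using this.symm

theorem wordProd_eq_of_swaps {u v : List V} (h : Swaps (GenCommute Γ) u v) :
    (coxeterMatrix Γ).toCoxeterSystem.wordProd u =
      (coxeterMatrix Γ).toCoxeterSystem.wordProd v := by
  have := (h.hasPath (stepSystem_group Γ).swap ((hasPath_group Γ (x := 1)).2 rfl))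
  simpa using ((hasPath_group Γ).1 this)

theorem exists_red_wordProd (g : (coxeterMatrix Γ).Group) :
    ∃ w, Red (· = ·) (GenCommute Γ) w ∧ (coxeterMatrix Γ).toCoxeterSystem.wordProd w = g := by
  obtain ⟨w, rfl⟩ := (coxeterMatrix Γ).toCoxeterSystem.wordProd_surjective g
  obtain ⟨u, h1, h2, -⟩ := (stepSystem_group Γ).exists_red
    ((hasPath_group Γ (w := w) (x := 1)).2 rfl)
  exact ⟨u, h2, by simpa using ((hasPath_group Γ).1 h1).symm⟩

end

/-! ### Buildings -/

section Building

variable {V X : Type*} {Γ : SimpleGraph V} {r : V → Setoid X}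

/-- Consecutive chambers of a gallery. -/
def GalleryStep (r : V → Setoid X) (γ : V) (x y : X) : Prop := x ≠ y ∧ r γ x y

/-- Chamber systems in which reduced galleries are determined up to commutation by their
endpoints. -/
structure IsGallerySystem (Γ : SimpleGraph V) (r : V → Setoid X) : Prop where
  swap : Swappable (GenCommute Γ) (GalleryStep r)
  connected : ∀ x y, ∃ w, ChamberPath r w x y
  closed : ∀ (w : List V) (x : X), Red (· = ·) (GenCommute Γ) w → ChamberPath r w x x → w = []

/-- For commuting `γ` and `δ` the words `γδ` and `δγ` are reduced and represent the same element, so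
galleries of both types exist together. A closed reduced gallery has the same distance as the empty
one. -/
theorem IsBuilding.isGallerySystem (h : IsBuilding Γ r) : IsGallerySystem Γ r where
  swap := by
    intro γ δ x y z hc h1 h2
    obtain ⟨g, hg⟩ := h.distance x z
    have hred : ∀ γ δ : V, γ ≠ δ → Red (· = ·) (GenCommute Γ) [γ, δ] := by
      intro γ δ hne p a q b s he hc
      have hl := congrArg List.length he
      simp only [List.length_cons, List.length_nil, List.length_append] at hl
      obtain rfl : p = [] := List.eq_nil_of_length_eq_zero (by omega)
      obtain rfl : q = [] := List.eq_nil_of_length_eq_zero (by omega)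
      simp only [List.nil_append, List.cons.injEq] at he
      obtain ⟨rfl, rfl, -⟩ := he
      rcases hc with ⟨h, -⟩ | ⟨h, -⟩
      · exact hne h
      · exact hne h.symm
    have h3 := (hg _ (isReducedGenWord_iff.2 (hred γ δ hc.1))).1 ⟨y, h1, z, h2, rfl⟩
    have h4 := wordProd_eq_of_swaps Γ (u := [γ, δ]) (v := [δ, γ])
      (.single (SwapStep.mk [] [] γ δ hc))
    obtain ⟨y', h5, z', h6, h7⟩ :=
      (hg _ (isReducedGenWord_iff.2 (hred δ γ hc.1.symm))).2 (h4 ▸ h3)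
    obtain rfl : z' = z := h7
    exact ⟨y', h5, h6⟩
  connected x y := by
    obtain ⟨g, hg⟩ := h.distance x y
    obtain ⟨w, hw, rfl⟩ := exists_red_wordProd Γ g
    exact ⟨w, (hg w (isReducedGenWord_iff.2 hw)).2 rfl⟩
  closed w x hw hp := by
    obtain ⟨g, hg⟩ := h.distance x x
    have h1 := (hg [] (isReducedGenWord_iff.2 red_nil)).1 rfl
    have h2 := (hg w (isReducedGenWord_iff.2 hw)).1 hp
    exact wordProd_ne_one hw (h2.trans (by rw [← h1, CoxeterSystem.wordProd_nil]))

namespace IsGallerySystem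

attribute [local instance] discreteOrder

variable (h : IsGallerySystem Γ r)
include h

theorem stepSystem : StepSystem (GenCommute Γ) (fun _ => 0) (GalleryStep r) where
  toLetterSystem := letterSystem_gen Γ
  step_symm _ _ _ h := ⟨h.1.symm, (r _).symm' h.2⟩
  swap := h.swap
  absorb _ _ _ _ _ h := absurd h.le h.ne
  merge γ x y z h1 h2 := by
    by_cases hxz : x = z
    · exact Or.inr ⟨[], by simp, hxz⟩
    · exact Or.inl ⟨hxz, (r γ).trans' h1.2 h2.2⟩

theorem exists_red_path (x y : X) :
    ∃ w, Red (· = ·) (GenCommute Γ) w ∧ ChamberPath r w x y := by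
  obtain ⟨w, hw⟩ := h.connected x y
  obtain ⟨u, h1, h2, -⟩ := h.stepSystem.exists_red hw
  exact ⟨u, h2, h1⟩

theorem swaps {u v : List V} {x y : X} (hu : Red (· = ·) (GenCommute Γ) u)
    (hv : Red (· = ·) (GenCommute Γ) v) (hpu : ChamberPath r u x y) (hpv : ChamberPath r v x y) :
    Swaps (GenCommute Γ) u v :=
  h.stepSystem.swaps_of_red h.closed hu hv hpu hpv

/-- The types of the reduced galleries from `x` to `y` form one class under commutations, and so do
the reduced words for one group element; a single reduced gallery therefore determines the distance.
-/
theorem isBuilding (hX : Nonempty X) (hne : ∀ (γ : V) (x : X), ∃ y, y ≠ x ∧ r γ x y) :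
    IsBuilding Γ r where
  nonempty := hX
  exists_ne := hne
  distance x y := by
    obtain ⟨u, hu, hpu⟩ := h.exists_red_path x y
    refine ⟨(coxeterMatrix Γ).toCoxeterSystem.wordProd u, fun w hw => ⟨fun hpw => ?_, fun he => ?_⟩⟩
    · exact wordProd_eq_of_swaps Γ (h.swaps (isReducedGenWord_iff.1 hw) hu hpw hpu)
    · exact (swaps_of_wordProd_eq Γ hu (isReducedGenWord_iff.1 hw) he.symm).hasPath h.swap hpu

omit h in
theorem residue_of_path {s : Set V} {w : List V} {x y : X} (hw : ∀ c ∈ w, c ∈ s)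
    (hp : ChamberPath r w x y) : residue r s x y := by
  induction w generalizing x with
  | nil => obtain rfl : x = y := hp; exact (residue r s).refl' x
  | cons γ w ih =>
    obtain ⟨z, h1, h2⟩ := hp
    have hle : r γ ≤ residue r s := le_iSup₂_of_le γ (hw γ (by simp)) le_rfl
    exact (residue r s).trans' (hle h1.2) (ih (fun c hc => hw c (by simp [hc])) h2)

omit h in
theorem residue_iff {s : Set V} {x y : X} :
    residue r s x y ↔ ∃ w : List V, (∀ c ∈ w, c ∈ s) ∧ ChamberPath r w x y := by
  refine ⟨fun hr => ?_, fun ⟨w, hw, hp⟩ => residue_of_path hw hp⟩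
  let P : Setoid X :=
    { r := fun x y => ∃ w : List V, (∀ c ∈ w, c ∈ s) ∧ ChamberPath r w x y
      iseqv :=
        { refl := fun x => ⟨[], by simp, rfl⟩
          symm := fun ⟨w, hw, hp⟩ => ⟨w.reverse, by simpa using hw,
            hasPath_reverse (fun γ x y h => ⟨h.1.symm, (r γ).symm' h.2⟩) hp⟩
          trans := fun ⟨w, hw, hp⟩ ⟨w', hw', hp'⟩ => ⟨w ++ w', by
            intro c hc
            rcases List.mem_append.1 hc with hc | hc
            · exact hw c hc
            · exact hw' c hc, hasPath_append.2 ⟨_, hp, hp'⟩⟩ } }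
  have hle : residue r s ≤ P := by
    refine iSup₂_le fun γ hγ x y hxy => ?_
    by_cases he : x = y
    · exact ⟨[], by simp, he⟩
    · exact ⟨[γ], by simpa using hγ, y, ⟨he, hxy⟩, rfl⟩
  exact hle hr

/-- Reducing a gallery within `s` introduces no new letters, and reduced galleries agree up to the
order of their letters. -/
theorem mem_of_residue {s : Set V} {w : List V} {x y : X} (hw : Red (· = ·) (GenCommute Γ) w)
    (hp : ChamberPath r w x y) (hr : residue r s x y) : ∀ c ∈ w, c ∈ s := by
  obtain ⟨u, hu, hpu⟩ := residue_iff.1 hr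
  obtain ⟨v, h1, h2, h3⟩ := h.stepSystem.exists_red hpu
  have h4 := h3.forall (P := (· ∈ s)) (fun a b hab hb => by obtain rfl : a = b := hab; exact hb) hu
  intro c hc
  exact h4 c ((h.swaps hw h2 hp h1).perm.mem_iff.1 hc)

/-- One reduced gallery serves for all colours at once: it avoids each `γ` with `dual r γ x y`. So
chambers and residues can be recovered from the dual classes. -/
theorem residue_iff_dual {s : Set V} {x y : X} :
    residue r s x y ↔ ∀ γ ∉ s, dual r γ x y := by
  constructor
  · intro hr γ hγ
    obtain ⟨w, hw, hp⟩ := residue_iff.1 hr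
    exact residue_of_path (fun c hc => fun h' => hγ (h' ▸ hw c hc)) hp
  · intro hd
    obtain ⟨w, hw, hp⟩ := h.exists_red_path x y
    refine residue_of_path (fun c hc => ?_) hp
    by_contra hcs
    exact h.mem_of_residue hw hp (hd c hcs) c hc rfl

theorem eq_of_dual {x y : X} (hd : ∀ γ, dual r γ x y) : x = y := by
  have := (h.residue_iff_dual (s := ∅)).2 fun γ _ => hd γ
  obtain ⟨w, hw, hp⟩ := residue_iff.1 this
  rcases w with _ | ⟨c, w⟩
  · exact hp
  · exact absurd (hw c (by simp)) (by simp)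

-- If `ε` is not final, some later letter fails to commute with it, which is another copy of `ε` or
-- a neighbour in `Γ`. Repeating this from the later letter, whose tail of the word has no new final
-- letters, ends at `δ`.
omit h in
theorem exists_chain_of_final {δ : V} (w : List V) : ∀ ε : V,
    (∀ γ, IsFinal Γ γ (ε :: w) → γ = δ) →
    ∃ l : List V, (ε :: l).Sublist (ε :: w) ∧ (ε :: l).IsChain Γ.Adj ∧
      (ε :: l).getLast (by simp) = δ := by
  induction hn : w.length using Nat.strong_induction_on generalizing w with
  | _ n ih =>
  intro ε hfin
  by_cases hc : ∀ c ∈ w, GenCommute Γ ε c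
  · exact ⟨[], by simp, by simp, by simpa using hfin ε ⟨[], w, rfl, hc⟩⟩
  · push Not at hc
    obtain ⟨ζ, hζ, hnc⟩ := hc
    obtain ⟨p, q, rfl⟩ := List.append_of_mem hζ
    obtain ⟨l, h1, h2, h3⟩ := ih q.length (by rw [← hn]; simp; omega) q rfl ζ (by
      rintro γ ⟨x, y, he, hy⟩
      exact hfin γ ⟨ε :: p ++ x, y, by simp [he], hy⟩)
    rcases trichotomy Γ ε ζ with rfl | hadj | hcomm
    · exact ⟨l, h1.trans (List.Sublist.cons_cons _ ((List.sublist_cons_self _ _).trans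
        (List.sublist_append_right _ _))), h2, h3⟩
    · exact ⟨ζ :: l, List.Sublist.cons_cons _ (h1.trans (List.sublist_append_right _ _)),
        List.isChain_cons_cons.2 ⟨hadj, h2⟩, by rw [List.getLast_cons (by simp)]; exact h3⟩
    · exact absurd hcomm hnc

-- Consecutive entries of a chain are adjacent in `Γ`, so a commutation never exchanges them.
omit h in
theorem sublist_of_swapStep {u v l : List V} (hs : SwapStep (GenCommute Γ) u v)
    (hl : l.IsChain Γ.Adj) (hu : l.Sublist u) : l.Sublist v := by
  obtain ⟨x, y, a, b, hab⟩ := hs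
  obtain ⟨l₁, l₂, rfl, h1, h2⟩ := List.sublist_append_iff.1 hu
  refine List.Sublist.append h1 ?_
  have hl2 := (List.isChain_append.1 hl).2.1
  rcases List.sublist_cons_iff.1 h2 with h3 | ⟨l₃, rfl, h3⟩
  · rcases List.sublist_cons_iff.1 h3 with h4 | ⟨l₃, rfl, h4⟩
    · exact (h4.cons _).cons _
    · exact List.Sublist.cons_cons _ (h4.cons _)
  · rcases List.sublist_cons_iff.1 h3 with h4 | ⟨l₄, rfl, h4⟩
    · exact List.Sublist.cons _ (List.Sublist.cons_cons _ h4)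
    · exact absurd (List.isChain_cons_cons.1 hl2).1 hab.2

-- No entry of `l` fits into the block that excludes it, so each further entry is pushed at least
-- one block further, and the blocks run out.
omit h in
theorem not_sublist_of_blocked (l : List V) : ∀ (e : V) (v : List V),
    Blocked (l.map fun e c => c ≠ e) v → ¬ (e :: l).Sublist v := by
  induction l with
  | nil =>
    rintro e v hv hs
    obtain rfl : v = [] := hv
    simp at hs
  | cons f l ih =>
    rintro e v ⟨w₁, w₂, rfl, h1, h2⟩ hs
    refine ih f w₂ h2 ?_
    obtain ⟨a, b, he, ha, hb⟩ := List.sublist_append_iff.1 hs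
    rcases a with _ | ⟨e', a⟩
    · simp only [List.nil_append] at he
      rw [← he] at hb
      exact (List.sublist_cons_self _ _).trans hb
    · rcases a with _ | ⟨f', a⟩
      · simp only [List.cons_append, List.nil_append, List.cons.injEq] at he
        rwa [← he.2] at hb
      · simp only [List.cons_append, List.cons.injEq] at he
        exact absurd he.2.1.symm (h1 f' (ha.subset (by simp)))

-- Coherence gives a common chamber of any two consecutive classes along the chain, and inside the
-- class of colour `e` galleries avoid `e`.
omit h in
theorem exists_blocked_path {C : ∀ γ, Quotient (dual r γ)}
    (hC : ∀ γ δ, Γ.Adj γ δ → ∃ z : X, Quotient.mk _ z = C γ ∧ Quotient.mk _ z = C δ) {y : X}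
    (l : List V) : ∀ (ε : V) (x : X), (ε :: l).IsChain Γ.Adj →
      Quotient.mk (dual r ((ε :: l).getLast (by simp))) y = C _ → Quotient.mk _ x = C ε →
      ∃ v, Blocked ((ε :: l).map fun e c => c ≠ e) v ∧ ChamberPath r v x y := by
  induction l with
  | nil =>
    intro ε x _ hy hx
    obtain ⟨w, hw, hp⟩ := residue_iff.1 (Quotient.exact (hx.trans hy.symm))
    exact ⟨w, ⟨w, [], by simp, hw, rfl⟩, hp⟩
  | cons f l ih =>
    intro ε x hch hy hx
    rw [List.isChain_cons_cons] at hch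
    obtain ⟨z, hz1, hz2⟩ := hC ε f hch.1
    obtain ⟨w, hw, hp⟩ := residue_iff.1 (Quotient.exact (hx.trans hz1.symm))
    obtain ⟨v, hv, hp'⟩ := ih f z hch.2 (by rw [List.getLast_cons (by simp)] at hy; exact hy) hz2
    exact ⟨w ++ v, ⟨w, v, rfl, hw, hv⟩, hasPath_append.2 ⟨z, hp, hp'⟩⟩

/-- A coherent family of classes has a common chamber. -/
theorem exists_common_chamber [Finite V] (hX : Nonempty X) {C : ∀ γ, Quotient (dual r γ)}
    (hC : ∀ γ δ, Γ.Adj γ δ → ∃ z : X, Quotient.mk _ z = C γ ∧ Quotient.mk _ z = C δ) :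
    ∃ x : X, ∀ γ, Quotient.mk _ x = C γ := by
  let D : X → Set V := fun x => {γ | Quotient.mk _ x ≠ C γ}
  obtain ⟨x₀, hx₀⟩ : ∃ x₀, ∀ x, (D x₀).ncard ≤ (D x).ncard := by
    obtain ⟨_, ⟨x₀, rfl⟩, h2⟩ := Nat.lt_wfRel.wf.has_min (Set.range fun x => (D x).ncard)
      (Set.range_nonempty _)
    exact ⟨x₀, fun x => not_lt.1 (h2 _ ⟨x, rfl⟩)⟩
  refine ⟨x₀, fun δ => ?_⟩
  by_contra hδ
  obtain ⟨y₀, hy₀⟩ := Quotient.exists_rep (C δ)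
  obtain ⟨w₀, hw₀⟩ := h.connected x₀ y₀
  -- A shortest gallery into the missed class `C δ` among those that start at a chamber missing no
  -- more classes than `x₀`. With a constant rank the multiset order compares lengths.
  obtain ⟨⟨x, y, w⟩, ⟨hx, hy, hp⟩, hmin⟩ := exists_rank_min
    (fun t : X × X × List V => D t.1 ⊆ D x₀ ∧ Quotient.mk _ t.2.1 = C δ ∧
      ChamberPath r t.2.2 t.1 t.2.1) (fun t => wordRank (fun _ => 0) t.2.2)
    ⟨(x₀, y₀, w₀), Set.Subset.rfl, hy₀, hw₀⟩
  simp only at hx hy hp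
  have hDx : D x = D x₀ := Set.eq_of_subset_of_ncard_le hx (hx₀ x)
  have hred : Red (· = ·) (GenCommute Γ) w := by
    by_contra hr
    obtain ⟨w', h1, h2, -⟩ := h.stepSystem.reduce hr hp
    exact hmin (x, y, w') ⟨hx, hy, h1⟩ h2
  -- A final letter other than `δ` could be moved to the end and dropped without leaving `C δ`.
  have hfin : ∀ γ, IsFinal Γ γ w → γ = δ := by
    rintro γ ⟨p, q, rfl, hq⟩
    by_contra hne
    have hs : Swaps (GenCommute Γ) (p ++ γ :: q) (p ++ q ++ [γ]) := by
      simpa using swaps_move_right hq p []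
    have h1 : ChamberPath r (p ++ q ++ [γ]) x y := hs.hasPath h.swap hp
    obtain ⟨y', h2, h3⟩ := hasPath_append.1 h1
    refine hmin (x, y', p ++ q) ⟨hx, ?_, h2⟩ rankLT_delete
    rw [← hy]
    exact Quotient.sound (residue_of_path (by simpa using hne) h3)
  rcases w with _ | ⟨ε, w⟩
  · obtain rfl : x = y := hp
    exact absurd hy (by have : δ ∈ D x := hDx ▸ hδ
                        exact this)
  obtain ⟨x₁, h1, h2⟩ := hp
  -- A first step in a missed colour keeps all the other classes, so the gallery could start after
  -- it.
  by_cases hε : ε ∈ D x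
  · refine hmin (x₁, y, w) ⟨fun γ hγ => ?_, hy, h2⟩
      (by simpa using rankLT_delete (rank := fun _ : V => 0) (x := []) (b := ε) (y := w))
    by_contra hγx
    rw [← hDx] at hγx
    refine hγ ?_
    have hγε : ε ≠ γ := fun he => hγx (he ▸ hε)
    rw [← not_not.1 hγx]
    exact Quotient.sound ((dual r γ).symm' (residue_of_path (w := [ε]) (by simpa using hγε)
      ⟨x₁, h1, rfl⟩))
  -- Otherwise coherence yields a second gallery from `x` to `y` through the classes along a chain
  -- from `ε` to `δ` inside `w`. Its reduced form is a rearrangement of `w`, so it contains the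
  -- chain, but its blocks forbid this.
  · obtain ⟨l, hl1, hl2, hl3⟩ := exists_chain_of_final w ε hfin
    subst hl3
    obtain ⟨v, hv, hpv⟩ := exists_blocked_path hC l ε x hl2 hy (not_not.1 hε)
    obtain ⟨v', h3, h4, h5⟩ := h.stepSystem.exists_red hpv
    have h6 := h5.blocked (by
      intro P hP a b hab hb
      obtain rfl : a = b := hab
      exact hb) hv
    have h7 := h.swaps hred h4 ⟨x₁, h1, h2⟩ h3
    have h8 : (ε :: l).Sublist v' := by
      clear h3 h4 h5 h6
      induction h7 with
      | refl => exact hl1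
      | tail _ hs ih => exact sublist_of_swapStep hs hl2 ih
    obtain ⟨w₁, w₂, rfl, h9, h10⟩ := h6
    refine not_sublist_of_blocked l ε w₂ h10 ?_
    obtain ⟨a, b, he, ha, hb⟩ := List.sublist_append_iff.1 h8
    rcases a with _ | ⟨e', a⟩
    · simp only [List.nil_append] at he
      rwa [← he] at hb
    · simp only [List.cons_append, List.cons.injEq] at he
      exact absurd he.1.symm (h9 e' (ha.subset (by simp)))

end IsGallerySystem

end Building

/-! ### Existence of the countable rich building -/

section RichBuilding

variable {V : Type*} (Γ : SimpleGraph V)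

/-- The graph in which every vertex is replaced by countably many non-adjacent copies. -/
abbrev blowUp : SimpleGraph (V × ℕ) := Γ.comap Prod.fst

/-- The chambers of the rich building. -/
abbrev RichChamber : Type _ := (coxeterMatrix (blowUp Γ)).Group

/-- The generators of the group of chambers. -/
noncomputable abbrev gen (p : V × ℕ) : RichChamber Γ :=
  (coxeterMatrix (blowUp Γ)).toCoxeterSystem.simple p

/-- The stabilizer of a panel. -/
noncomputable def panelGroup (γ : V) : Subgroup (RichChamber Γ) :=
  Subgroup.closure (Set.range fun n : ℕ => gen Γ (γ, n))

/-- The equivalence relations of the rich building. -/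
noncomputable def richRel (γ : V) : Setoid (RichChamber Γ) := QuotientGroup.leftRel (panelGroup Γ γ)

/-- The product of copies of the generator `γ`. -/
noncomputable def panelProd (γ : V) (l : List ℕ) : RichChamber Γ :=
  (coxeterMatrix (blowUp Γ)).toCoxeterSystem.wordProd (l.map fun n => (γ, n))

variable {Γ}

theorem richRel_iff {γ : V} {x y : RichChamber Γ} :
    richRel Γ γ x y ↔ x⁻¹ * y ∈ panelGroup Γ γ := QuotientGroup.leftRel_apply

theorem genCommute_panel (γ : V) {n m : ℕ} (h : n ≠ m) :
    GenCommute (blowUp Γ) (γ, n) (γ, m) := ⟨by simpa using h, by simp⟩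

theorem panelProd_nil (γ : V) : panelProd Γ γ [] = 1 := CoxeterSystem.wordProd_nil _

theorem panelProd_cons (γ : V) (n : ℕ) (l : List ℕ) :
    panelProd Γ γ (n :: l) = gen Γ (γ, n) * panelProd Γ γ l := CoxeterSystem.wordProd_cons _ _ _

theorem commute_gen {p q : V × ℕ} (h : ¬ Γ.Adj p.1 q.1) : gen Γ p * gen Γ q = gen Γ q * gen Γ p := by
  by_cases hpq : p = q
  · rw [hpq]
  · exact simple_mul_comm ⟨hpq, h⟩

theorem panelProd_delete (γ : V) (l : List ℕ) (n : ℕ) (hn : n ∈ l) :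
    ∃ l' : List ℕ, l'.Sublist l ∧ panelProd Γ γ l = gen Γ (γ, n) * panelProd Γ γ l' := by
  induction l with
  | nil => simp at hn
  | cons m l ih =>
    by_cases h : m = n
    · exact ⟨l, List.sublist_cons_self _ _, by rw [panelProd_cons, h]⟩
    · obtain ⟨l', h1, h2⟩ := ih (by simpa [Ne.symm h] using hn)
      refine ⟨m :: l', h1.cons_cons _, ?_⟩
      rw [panelProd_cons, h2, panelProd_cons, ← mul_assoc, ← mul_assoc, commute_gen (by simp)]

/-- The copies of `γ` are commuting involutions, so repeated factors cancel. -/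
theorem exists_panelProd {γ : V} {g : RichChamber Γ} (hg : g ∈ panelGroup Γ γ) :
    ∃ l : List ℕ, l.Nodup ∧ g = panelProd Γ γ l := by
  have key : ∀ (n : ℕ) (g : RichChamber Γ), (∃ l : List ℕ, l.Nodup ∧ g = panelProd Γ γ l) →
      ∃ l : List ℕ, l.Nodup ∧ gen Γ (γ, n) * g = panelProd Γ γ l := by
    rintro n g ⟨l, hl, rfl⟩
    by_cases hn : n ∈ l
    · obtain ⟨l', h1, h2⟩ := panelProd_delete (Γ := Γ) γ l n hn
      exact ⟨l', hl.sublist h1, by rw [h2, CoxeterSystem.simple_mul_simple_cancel_left]⟩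
    · exact ⟨n :: l, List.nodup_cons.2 ⟨hn, hl⟩, by rw [panelProd_cons]⟩
  induction hg using Subgroup.closure_induction_left with
  | one => exact ⟨[], List.nodup_nil, (panelProd_nil γ).symm⟩
  | mul_left x hx y hy ih =>
    obtain ⟨n, rfl⟩ := hx
    exact key n y ih
  | inv_mul_cancel x hx y hy ih =>
    obtain ⟨n, rfl⟩ := hx
    rw [CoxeterSystem.inv_simple]
    exact key n y ih

/-- Distinct copies of `γ` do not affect each other's coordinates, so each reflection is applied at
a positive coordinate and `Positive.reflect` can be iterated. -/
theorem act_panelProd {γ : V} (l : List ℕ) : ∀ (f : V × ℕ → ℤ), Positive (blowUp Γ) f → l.Nodup →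
    (∀ n ∈ l, 0 < f (γ, n)) → Positive (blowUp Γ) (act (panelProd Γ γ l) f) ∧
      (∀ n ∉ l, act (panelProd Γ γ l) f (γ, n) = f (γ, n)) ∧
      (∀ n ∈ l, act (panelProd Γ γ l) f (γ, n) < 0) ∧
      ∀ p, act (panelProd Γ γ l) f p < 0 →
        p.1 = γ ∨ (f p < 0 ∧ (l = [] ∨ GenCommute Γ γ p.1)) := by
  induction l with
  | nil =>
    intro f hf _ _
    rw [panelProd_nil, act_one]
    exact ⟨hf, fun _ _ => rfl, by simp, fun p hp => Or.inr ⟨hp, Or.inl rfl⟩⟩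
  | cons n l ih =>
    intro f hf hl hpos
    rw [List.nodup_cons] at hl
    obtain ⟨h1, h2⟩ := hf.reflect (hpos n (by simp))
    have hne : ∀ m, m ≠ n → reflect (blowUp Γ) (γ, n) f (γ, m) = f (γ, m) := fun m hm =>
      reflect_comm (genCommute_panel γ (Ne.symm hm)) f
    obtain ⟨h3, h4, h5, h6⟩ := ih (reflect (blowUp Γ) (γ, n) f) h1 hl.2 (fun m hm => by
      rw [hne m (fun h => hl.1 (h ▸ hm))]
      exact hpos m (by simp [hm]))
    rw [panelProd_cons, act_mul, act_simple]
    refine ⟨h3, fun m hm => ?_, fun m hm => ?_, fun p hp => ?_⟩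
    · simp only [List.mem_cons, not_or] at hm
      rw [h4 m hm.2, hne m hm.1]
    · rcases List.mem_cons.1 hm with rfl | hm
      · rw [h4 m hl.1, reflect_self]
        have := hpos m (by simp)
        omega
      · exact h5 m hm
    · rcases h6 p hp with h7 | ⟨h7, -⟩
      · exact Or.inl h7
      · rcases h2 p h7 with rfl | ⟨h8, h9⟩
        · exact Or.inl rfl
        · by_cases hp1 : p.1 = γ
          · exact Or.inl hp1
          · exact Or.inr ⟨h9, Or.inr ⟨Ne.symm hp1, h8.2⟩⟩

/-- The analogue of `act_wordProd_red` for galleries: a step of type `γ` multiplies by a non-empty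
product of copies of `γ`, all of whose coordinates are positive before, as `γ` is not final. It
excludes closed reduced galleries. -/
theorem act_red_path (w : List V) (hw : Red (· = ·) (GenCommute Γ) w) : ∀ x y : RichChamber Γ,
    ChamberPath (richRel Γ) w x y → Positive (blowUp Γ) (act (x⁻¹ * y) 1) ∧
      (∀ p, act (x⁻¹ * y) 1 p < 0 → IsFinal Γ p.1 w) ∧
      (w ≠ [] → ∃ p, act (x⁻¹ * y) 1 p < 0) := by
  induction w using List.reverseRecOn with
  | nil =>
    intro x y h
    obtain rfl : x = y := h
    rw [inv_mul_cancel, act_one]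
    exact ⟨⟨by simp, by simp⟩, fun p hp => absurd hp (by simp), fun h => absurd rfl h⟩
  | append_singleton w γ ih =>
    intro x y h
    obtain ⟨z, h1, h2⟩ := hasPath_append.1 h
    rw [hasPath_singleton] at h2
    obtain ⟨h3, h4, -⟩ := ih hw.left x z h1
    obtain ⟨l, hl, hzy⟩ := exists_panelProd (richRel_iff.1 h2.2)
    have hl0 : l ≠ [] := by
      rintro rfl
      rw [panelProd_nil, inv_mul_eq_one] at hzy
      exact h2.1 hzy
    have hxy : x⁻¹ * y = (x⁻¹ * z) * panelProd Γ γ l := by rw [← hzy]; group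
    rw [hxy, act_mul]
    obtain ⟨h5, -, h6, h7⟩ := act_panelProd (γ := γ) l (act (x⁻¹ * z) 1) h3 hl (fun n _ => by
      rcases lt_trichotomy (act (x⁻¹ * z) 1 (γ, n)) 0 with h | h | h
      · exact absurd (h4 _ h) (not_isFinal_of_red hw)
      · exact absurd h (h3.1 _)
      · exact h)
    refine ⟨h5, fun p hp => ?_, fun _ => ?_⟩
    · rcases h7 p hp with h8 | ⟨h8, h9⟩
      · rw [h8]; exact isFinal_concat γ w
      · exact (h4 p h8).concat (h9.resolve_left hl0)
    · obtain ⟨n, hn⟩ := List.exists_mem_of_ne_nil l hl0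
      exact ⟨_, h6 n hn⟩

theorem gen_injective : Function.Injective (gen Γ) := by
  intro p q hpq
  by_contra hne
  have h := congrFun (congrArg (fun g => act g (1 : V × ℕ → ℤ)) hpq) p
  simp only [act_simple, reflect_self] at h
  rcases trichotomy (blowUp Γ) q p with h1 | h1 | h1
  · exact hne h1
  · rw [reflect_adj h1] at h; simp at h
  · rw [reflect_comm h1] at h; simp at h

theorem gen_ne_one (p : V × ℕ) : gen Γ p ≠ 1 := by
  intro hp
  have h := congrFun (congrArg (fun g => act g (1 : V × ℕ → ℤ)) hp) p
  simp only [act_simple, reflect_self, act_one] at h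
  simp at h

theorem gen_mem (γ : V) (n : ℕ) : gen Γ (γ, n) ∈ panelGroup Γ γ :=
  Subgroup.subset_closure ⟨n, rfl⟩

theorem isGallerySystem_richRel : IsGallerySystem Γ (richRel Γ) where
  swap := by
    rintro γ δ x y z hc ⟨h1, h2⟩ ⟨h3, h4⟩
    rw [richRel_iff] at h2 h4
    have hcomm : ∀ g ∈ panelGroup Γ γ, ∀ h ∈ panelGroup Γ δ, g * h = h * g := by
      intro g hg h hh
      obtain ⟨l, -, rfl⟩ := exists_panelProd hg
      obtain ⟨l', -, rfl⟩ := exists_panelProd hh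
      refine Commute.list_prod_left _ _ fun a ha => Commute.list_prod_right _ _ fun b hb => ?_
      simp only [List.mem_map] at ha hb
      obtain ⟨_, ⟨n, -, rfl⟩, rfl⟩ := ha
      obtain ⟨_, ⟨m, -, rfl⟩, rfl⟩ := hb
      exact commute_gen hc.2
    have key := hcomm _ h2 _ h4
    refine ⟨x * (y⁻¹ * z), ⟨fun h => h3 ?_, ?_⟩, ⟨fun h => h1 ?_, ?_⟩⟩
    · rwa [left_eq_mul, inv_mul_eq_one] at h
    · rw [richRel_iff]; simpa using h4
    · rwa [← mul_assoc, mul_eq_right, mul_inv_eq_one] at h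
    · rw [richRel_iff]
      have : (x * (y⁻¹ * z))⁻¹ * z = x⁻¹ * y := by
        rw [mul_inv_rev, mul_assoc, inv_mul_eq_iff_eq_mul, ← key]; group
      rw [this]; exact h2
  connected x y := by
    obtain ⟨L, hL⟩ := (coxeterMatrix (blowUp Γ)).toCoxeterSystem.wordProd_surjective (x⁻¹ * y)
    refine ⟨L.map Prod.fst, ?_⟩
    induction L generalizing x with
    | nil =>
      rw [CoxeterSystem.wordProd_nil, eq_comm, inv_mul_eq_one] at hL
      exact hL
    | cons p L ih =>
      rw [CoxeterSystem.wordProd_cons] at hL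
      refine ⟨x * gen Γ p, ⟨fun h => gen_ne_one p (left_eq_mul.1 h), ?_⟩, ih _ ?_⟩
      · rw [richRel_iff]; simpa using gen_mem p.1 p.2
      · rw [mul_inv_rev, mul_assoc, ← hL, CoxeterSystem.inv_simple,
          CoxeterSystem.simple_mul_simple_cancel_left]
  closed w x hw hp := by
    by_contra hne
    obtain ⟨-, -, h⟩ := act_red_path w hw x x hp
    obtain ⟨p, hp⟩ := h hne
    rw [inv_mul_cancel, act_one] at hp
    simp at hp

theorem rich_richRel (γ : V) (x : RichChamber Γ) : {y | richRel Γ γ x y}.Infinite := by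
  refine Set.infinite_of_injective_forall_mem (f := fun n : ℕ => x * gen Γ (γ, n)) ?_ ?_
  · intro n m h
    have := gen_injective (mul_left_cancel h)
    simpa using this
  · intro n
    change richRel Γ γ _ _
    rw [richRel_iff]
    simpa using gen_mem γ n

/-- Countable rich buildings exist. -/
theorem isCountableRichBuilding_richRel [Finite V] : IsCountableRichBuilding Γ (richRel Γ) where
  isBuilding := isGallerySystem_richRel.isBuilding ⟨1⟩ fun γ x => by
    obtain ⟨y, hy, hne⟩ := (rich_richRel γ x).exists_notMem_finset {x}
    exact ⟨y, by simpa using hne, hy⟩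
  countable := (coxeterMatrix (blowUp Γ)).toCoxeterSystem.wordProd_surjective.countable
  rich := rich_richRel

end RichBuilding

/-! ### Flags -/

section Flags

variable {V : Type*} {Γ : SimpleGraph V} {M : Type*} [(lang V).Structure M]

theorem diffColours_self (F : Flag Γ M) : diffColours F F = ∅ := by simp [diffColours]

theorem diffColours_comm (F G : Flag Γ M) : diffColours F G = diffColours G F := by
  ext γ; simp [diffColours, eq_comm]

theorem diffColours_subset_iff {F G : Flag Γ M} {s : Set V} :
    diffColours F G ⊆ s ↔ ∀ γ ∉ s, F.vertex γ = G.vertex γ := by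
  simp only [diffColours, Set.subset_def, Set.mem_ofPred_eq]
  exact forall_congr' fun γ => not_imp_comm

theorem eq_of_diffColours_subset_empty {F G : Flag Γ M} (h : diffColours F G ⊆ ∅) : F = G :=
  Flag.ext (funext fun γ => diffColours_subset_iff.1 h γ (by simp))

theorem diffColours_trans {F G H : Flag Γ M} {s : Set V} (h : diffColours F G ⊆ s)
    (h' : diffColours G H ⊆ s) : diffColours F H ⊆ s := by
  rw [diffColours_subset_iff] at *
  exact fun γ hγ => (h γ hγ).trans (h' γ hγ)

theorem diffColours_symm {F G : Flag Γ M} {s : Set V} (h : diffColours F G ⊆ s) :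
    diffColours G F ⊆ s := by rwa [diffColours_comm]

open Classical in
/-- The flag that agrees with `G` on `s` and with `F` elsewhere. -/
noncomputable def mixFlag (hM : IsGammaGraph Γ M) (s : Set V) (F G : Flag Γ M)
    (h : ∀ γ ∈ s, ∀ δ ∉ s, Γ.Adj γ δ → F.vertex γ = G.vertex γ ∨ F.vertex δ = G.vertex δ) :
    Flag Γ M where
  vertex γ := if γ ∈ s then G.vertex γ else F.vertex γ
  hasColour γ := by
    by_cases hγ : γ ∈ s
    · simp only [hγ, if_true]; exact G.hasColour γ
    · simp only [hγ, if_false]; exact F.hasColour γ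
  adj_iff γ δ := by
    have key : ∀ γ ∈ s, ∀ δ ∉ s, (Adj V (G.vertex γ) (F.vertex δ) ↔ Γ.Adj γ δ) := by
      intro γ hγ δ hδ
      refine ⟨hM.adj_colour _ _ _ _ (G.hasColour γ) (F.hasColour δ), fun hadj => ?_⟩
      rcases h γ hγ δ hδ hadj with h | h
      · rw [← h, F.adj_iff]; exact hadj
      · rw [h, G.adj_iff]; exact hadj
    by_cases hγ : γ ∈ s <;> by_cases hδ : δ ∈ s
    · simp only [hγ, hδ, if_true]; exact G.adj_iff γ δ
    · simp only [hγ, hδ, if_true, if_false]; exact key γ hγ δ hδ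
    · simp only [hγ, hδ, if_true, if_false]
      rw [Γ.adj_comm, ← key δ hδ γ hγ]
      exact ⟨hM.symm _ _, hM.symm _ _⟩
    · simp only [hγ, hδ, if_false]; exact F.adj_iff γ δ

section mix
variable {hM : IsGammaGraph Γ M} {s : Set V} {F G : Flag Γ M}
    {h : ∀ γ ∈ s, ∀ δ ∉ s, Γ.Adj γ δ → F.vertex γ = G.vertex γ ∨ F.vertex δ = G.vertex δ}

theorem mixFlag_mem {γ : V} (hγ : γ ∈ s) : (mixFlag hM s F G h).vertex γ = G.vertex γ := by
  simp [mixFlag, hγ]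

theorem mixFlag_notMem {γ : V} (hγ : γ ∉ s) : (mixFlag hM s F G h).vertex γ = F.vertex γ := by
  simp [mixFlag, hγ]

theorem diffColours_mixFlag_left : diffColours F (mixFlag hM s F G h) ⊆ s :=
  diffColours_subset_iff.2 fun _ hγ => (mixFlag_notMem hγ).symm

theorem diffColours_mixFlag_right {t : Set V} (ht : diffColours F G ⊆ s ∪ t) :
    diffColours (mixFlag hM s F G h) G ⊆ t := by
  rw [diffColours_subset_iff] at *
  intro γ hγ
  by_cases hs : γ ∈ s
  · exact mixFlag_mem hs
  · rw [mixFlag_notMem hs]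
    exact ht γ (by simp [hs, hγ])

end mix

/-- Exchange two changes of a flag at commuting sets of colours. -/
theorem exists_swap_flag (hM : IsGammaGraph Γ M) {s t : Set V} (hst : LetterCommute Γ s t)
    {F G H : Flag Γ M} (h1 : diffColours F G ⊆ s) (h2 : diffColours G H ⊆ t) :
    ∃ G' : Flag Γ M, diffColours F G' ⊆ t ∧ diffColours G' H ⊆ s ∧
      (∀ γ ∈ t, G'.vertex γ = H.vertex γ) ∧ ∀ γ ∉ t, G'.vertex γ = F.vertex γ := by
  rw [diffColours_subset_iff] at h1 h2
  refine ⟨mixFlag hM t F H fun γ hγ δ hδ hadj => Or.inr ?_, diffColours_mixFlag_left,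
    diffColours_mixFlag_right ?_, fun γ => mixFlag_mem, fun γ => mixFlag_notMem⟩
  · have hδs : δ ∉ s := fun hδs => (hst δ hδs γ hγ).2 hadj.symm
    rw [h1 δ hδs, h2 δ hδ]
  · rw [diffColours_subset_iff]
    intro γ hγ
    simp only [Set.mem_union, not_or] at hγ
    rw [h1 γ hγ.2, h2 γ hγ.1]

/-- `F` and `G` are connected by `n` steps that each change the flag only at a set of colours in
`𝒯`. -/
def Chain (𝒯 : Set (Set V)) : ℕ → Flag Γ M → Flag Γ M → Prop
  | 0, F, G => F = G
  | n + 1, F, G => ∃ H, (∃ t ∈ 𝒯, diffColours F H ⊆ t) ∧ Chain 𝒯 n H G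

theorem Chain.trans {𝒯 : Set (Set V)} {m n : ℕ} {F G H : Flag Γ M} (h : Chain 𝒯 m F G)
    (h' : Chain 𝒯 n G H) : Chain 𝒯 (n + m) F H := by
  induction m generalizing F with
  | zero => obtain rfl : F = G := h; exact h'
  | succ m ih =>
    obtain ⟨K, h1, h2⟩ := h
    exact ⟨K, h1, ih h2⟩

theorem Chain.single {𝒯 : Set (Set V)} {F G : Flag Γ M} {t : Set V} (ht : t ∈ 𝒯)
    (h : diffColours F G ⊆ t) : Chain 𝒯 1 F G := ⟨G, ⟨t, ht, h⟩, rfl⟩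

theorem Chain.symm {𝒯 : Set (Set V)} {n : ℕ} {F G : Flag Γ M} (h : Chain 𝒯 n F G) :
    Chain 𝒯 n G F := by
  induction n generalizing F with
  | zero => exact Eq.symm h
  | succ n ih =>
    obtain ⟨K, ⟨t, ht, h1⟩, h2⟩ := h
    have := (ih h2).trans (Chain.single ht (diffColours_symm h1))
    rwa [add_comm] at this

theorem Chain.mono {𝒯 : Set (Set V)} (h0 : 𝒯.Nonempty) {m n : ℕ} (hmn : m ≤ n) {F G : Flag Γ M}
    (h : Chain 𝒯 m F G) : Chain 𝒯 n F G := by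
  obtain ⟨t, ht⟩ := h0
  induction hmn with
  | refl => exact h
  | step _ ih => exact ⟨F, ⟨t, ht, by simp [diffColours_self]⟩, ih⟩

theorem Chain.diffColours_subset {𝒯 : Set (Set V)} {s : Set V} (hs : ∀ t ∈ 𝒯, t ⊆ s) {n : ℕ}
    {F G : Flag Γ M} (h : Chain 𝒯 n F G) : diffColours F G ⊆ s := by
  induction n generalizing F with
  | zero => obtain rfl : F = G := h; simp [diffColours_self]
  | succ n ih =>
    obtain ⟨H, ⟨t, ht, h1⟩, h2⟩ := h
    exact diffColours_trans (h1.trans (hs t ht)) (ih h2)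

theorem Chain.mono_set {𝒯 𝒯' : Set (Set V)} (h𝒯 : 𝒯 ⊆ 𝒯') {n : ℕ} {F G : Flag Γ M}
    (h : Chain 𝒯 n F G) : Chain 𝒯' n F G := by
  induction n generalizing F with
  | zero => exact h
  | succ n ih =>
    obtain ⟨K, ⟨t, ht, h1⟩, h2⟩ := h
    exact ⟨K, ⟨t, h𝒯 ht, h1⟩, ih h2⟩

/-- The pairs `(F, G)` and `(F', G')` agree on `t`, and on the neighbours of `t`. -/
structure Parallel (t : Set V) (F G F' G' : Flag Γ M) : Prop where
  left : diffColours F G ⊆ t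
  right : diffColours F' G' ⊆ t
  source : ∀ γ ∈ t, F.vertex γ = F'.vertex γ
  target : ∀ γ ∈ t, G.vertex γ = G'.vertex γ
  boundary : ∀ γ ∈ t, ∀ δ ∉ t, Γ.Adj γ δ → F.vertex δ = F'.vertex δ

theorem Parallel.symm {t : Set V} {F G F' G' : Flag Γ M} (h : Parallel t F G F' G') :
    Parallel t F' G' F G :=
  ⟨h.right, h.left, fun γ hγ => (h.source γ hγ).symm, fun γ hγ => (h.target γ hγ).symm,
    fun γ hγ δ hδ ha => (h.boundary γ hγ δ hδ ha).symm⟩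

/-- The vertices in `t` of each intermediate flag are planted into `F'`; agreement at the neighbours
of `t` makes the mixture a flag. So whether a step splits depends only on `t` and its neighbours. -/
theorem Parallel.chain (hM : IsGammaGraph Γ M) {t : Set V} {F G F' G' : Flag Γ M}
    (h : Parallel t F G F' G') {𝒯 : Set (Set V)} (h𝒯 : ∀ s ∈ 𝒯, s ⊆ t) {n : ℕ}
    (hc : Chain 𝒯 n F G) : Chain 𝒯 n F' G' := by
  induction n generalizing F F' with
  | zero =>
    obtain rfl : F = G := hc
    refine Flag.ext (funext fun γ => ?_)
    by_cases hγ : γ ∈ t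
    · rw [← h.source γ hγ, ← h.target γ hγ]
    · exact diffColours_subset_iff.1 h.right γ hγ
  | succ n ih =>
    obtain ⟨H, ⟨s, hs, h1⟩, h2⟩ := hc
    have hFH : ∀ γ ∉ t, F.vertex γ = H.vertex γ :=
      diffColours_subset_iff.1 (h1.trans (h𝒯 s hs))
    have hmix : ∀ γ ∈ t, ∀ δ ∉ t, Γ.Adj γ δ →
        F'.vertex γ = H.vertex γ ∨ F'.vertex δ = H.vertex δ := fun γ hγ δ hδ ha =>
      Or.inr ((h.boundary γ hγ δ hδ ha).symm.trans (hFH δ hδ))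
    refine ⟨mixFlag hM t F' H hmix, ⟨s, hs, ?_⟩, ih ⟨?_, ?_, fun γ hγ => ?_, h.target, ?_⟩ h2⟩
    · rw [diffColours_subset_iff] at h1 ⊢
      intro γ hγ
      by_cases hγt : γ ∈ t
      · rw [mixFlag_mem hγt, ← h1 γ hγ, h.source γ hγt]
      · rw [mixFlag_notMem hγt]
    · exact diffColours_trans (diffColours_symm (diffColours_subset_iff.2 hFH)) h.left
    · exact diffColours_trans (diffColours_symm diffColours_mixFlag_left) h.right
    · rw [mixFlag_mem hγ]
    · intro γ hγ δ hδ ha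
      rw [mixFlag_notMem hδ, ← hFH δ hδ]
      exact h.boundary γ hγ δ hδ ha

/-- The proper subsets of a letter. -/
abbrev properSubsets (s : Set V) : Set (Set V) := {t | t ⊂ s}

theorem IsLetter.nonempty {s : Set V} (h : IsLetter Γ s) : s.Nonempty := by
  obtain ⟨x⟩ := SimpleGraph.Connected.nonempty h
  exact ⟨x.1, x.2⟩

theorem IsLetter.properSubsets_nonempty {s : Set V} (h : IsLetter Γ s) :
    (properSubsets s).Nonempty := ⟨∅, Set.empty_ssubset.2 h.nonempty⟩

theorem isLetter_singleton (γ : V) : IsLetter Γ {γ} := by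
  have : Subsingleton ({γ} : Set V) := by simp
  exact @SimpleGraph.Connected.mk _ _ SimpleGraph.Preconnected.of_subsingleton ⟨⟨γ, rfl⟩⟩

/-- A set of colours has a connected component. -/
theorem exists_component (D : Set V) {γ : V} (hγ : γ ∈ D) :
    ∃ s : Set V, γ ∈ s ∧ s ⊆ D ∧ IsLetter Γ s ∧ ∀ δ ∈ s, ∀ ε ∈ D, Γ.Adj δ ε → ε ∈ s := by
  let s : Set V := {δ | ∃ h : δ ∈ D, Relation.ReflTransGen (Γ.induce D).Adj ⟨γ, hγ⟩ ⟨δ, h⟩}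
  have hγs : γ ∈ s := ⟨hγ, .refl⟩
  refine ⟨s, hγs, fun δ h => h.1, ?_, fun δ ⟨h1, h2⟩ ε hε hadj => ⟨hε, h2.tail hadj⟩⟩
  have key : ∀ x : D, Relation.ReflTransGen (Γ.induce D).Adj ⟨γ, hγ⟩ x →
      ∃ hx : x.1 ∈ s, (Γ.induce s).Reachable ⟨γ, hγs⟩ ⟨x.1, hx⟩ := by
    intro x hx
    induction hx with
    | refl => exact ⟨hγs, SimpleGraph.Reachable.refl _⟩
    | @tail y z hy hyz ih =>
      obtain ⟨h1, h2⟩ := ih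
      have hz : z.1 ∈ s := ⟨z.2, hy.tail hyz⟩
      refine ⟨hz, h2.trans (SimpleGraph.Adj.reachable ?_)⟩
      exact hyz
  have : Nonempty s := ⟨⟨γ, hγs⟩⟩
  refine SimpleGraph.Connected.mk fun x y => ?_
  obtain ⟨_, h1⟩ := key ⟨x.1, x.2.1⟩ x.2.2
  obtain ⟨_, h2⟩ := key ⟨y.1, y.2.1⟩ y.2.2
  exact h1.symm.trans h2

/-- The connected components of the set of differing colours can be changed one after another, since
`Γ` has no edges between them. -/
theorem exists_weakFlagPath [Finite V] (hM : IsGammaGraph Γ M) (F G : Flag Γ M) :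
    ∃ u : List (Set V), (∀ t ∈ u, t ⊆ diffColours F G) ∧ WeakFlagPath u F G := by
  induction hn : (diffColours F G).ncard using Nat.strong_induction_on generalizing F with
  | _ n ih =>
  rcases Set.eq_empty_or_nonempty (diffColours F G) with h | ⟨γ, hγ⟩
  · exact ⟨[], by simp, eq_of_diffColours_subset_empty h.le⟩
  obtain ⟨s, hγs, hsD, hs, hclosed⟩ := exists_component (Γ := Γ) _ hγ
  have hmix : ∀ δ ∈ s, ∀ ε ∉ s, Γ.Adj δ ε →
      F.vertex δ = G.vertex δ ∨ F.vertex ε = G.vertex ε := fun δ hδ ε hε ha => by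
    by_contra hne
    push Not at hne
    exact hε (hclosed δ hδ ε hne.2 ha)
  set H := mixFlag hM s F G hmix
  have hd : diffColours H G ⊆ diffColours F G \ s :=
    diffColours_mixFlag_right (by simp)
  have hlt : (diffColours H G).ncard < n := by
    rw [← hn]
    refine Set.ncard_lt_ncard (ssubset_of_subset_of_ne (hd.trans Set.sdiff_subset) ?_)
    intro he
    exact (hd (he ▸ hγ)).2 hγs
  obtain ⟨u, hu, hp⟩ := ih _ hlt H rfl
  refine ⟨s :: u, ?_, H, ⟨hs, ?_⟩, hp⟩
  · intro t ht
    rcases List.mem_cons.1 ht with rfl | ht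
    · exact hsD
    · exact (hu t ht).trans (hd.trans Set.sdiff_subset)
  · refine diffColours_mixFlag_left.antisymm fun δ hδ => ?_
    change F.vertex δ ≠ H.vertex δ
    rw [mixFlag_mem hδ]
    exact hsD hδ

theorem WeakFlagPath.chain {𝒯 : Set (Set V)} {u : List (Set V)} (hu : ∀ t ∈ u, t ∈ 𝒯)
    {F G : Flag Γ M} (h : WeakFlagPath u F G) : Chain 𝒯 u.length F G := by
  induction u generalizing F with
  | nil => exact h
  | cons t u ih =>
    obtain ⟨H, h1, h2⟩ := h
    exact ⟨H, ⟨t, hu t (by simp), h1.2.le⟩, ih (fun t ht => hu t (by simp [ht])) h2⟩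

theorem Chain.exists_weakFlagPath [Finite V] (hM : IsGammaGraph Γ M) {𝒯 : Set (Set V)} {n : ℕ}
    {F G : Flag Γ M} (h : Chain 𝒯 n F G) :
    ∃ u : List (Set V), (∀ s ∈ u, ∃ t ∈ 𝒯, s ⊆ t) ∧ WeakFlagPath u F G := by
  induction n generalizing F with
  | zero => exact ⟨[], by simp, h⟩
  | succ n ih =>
    obtain ⟨H, ⟨t, ht, h1⟩, h2⟩ := h
    obtain ⟨u, hu, hp⟩ := RABuilding.exists_weakFlagPath hM F H
    obtain ⟨v, hv, hp'⟩ := ih h2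
    refine ⟨u ++ v, fun s hs => ?_, hasPath_append.2 ⟨H, hp, hp'⟩⟩
    rcases List.mem_append.1 hs with hs | hs
    · exact ⟨t, ht, (hu s hs).trans h1⟩
    · exact hv s hs

/-- Any change can be split into connected components, so the connectedness of the letters of a
splitting is immaterial. That the flags differ on all of `s` is automatic, as otherwise a single
change at a proper subset would do. -/
theorem flagStep_iff [Finite V] (hM : IsGammaGraph Γ M) {s : Set V} {F G : Flag Γ M} :
    FlagStep s F G ↔ IsLetter Γ s ∧ diffColours F G ⊆ s ∧
      ∀ n, ¬ Chain (properSubsets s) n F G := by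
  constructor
  · rintro ⟨⟨h1, h2⟩, h3⟩
    refine ⟨h1, h2.le, fun n hc => ?_⟩
    obtain ⟨u, hu, hp⟩ := hc.exists_weakFlagPath hM
    exact h3 ⟨u, fun t ht => by
      obtain ⟨t', ht', hle⟩ := hu t ht
      exact lt_of_le_of_lt hle ht', hp⟩
  · rintro ⟨h1, h2, h3⟩
    refine ⟨⟨h1, ?_⟩, fun ⟨u, hu, hp⟩ => h3 _ (WeakFlagPath.chain hu hp)⟩
    by_contra hne
    exact h3 1 (Chain.single (ssubset_of_subset_of_ne h2 hne) le_rfl)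

theorem Parallel.flagStep [Finite V] (hM : IsGammaGraph Γ M) {t : Set V} {F G F' G' : Flag Γ M}
    (h : Parallel t F G F' G') (hs : FlagStep t F G) : FlagStep t F' G' := by
  rw [flagStep_iff hM] at hs ⊢
  exact ⟨hs.1, h.right, fun n hc => hs.2.2 n (h.symm.chain hM (fun s hs => hs.subset) hc)⟩

theorem LetterCommute.symm {s t : Set V} (h : LetterCommute Γ s t) : LetterCommute Γ t s :=
  fun γ hγ δ hδ => (h δ hδ γ hγ).symm

theorem LetterCommute.mono {s s' t t' : Set V} (h : LetterCommute Γ s t) (hs : s' ⊆ s)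
    (ht : t' ⊆ t) : LetterCommute Γ s' t' := fun γ hγ δ hδ => h γ (hs hγ) δ (ht hδ)

theorem LetterCommute.notMem {s t : Set V} (h : LetterCommute Γ s t) {γ : V} (hγ : γ ∈ s) :
    γ ∉ t := fun ht => (h γ hγ γ ht).1 rfl

variable (Γ) in
/-- The letters. -/
abbrev Letter : Type _ := {s : Set V // IsLetter Γ s}

/-- The commutation relation on letters. -/
abbrev LetterComm (a b : Letter Γ) : Prop := LetterCommute Γ a.1 b.1

/-- The number of elements of a letter. -/
noncomputable abbrev letterRank (a : Letter Γ) : ℕ := a.1.ncard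

/-- Steps of flag paths. -/
abbrev LetterStep (a : Letter Γ) (F G : Flag Γ M) : Prop := FlagStep a.1 F G

theorem diffColours_of_path {t : Set V} {u : List (Letter Γ)} (hu : ∀ a ∈ u, a.1 ⊆ t)
    {F G : Flag Γ M} (h : HasPath LetterStep u F G) : diffColours F G ⊆ t := by
  induction u generalizing F with
  | nil => obtain rfl : F = G := h; simp [diffColours_self]
  | cons a u ih =>
    obtain ⟨H, h1, h2⟩ := h
    exact diffColours_trans (h1.1.2.le.trans (hu a (by simp)))
      (ih (fun b hb => hu b (by simp [hb])) h2)

theorem letterSystem [Finite V] : LetterSystem (Letter Γ) LetterComm letterRank where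
  symm _ _ h := h.symm
  irrefl a h := by
    obtain ⟨γ, hγ⟩ := a.2.nonempty
    exact h.notMem hγ hγ
  mono a b c hab h := h.mono hab subset_rfl
  rank_lt a b h := Set.ncard_lt_ncard h

variable [Finite V] (hM : IsGammaGraph Γ M)
include hM

omit [Finite V] hM in
theorem exists_path_of_weakStep {t : Set V}
    (ih : ∀ s ⊂ t, ∀ F G : Flag Γ M, diffColours F G ⊆ s →
      ∃ u : List (Letter Γ), (∀ a ∈ u, a.1 ⊆ s) ∧ HasPath LetterStep u F G)
    {u : List (Set V)} (hu : ∀ s ∈ u, s ⊂ t) {F G : Flag Γ M} (h : WeakFlagPath u F G) :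
    ∃ u : List (Letter Γ), (∀ a ∈ u, a.1 ⊂ t) ∧ HasPath LetterStep u F G := by
  induction u generalizing F with
  | nil => exact ⟨[], by simp, h⟩
  | cons s u ihu =>
    obtain ⟨H, h1, h2⟩ := h
    obtain ⟨v, hv, hp⟩ := ih s (hu s (by simp)) F H h1.2.le
    obtain ⟨v', hv', hp'⟩ := ihu (fun s hs => hu s (by simp [hs])) h2
    refine ⟨v ++ v', fun a ha => ?_, hasPath_append.2 ⟨H, hp, hp'⟩⟩
    rcases List.mem_append.1 ha with ha | ha
    · exact lt_of_le_of_lt (hv a ha) (hu s (by simp))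
    · exact hv' a ha

/-- Flags that differ only at colours in `t` are connected by a flag path with letters contained
in `t`. -/
theorem exists_path_of_diffColours (t : Set V) : ∀ F G : Flag Γ M, diffColours F G ⊆ t →
    ∃ u : List (Letter Γ), (∀ a ∈ u, a.1 ⊆ t) ∧ HasPath LetterStep u F G := by
  induction t using (wellFounded_lt (α := Set V)).induction with
  | _ t ih =>
  intro F G hFG
  obtain ⟨u, hu, hp⟩ := exists_weakFlagPath hM F G
  replace hu : ∀ s ∈ u, s ⊆ t := fun s hs => (hu s hs).trans hFG
  clear hFG
  induction u generalizing F with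
  | nil => exact ⟨[], by simp, hp⟩
  | cons s u ihu =>
    obtain ⟨H, h1, h2⟩ := hp
    obtain ⟨v', hv', hp'⟩ := ihu H h2 fun s hs => hu s (by simp [hs])
    have : ∃ v : List (Letter Γ), (∀ a ∈ v, a.1 ⊆ t) ∧ HasPath LetterStep v F H := by
      by_cases hs : FlagStep s F H
      · exact ⟨[⟨s, h1.1⟩], by simpa using hu s (by simp), hasPath_singleton.2 hs⟩
      · have hw : ∃ u : List (Set V), (∀ t ∈ u, t ⊂ s) ∧ WeakFlagPath u F H := by
          by_contra hc
          exact hs ⟨h1, hc⟩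
        obtain ⟨w, hw, hpw⟩ := hw
        have hst := hu s (by simp)
        obtain ⟨v, hv, hpv⟩ := exists_path_of_weakStep (t := s)
          (fun s' hs' => ih s' (lt_of_lt_of_le hs' hst)) hw hpw
        exact ⟨v, fun a ha => (hv a ha).subset.trans hst, hpv⟩
    obtain ⟨v, hv, hp⟩ := this
    refine ⟨v ++ v', fun a ha => ?_, hasPath_append.2 ⟨H, hp, hp'⟩⟩
    rcases List.mem_append.1 ha with ha | ha
    · exact hv a ha
    · exact hv' a ha

theorem Chain.exists_path {s : Set V} {n : ℕ} {F G : Flag Γ M}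
    (h : Chain (properSubsets s) n F G) :
    ∃ u : List (Letter Γ), (∀ a ∈ u, a.1 ⊂ s) ∧ HasPath LetterStep u F G := by
  obtain ⟨u, hu, hp⟩ := h.exists_weakFlagPath hM
  refine exists_path_of_weakStep (fun s _ => exists_path_of_diffColours hM s) (fun a ha => ?_) hp
  obtain ⟨t, ht, hle⟩ := hu a ha
  exact lt_of_le_of_lt hle ht

/-- Commuting letters are disjoint and have no edges between them, so the exchanged steps are
parallel to the original ones. -/
theorem flagStep_swap {s t : Set V} (hst : LetterCommute Γ s t) {F G H : Flag Γ M}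
    (h1 : FlagStep s F G) (h2 : FlagStep t G H) :
    ∃ G' : Flag Γ M, FlagStep t F G' ∧ FlagStep s G' H ∧
      (∀ γ ∈ t, G'.vertex γ = H.vertex γ) ∧ ∀ γ ∉ t, G'.vertex γ = F.vertex γ := by
  have hd1 := h1.1.2.le
  have hd2 := h2.1.2.le
  obtain ⟨G', h3, h4, h5, h6⟩ := exists_swap_flag hM hst hd1 hd2
  rw [diffColours_subset_iff] at hd1 hd2
  refine ⟨G', Parallel.flagStep hM ⟨h2.1.2.le, h3, fun γ hγ => ?_, fun γ hγ => (h5 γ hγ).symm,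
    fun γ hγ δ hδ ha => ?_⟩ h2, Parallel.flagStep hM ⟨h1.1.2.le, h4, fun γ hγ => ?_,
    fun γ hγ => ?_, fun γ hγ δ hδ ha => ?_⟩ h1, h5, h6⟩
  · exact (hd1 γ (hst.symm.notMem hγ)).symm
  · exact (hd1 δ (fun hδs => (hst δ hδs γ hγ).2 ha.symm)).symm
  · exact (h6 γ (hst.notMem hγ)).symm
  · exact hd2 γ (hst.notMem hγ)
  · exact (h6 δ (fun hδt => (hst γ hγ δ hδt).2 ha)).symm

/-- For `absorb`, a splitting of the composite, preceded by the reversed `a`-change, would split the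
`b`-step. For `merge`, a composite that is no flag step has a splitting, which can be refined to a
flag path. -/
theorem stepSystem_flag :
    StepSystem (LetterComm (Γ := Γ)) letterRank (LetterStep (Γ := Γ) (M := M)) where
  toLetterSystem := letterSystem
  step_symm a F G h := by
    rw [LetterStep, flagStep_iff hM] at h ⊢
    exact ⟨h.1, diffColours_symm h.2.1, fun n hc => h.2.2 n hc.symm⟩
  swap a b F G H hab h1 h2 := by
    obtain ⟨G', h3, h4, -⟩ := flagStep_swap hM hab h1 h2
    exact ⟨G', h3, h4⟩
  absorb a b F G H hab h1 h2 := by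
    rw [LetterStep, flagStep_iff hM] at h1 h2 ⊢
    refine ⟨b.2, diffColours_trans (h1.2.1.trans (subset_of_ssubset hab)) h2.2.1, fun n hc => ?_⟩
    exact h2.2.2 (n + 1) ⟨F, ⟨a.1, hab, diffColours_symm h1.2.1⟩, hc⟩
  merge a F G H h1 h2 := by
    by_cases h : FlagStep a.1 F H
    · exact Or.inl h
    · rw [LetterStep, flagStep_iff hM] at h1 h2
      rw [flagStep_iff hM] at h
      push Not at h
      obtain ⟨n, hn⟩ := h a.2 (diffColours_trans h1.2.1 h2.2.1)
      obtain ⟨u, hu, hp⟩ := Chain.exists_path hM hn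
      exact Or.inr ⟨u, hu, hp⟩

omit hM [Finite V] in
theorem red_map_letter {u : List (Letter Γ)} (h : Red (· ≤ ·) LetterComm u) :
    Red (· ⊆ ·) (LetterCommute Γ) (u.map Subtype.val) := by
  intro x a y b z he hc
  obtain ⟨x', u₁, rfl, rfl, h1⟩ := List.map_eq_append_iff.1 he
  obtain ⟨a', u₂, rfl, rfl, h2⟩ := List.map_eq_cons_iff.1 h1
  obtain ⟨y', u₃, rfl, rfl, h3⟩ := List.map_eq_append_iff.1 h2
  obtain ⟨b', u₄, rfl, rfl, rfl⟩ := List.map_eq_cons_iff.1 h3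
  refine h x' a' y' b' u₄ rfl ?_
  rcases hc with ⟨h1, h2⟩ | ⟨h1, h2⟩
  · exact Or.inl ⟨h1, fun c hc => h2 _ (List.mem_map_of_mem hc)⟩
  · exact Or.inr ⟨h1, fun c hc => h2 _ (List.mem_map_of_mem hc)⟩

omit hM [Finite V] in
theorem hasPath_map_letter {u : List (Letter Γ)} {F G : Flag Γ M} (h : HasPath LetterStep u F G) :
    FlagPath (u.map Subtype.val) F G := by
  induction u generalizing F with
  | nil => exact h
  | cons a u ih =>
    obtain ⟨H, h1, h2⟩ := h
    exact ⟨H, h1, ih h2⟩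

omit hM [Finite V] in
theorem closed_path_eq_nil (hsc : SimplyConnected Γ M) (u : List (Letter Γ)) (F : Flag Γ M)
    (hu : Red (· ≤ ·) LetterComm u) (h : HasPath LetterStep u F F) : u = [] := by
  exact List.map_eq_nil_iff.1
    (hsc F _ (isReducedWord_iff.2 (red_map_letter hu)) (hasPath_map_letter h))

theorem flag_swaps (hsc : SimplyConnected Γ M) {u v : List (Letter Γ)}
    {F G : Flag Γ M} (hu : Red (· ≤ ·) LetterComm u) (hv : Red (· ≤ ·) LetterComm v)
    (hpu : HasPath LetterStep u F G) (hpv : HasPath LetterStep v F G) : Swaps LetterComm u v :=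
  (stepSystem_flag hM).swaps_of_red (closed_path_eq_nil hsc) hu hv hpu hpv

/-- The letters of a reduced flag path are contained in the letters of every flag path with the
same endpoints. -/
theorem forall_of_path (hsc : SimplyConnected Γ M) {P : Letter Γ → Prop}
    (hP : ∀ a b, a ≤ b → P b → P a) {u v : List (Letter Γ)} {F G : Flag Γ M}
    (hu : Red (· ≤ ·) LetterComm u) (hpu : HasPath LetterStep u F G)
    (hpv : HasPath LetterStep v F G) (hv : ∀ a ∈ v, P a) : ∀ a ∈ u, P a := by
  obtain ⟨w, h1, h2, h3⟩ := (stepSystem_flag hM).exists_red hpv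
  have h4 := h3.forall hP hv
  exact fun a ha => h4 a ((flag_swaps hM hsc hu h2 hpu h1).perm.mem_iff.1 ha)

theorem subset_of_diffColours (hsc : SimplyConnected Γ M) {t : Set V} {F G : Flag Γ M}
    (h : diffColours F G ⊆ t) {u : List (Letter Γ)} (hu : Red (· ≤ ·) LetterComm u)
    (hp : HasPath LetterStep u F G) : ∀ a ∈ u, a.1 ⊆ t := by
  obtain ⟨v, hv, hpv⟩ := exists_path_of_diffColours hM t F G h
  exact forall_of_path hM hsc (P := fun a : Letter Γ => a.1 ⊆ t)
    (fun _ _ hab hb => Set.Subset.trans hab hb) hu hp hpv hv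

end Flags

/-! ### The coloured graph of a building -/

/-- Any two flags are connected by steps that change a single vertex. -/
def SinglesConnected {V : Type*} (Γ : SimpleGraph V) (M : Type*) [(lang V).Structure M] : Prop :=
  ∀ F G : Flag Γ M, ∃ n, Chain {t | ∃ γ, t = {γ}} n F G

section ColouredGraph

variable {V X : Type*} {Γ : SimpleGraph V} {r : V → Setoid X}

theorem adj_colouredGraph {a b : ColouredGraph Γ r} : Adj V a b ↔ Γ.Adj a.1 b.1 ∧
    ∃ z : X, Quotient.mk _ z = a.2 ∧ Quotient.mk _ z = b.2 := Iff.rfl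

theorem hasColour_colouredGraph {a : ColouredGraph Γ r} {γ : V} : HasColour γ a ↔ a.1 = γ :=
  Iff.rfl

/-- The flag of the classes of a chamber. -/
def chamberFlag (Γ : SimpleGraph V) (r : V → Setoid X) (x : X) : Flag Γ (ColouredGraph Γ r) where
  vertex γ := ⟨γ, Quotient.mk _ x⟩
  hasColour _ := rfl
  adj_iff _ _ := adj_colouredGraph.trans ⟨fun h => h.1, fun h => ⟨h, x, rfl, rfl⟩⟩

theorem chamberFlag_vertex_eq {x : X} {γ : V} {a : ColouredGraph Γ r} (h1 : a.1 = γ)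
    (h2 : Quotient.mk _ x = a.2) : (chamberFlag Γ r x).vertex γ = a := by
  obtain ⟨δ, q⟩ := a
  obtain rfl : δ = γ := h1
  exact congrArg (Sigma.mk δ) h2

theorem isGammaSpace_colouredGraph : IsGammaSpace Γ (ColouredGraph Γ r) where
  isGammaGraph :=
    { symm := fun a b ⟨h, z, h1, h2⟩ => ⟨h.symm, z, h2, h1⟩
      irrefl := fun a h => Γ.irrefl h.1
      colour := fun a => ⟨a.1, rfl, fun γ h => Eq.symm h⟩
      adj_colour := fun a b γ δ h1 h2 h => by
        rw [hasColour_colouredGraph] at h1 h2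
        exact h1 ▸ h2 ▸ h.1 }
  vertex_mem_flag a := by
    obtain ⟨x, hx⟩ := Quotient.exists_rep a.2
    exact ⟨chamberFlag Γ r x, a.1, chamberFlag_vertex_eq rfl hx⟩
  edge_mem_flag a b h := by
    obtain ⟨-, z, h1, h2⟩ := h
    exact ⟨chamberFlag Γ r z, a.1, b.1, chamberFlag_vertex_eq rfl h1, chamberFlag_vertex_eq rfl h2⟩

namespace IsGallerySystem

variable (h : IsGallerySystem Γ r)
include h

/-- The vertices of a flag are a coherent family of classes, and `exists_common_chamber` applies. -/
theorem exists_chamberFlag [Finite V] (hX : Nonempty X) (F : Flag Γ (ColouredGraph Γ r)) :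
    ∃ x, chamberFlag Γ r x = F := by
  have hF : ∀ γ, ∃ c : Quotient (dual r γ), F.vertex γ = ⟨γ, c⟩ := fun γ => by
    have h1 := F.hasColour γ
    generalize F.vertex γ = a at h1 ⊢
    obtain ⟨δ, q⟩ := a
    obtain rfl : δ = γ := h1
    exact ⟨q, rfl⟩
  choose C hC using hF
  obtain ⟨x, hx⟩ := h.exists_common_chamber hX (C := C) fun γ δ hγδ => by
    have h2 := (F.adj_iff γ δ).2 hγδ
    rw [hC, hC] at h2
    exact h2.2
  refine ⟨x, Flag.ext (funext fun γ => ?_)⟩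
  rw [hC]
  exact chamberFlag_vertex_eq rfl (hx γ)

theorem diffColours_chamberFlag {x y : X} {s : Set V} :
    diffColours (chamberFlag Γ r x) (chamberFlag Γ r y) ⊆ s ↔ residue r s x y := by
  rw [diffColours_subset_iff, h.residue_iff_dual]
  refine forall₂_congr fun γ _ => ⟨fun he => ?_, fun hd => ?_⟩
  · exact Quotient.exact (eq_of_heq (Sigma.mk.inj he).2)
  · exact chamberFlag_vertex_eq rfl (Quotient.sound hd)

theorem chamberFlag_injective : Function.Injective (chamberFlag Γ r) := by
  intro x y he
  have h1 := (h.diffColours_chamberFlag (s := ∅)).1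
    (by rw [he, diffColours_self] : diffColours (chamberFlag Γ r x) (chamberFlag Γ r y) ⊆ ∅)
  exact h.eq_of_dual fun γ => h.residue_iff_dual.1 h1 γ (by simp)

theorem chain_of_path {s : Set V} {w : List V} (hw : ∀ γ ∈ w, γ ∈ s) {x y : X}
    (hp : ChamberPath r w x y) :
    Chain {t | ∃ γ ∈ s, t = {γ}} w.length (chamberFlag Γ r x) (chamberFlag Γ r y) := by
  induction w generalizing x with
  | nil => obtain rfl : x = y := hp; exact rfl
  | cons γ w ih =>
    obtain ⟨z, h1, h2⟩ := hp
    refine ⟨chamberFlag Γ r z, ⟨{γ}, ⟨γ, hw γ (by simp), rfl⟩, ?_⟩,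
      ih (fun γ hγ => hw γ (by simp [hγ])) h2⟩
    rw [h.diffColours_chamberFlag]
    exact residue_of_path (w := [γ]) (by simp) ⟨z, h1, rfl⟩

theorem singlesConnected [Finite V] (hX : Nonempty X) :
    SinglesConnected Γ (ColouredGraph Γ r) := by
  intro F G
  obtain ⟨x, rfl⟩ := h.exists_chamberFlag hX F
  obtain ⟨y, rfl⟩ := h.exists_chamberFlag hX G
  obtain ⟨w, hw⟩ := h.connected x y
  have h1 := h.chain_of_path (s := Set.univ) (fun _ _ => trivial) hw
  exact ⟨_, by simpa using h1⟩

/-- A residue is connected by steps in single colours, so a flag step with more than one colour in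
its letter would split. -/
theorem exists_chamberPath [Finite V] (hX : Nonempty X) {u : List (Set V)} : ∀ {x y : X},
    FlagPath u (chamberFlag Γ r x) (chamberFlag Γ r y) →
    ∃ w : List V, u = w.map singleton ∧ ChamberPath r w x y := by
  induction u with
  | nil => exact fun {x y} hp => ⟨[], rfl, h.chamberFlag_injective hp⟩
  | cons s u ih =>
    rintro x y ⟨F, h1, h2⟩
    obtain ⟨z, rfl⟩ := h.exists_chamberFlag hX F
    obtain ⟨w, rfl, hw⟩ := ih h2
    rw [flagStep_iff isGammaSpace_colouredGraph.isGammaGraph] at h1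
    obtain ⟨h3, h4, h5⟩ := h1
    obtain ⟨γ, hγ⟩ := h3.nonempty
    have hs : s = {γ} := by
      by_contra hne
      obtain ⟨w, hw, hp⟩ := residue_iff.1 (h.diffColours_chamberFlag.1 h4)
      refine h5 w.length ?_
      have hc := h.chain_of_path hw hp
      refine hc.mono_set ?_
      rintro t ⟨δ, hδ, rfl⟩
      refine ssubset_of_subset_of_ne (Set.singleton_subset_iff.2 hδ) ?_
      rintro rfl
      exact hne (congrArg _ (Eq.symm hγ))
    subst hs
    refine ⟨γ :: w, rfl, z, ⟨?_, ?_⟩, hw⟩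
    · rintro rfl
      exact h5 0 rfl
    · obtain ⟨w, hw, hp⟩ := residue_iff.1 (h.diffColours_chamberFlag.1 h4)
      have : ∀ {w : List V} {x z : X}, (∀ c ∈ w, c ∈ ({γ} : Set V)) → ChamberPath r w x z →
          r γ x z := by
        intro w
        induction w with
        | nil => exact fun {x z} _ hp => by obtain rfl : x = z := hp; exact (r γ).refl' x
        | cons c w ih =>
          rintro x z hw ⟨y, h1, h2⟩
          obtain rfl : c = γ := hw c (by simp)
          exact (r c).trans' h1.2 (ih (fun c hc => hw c (by simp [hc])) h2)
      exact this hw hp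

theorem simplyConnected [Finite V] (hX : Nonempty X) :
    SimplyConnected Γ (ColouredGraph Γ r) := by
  intro F u hu hp
  obtain ⟨x, rfl⟩ := h.exists_chamberFlag hX F
  obtain ⟨w, rfl, hw⟩ := h.exists_chamberPath hX hp
  rw [isReducedWord_iff] at hu
  rw [h.closed w x ?_ hw]
  · rfl
  intro a γ b δ c he hc
  refine hu (a.map singleton) {γ} (b.map singleton) {δ} (c.map singleton) (by simp [he]) ?_
  have key : ∀ ε, (∀ c ∈ b, GenCommute Γ ε c) →
      ∀ t ∈ b.map (singleton : V → Set V), LetterCommute Γ {ε} t := by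
    intro ε hε t ht
    obtain ⟨c, hc, rfl⟩ := List.mem_map.1 ht
    rintro _ rfl _ rfl
    exact hε _ hc
  rcases hc with ⟨rfl, h2⟩ | ⟨rfl, h2⟩
  · exact Or.inl ⟨subset_rfl, key _ h2⟩
  · exact Or.inr ⟨subset_rfl, key _ h2⟩

theorem isRichSimplyConnected [Finite V] (hX : Nonempty X)
    (hrich : ∀ (γ : V) (x : X), {y | r γ x y}.Infinite) :
    IsRichSimplyConnected Γ (ColouredGraph Γ r) where
  isGammaSpace := isGammaSpace_colouredGraph
  simplyConnected := h.simplyConnected hX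
  rich γ G := by
    obtain ⟨x, rfl⟩ := h.exists_chamberFlag hX G
    refine ((hrich γ x).image (h.chamberFlag_injective.injOn)).mono ?_
    rintro _ ⟨y, hy, rfl⟩
    have hle : r γ ≤ residue r {γ} := le_iSup₂_of_le γ rfl le_rfl
    exact h.diffColours_chamberFlag.2 (hle ((r γ).symm' hy))

end IsGallerySystem

theorem IsCountableRichBuilding.isRichSimplyConnected [Finite V]
    (h : IsCountableRichBuilding Γ r) : IsRichSimplyConnected Γ (ColouredGraph Γ r) :=
  h.isBuilding.isGallerySystem.isRichSimplyConnected h.isBuilding.nonempty h.rich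

theorem IsCountableRichBuilding.singlesConnected [Finite V]
    (h : IsCountableRichBuilding Γ r) : SinglesConnected Γ (ColouredGraph Γ r) :=
  h.isBuilding.isGallerySystem.singlesConnected h.isBuilding.nonempty

theorem IsCountableRichBuilding.countable_colouredGraph [Finite V]
    (h : IsCountableRichBuilding Γ r) : Countable (ColouredGraph Γ r) := by
  have := h.countable
  have : Countable V := Finite.to_countable
  unfold ColouredGraph
  infer_instance

theorem IsCountableRichBuilding.nonempty_colouredGraph [Nonempty V]
    (h : IsCountableRichBuilding Γ r) : Nonempty (ColouredGraph Γ r) := by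
  obtain ⟨x⟩ := h.isBuilding.nonempty
  exact ⟨⟨Classical.arbitrary V, Quotient.mk _ x⟩⟩

end ColouredGraph

/-! ### Simple connectedness is a first-order property -/

theorem append_eq_append_cons {β : Type*} {w f x y : List β} {a : β}
    (h : w ++ f = x ++ a :: y) :
    (∃ e, x = w ++ e ∧ f = e ++ a :: y) ∨ ∃ e, w = x ++ a :: e ∧ y = e ++ f := by
  rcases List.append_eq_append_iff.1 h with ⟨e, h1, h2⟩ | ⟨e, h1, h2⟩
  · exact Or.inl ⟨e, h1, h2⟩
  · rcases e with _ | ⟨b, e⟩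
    · exact Or.inl ⟨[], by simpa using h1.symm, by simpa using h2.symm⟩
    · simp only [List.cons_append, List.cons.injEq] at h2
      exact Or.inr ⟨e, by rw [h1, h2.1], h2.2⟩

section Rounds

variable {V : Type*} {Γ : SimpleGraph V} {M : Type*} [(lang V).Structure M]

/-- `F` and `G` differ only in `s`, and are not joined by `N` changes at proper subsets of `s`. -/
def TightStep (N : ℕ) (s : Set V) (F G : Flag Γ M) : Prop :=
  diffColours F G ⊆ s ∧ ¬ Chain (properSubsets s) N F G

/-- Some flag path with word `w` cannot be replaced by `m` changes at proper subsets of `s`. -/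
def Tight (M : Type*) [(lang V).Structure M] (m : ℕ) (b : Set V × List (Letter Γ)) : Prop :=
  ∃ F G : Flag Γ M, HasPath LetterStep b.2 F G ∧ ¬ Chain (properSubsets b.1) m F G

/-- The concatenation of the words of a list of blocks. -/
def flat (bs : List (Set V × List (Letter Γ))) : List (Letter Γ) := bs.flatMap Prod.snd

theorem flat_cons (b : Set V × List (Letter Γ)) (bs : List (Set V × List (Letter Γ))) :
    flat (b :: bs) = b.2 ++ flat bs := List.flatMap_cons ..

/-- The elements of `s ∩ t` that commute with the letters in `w`. -/
def freeSet (t s : Set V) (w : List (Letter Γ)) : Set V :=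
  {γ | γ ∈ s ∧ γ ∈ t ∧ ∀ a ∈ w, ∀ δ ∈ a.1, GenCommute Γ γ δ}

theorem freeSet_mono (t s : Set V) {w w' : List (Letter Γ)} (h : w' ⊆ w) :
    freeSet t s w ⊆ freeSet t s w' := fun _ hγ => ⟨hγ.1, hγ.2.1, fun a ha => hγ.2.2 a (h ha)⟩

/-- The second list of blocks arises from the first by moving letters contained in `t` to the end,
which changes the final flag `B` to `A`. -/
inductive Thinning (t : Set V) : List (Set V × List (Letter Γ)) →
    List (Set V × List (Letter Γ)) → Flag Γ M → Flag Γ M → Prop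
  | nil (A) : Thinning t [] [] A A
  | cons {s w w' bs bs' A H B} (h1 : ∀ a ∈ w', a.1 ⊆ s)
      (h2 : ∀ F G : Flag Γ M, HasPath LetterStep w F G → ∃ K, HasPath LetterStep w' F K ∧
        diffColours K G ⊆ freeSet t s (flat bs'))
      (h3 : diffColours A H ⊆ freeSet t s (flat bs')) (h4 : Thinning t bs bs' H B) :
      Thinning t ((s, w) :: bs) ((s, w') :: bs') A B

theorem Thinning.refl {t : Set V} {bs : List (Set V × List (Letter Γ))}
    (h : ∀ b ∈ bs, ∀ a ∈ b.2, a.1 ⊆ b.1) (A : Flag Γ M) : Thinning t bs bs A A := by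
  induction bs with
  | nil => exact .nil A
  | cons b bs ih =>
    refine .cons (h b (by simp)) (fun F G hp => ⟨G, hp, ?_⟩) (H := A) ?_
      (ih fun b hb => h b (by simp [hb]))
    all_goals simp [diffColours_self]

theorem Thinning.letters {t : Set V} {bs bs' : List (Set V × List (Letter Γ))} {A B : Flag Γ M}
    (h : Thinning t bs bs' A B) : ∀ b ∈ bs', ∀ a ∈ b.2, a.1 ⊆ b.1 := by
  induction h with
  | nil => simp
  | cons h1 _ _ _ ih =>
    intro b hb
    rcases List.mem_cons.1 hb with rfl | hb
    · exact h1
    · exact ih b hb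

theorem Thinning.map_fst {t : Set V} {bs bs' : List (Set V × List (Letter Γ))} {A B : Flag Γ M}
    (h : Thinning t bs bs' A B) : bs'.map Prod.fst = bs.map Prod.fst := by
  induction h with
  | nil => rfl
  | cons _ _ _ _ ih => simp [ih]

/-- If `a` lies in the first block, `c` consists of colours that this block may lose, and the change
is absorbed there. If `a` lies further on, those colours commute with `a`, so the change at `c` can
be moved past them. -/
theorem Thinning.shift (hM : IsGammaGraph Γ M) {t : Set V}
    {bs bs' : List (Set V × List (Letter Γ))} {A B : Flag Γ M}
    (h : Thinning t bs bs' A B) {x y : List (Letter Γ)} {a : Letter Γ}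
    (he : flat bs' = x ++ a :: y) {c : Set V} (hca : c ⊆ a.1) (hct : c ⊆ t)
    (hcy : ∀ b ∈ y, LetterCommute Γ c b.1) {A' : Flag Γ M} (hA : diffColours A' A ⊆ c) :
    Thinning t bs bs' A' B := by
  induction h generalizing x A' with
  | nil => simp [flat] at he
  | @cons s w w' bs bs' A H B h1 h2 h3 h4 ih =>
    rw [flat_cons] at he
    rcases append_eq_append_cons he with ⟨e, -, he⟩ | ⟨e, rfl, rfl⟩
    · have hcomm : LetterCommute Γ c (freeSet t s (flat bs')) := fun γ hγ δ hδ =>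
        (hδ.2.2 a (by rw [he]; simp) γ (hca hγ)).symm
      obtain ⟨H', h5, h6, -⟩ := exists_swap_flag hM hcomm hA h3
      exact .cons h1 h2 h5 (ih he h6)
    · refine .cons h1 h2 (diffColours_trans (hA.trans fun γ hγ => ⟨h1 a (by simp) (hca hγ), hct hγ,
        fun b hb δ hδ => hcy b (by simp [hb]) γ hγ δ hδ⟩) h3) h4

variable [Finite V]

/-- Moved to the end of its block, `a` becomes part of the difference permitted by `freeSet`. For
the earlier blocks the condition only gets weaker. -/
theorem Thinning.delete (hM : IsGammaGraph Γ M) {t : Set V}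
    {bs bs' : List (Set V × List (Letter Γ))} {A B : Flag Γ M}
    (h : Thinning t bs bs' A B) {x y : List (Letter Γ)} {a : Letter Γ}
    (he : flat bs' = x ++ a :: y) (hat : a.1 ⊆ t) (hay : ∀ b ∈ y, LetterComm a b) :
    ∃ bs'', flat bs'' = x ++ y ∧ Thinning t bs bs'' A B := by
  induction h generalizing x with
  | nil => simp [flat] at he
  | @cons s w w' bs bs' A H B h1 h2 h3 h4 ih =>
    rw [flat_cons] at he
    rcases append_eq_append_cons he with ⟨e, rfl, he'⟩ | ⟨e, rfl, rfl⟩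
    · obtain ⟨bs'', h5, h6⟩ := ih he'
      have hsub := freeSet_mono t s (w := flat bs') (w' := flat bs'') (by
        rw [he', h5]
        intro b hb
        simp only [List.mem_append, List.mem_cons] at hb ⊢
        tauto)
      refine ⟨(s, w') :: bs'', by simp [flat_cons, h5], .cons h1 (fun F G hp => ?_) (h3.trans hsub)
        h6⟩
      obtain ⟨K, h7, h8⟩ := h2 F G hp
      exact ⟨K, h7, h8.trans hsub⟩
    · refine ⟨(s, x ++ e) :: bs', by simp [flat_cons], .cons (fun b hb => h1 b ?_) (fun F G hp => ?_)
        h3 h4⟩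
      · simp only [List.mem_append, List.mem_cons] at hb ⊢
        tauto
      obtain ⟨K, h7, h8⟩ := h2 F G hp
      have hsw := swaps_move_right (comm := LetterComm) (a := a) (y := e)
        (fun c hc => hay c (by simp [hc])) x []
      simp only [List.append_nil] at hsw
      obtain ⟨L, h9, h10⟩ := hasPath_append.1 (hsw.hasPath (stepSystem_flag hM).swap h7)
      refine ⟨L, h9, diffColours_trans ((hasPath_singleton.1 h10).1.2.le.trans fun γ hγ => ?_) h8⟩
      exact ⟨h1 a (by simp) hγ, hat hγ, fun b hb δ hδ => hay b (by simp [hb]) γ hγ δ hδ⟩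

/-- A choice of smallest total rank is reduced: a violation across the cut is removed by moving a
letter from the blocks to the end, or by absorbing a letter of `v` into a block. -/
theorem exists_thinning (hM : IsGammaGraph Γ M) {t : Set V}
    {bs : List (Set V × List (Letter Γ))} (hbs : ∀ b ∈ bs, ∀ a ∈ b.2, a.1 ⊆ b.1)
    (hred : Red (· ≤ ·) LetterComm (flat bs)) {F B F' : Flag Γ M}
    (hp : HasPath LetterStep (flat bs) F B) (ht : diffColours B F' ⊆ t) :
    ∃ bs' v A, Thinning t bs bs' A B ∧ (∀ a ∈ v, a.1 ⊆ t) ∧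
      HasPath LetterStep (flat bs' ++ v) F F' ∧ HasPath LetterStep v A F' ∧
      Red (· ≤ ·) LetterComm (flat bs' ++ v) := by
  have S := stepSystem_flag hM
  obtain ⟨v₀, hv₀, hpv₀⟩ := exists_path_of_diffColours hM t B F' ht
  obtain ⟨⟨bs', v, A⟩, ⟨h1, h2, h3, h4, h5⟩, hmin⟩ := exists_rank_min
    (fun T : List (Set V × List (Letter Γ)) × List (Letter Γ) × Flag Γ M =>
      Thinning t bs T.1 T.2.2 B ∧ (∀ a ∈ T.2.1, a.1 ⊆ t) ∧ HasPath LetterStep (flat T.1) F T.2.2 ∧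
      HasPath LetterStep T.2.1 T.2.2 F' ∧ Red (· ≤ ·) LetterComm (flat T.1))
    (fun T => wordRank letterRank (flat T.1 ++ T.2.1))
    ⟨(bs, v₀, B), .refl hbs B, hv₀, hp, hpv₀, hred⟩
  simp only at h1 h2 h3 h4 h5
  refine ⟨bs', v, A, h1, h2, hasPath_append.2 ⟨A, h3, h4⟩, h4, ?_⟩
  by_contra hnr
  rcases red_append_cases hnr with h | h | ⟨x, a, y, y', b, z, hx, rfl, hab⟩
  · exact h h5
  · obtain ⟨v', h6, h7, h8⟩ := S.reduce h h4
    refine hmin (bs', v', A) ⟨h1, h8.forall (P := fun a : Letter Γ => a.1 ⊆ t)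
      (fun _ _ hab hb => Set.Subset.trans hab hb) h2, h3, h6, h5⟩ ?_
    have := h7.add_left (wordRank letterRank (flat bs'))
    rwa [← wordRank_append, ← wordRank_append] at this
  -- moving a letter `a` contained in `t` from the blocks to the end
  have hdel : a.1 ⊆ t → (∀ c ∈ y, LetterComm a c) → ∃ bs'' A', flat bs'' = x ++ y ∧
      Thinning t bs bs'' A' B ∧ HasPath LetterStep (flat bs'') F A' ∧ LetterStep a A' A ∧
      Red (· ≤ ·) LetterComm (flat bs'') := by
    intro hat hay
    have hsw : Swaps LetterComm (flat bs') (x ++ y ++ [a]) := by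
      rw [hx]
      simpa using swaps_move_right hay x []
    obtain ⟨A', h9, h10⟩ := hasPath_append.1 (hsw.hasPath S.swap h3)
    have h10 := hasPath_singleton.1 h10
    obtain ⟨bs'', h11, h12⟩ := (h1.shift hM hx subset_rfl hat hay h10.1.2.le).delete hM hx hat hay
    exact ⟨bs'', A', h11, h12, by rwa [h11], h10, by
      rw [h11]; exact (hsw.red S.toLetterSystem h5).left⟩
  have hbt : b.1 ⊆ t := h2 b (by simp)
  have key : (a = b ∧ ∀ c ∈ y ++ y', LetterComm a c) ∨ (a < b ∧ ∀ c ∈ y ++ y', LetterComm a c) ∨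
      (b < a ∧ ∀ c ∈ y ++ y', LetterComm b c) := by
    by_cases he : a = b
    · subst he; exact Or.inl ⟨rfl, by rcases hab with h | h <;> exact h.2⟩
    · rcases hab with h | h
      · exact Or.inr (Or.inl ⟨lt_of_le_of_ne h.1 he, h.2⟩)
      · exact Or.inr (Or.inr ⟨lt_of_le_of_ne h.1 (Ne.symm he), h.2⟩)
  rcases key with ⟨rfl, hc⟩ | ⟨hlt, hc⟩ | ⟨hlt, hc⟩
  · obtain ⟨bs'', A', h6, h7, h8, h9, h10⟩ := hdel hbt fun c hc' => hc c (by simp [hc'])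
    have hpath : HasPath LetterStep ((a :: (y' ++ [a])) ++ z) A' F' := by
      refine ⟨A, h9, ?_⟩
      simpa using h4
    obtain ⟨K, h11, h12⟩ := hasPath_append.1 hpath
    rcases S.cancel (fun c hc' => hc c (by simp [hc'])) h11 with h13 | ⟨z', h13, h14⟩
    · refine hmin (bs'', y' ++ a :: z, A') ⟨h7, h2, h8, ?_, h10⟩ ?_
      · simpa using hasPath_append.2 ⟨K, h13, h12⟩
      · simp only [h6, hx]
        simpa using rankLT_delete (rank := letterRank) (x := x) (b := a) (y := y ++ (y' ++ a :: z))
    · refine hmin (bs'', y' ++ z' ++ z, A') ⟨h7, fun c hc' => ?_, h8,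
        hasPath_append.2 ⟨K, h14, h12⟩, h10⟩ ?_
      · simp only [List.mem_append] at hc'
        rcases hc' with (hc' | hc') | hc'
        · exact h2 c (by simp [hc'])
        · exact Set.Subset.trans (h13 c hc').le hbt
        · exact h2 c (by simp [hc'])
      · simp only [h6, hx]
        have r1 := rankLT_delete (rank := letterRank) (x := x) (b := a) (y := y ++ (y' ++ z' ++ z))
        have r2 := rankLT_replace (rank := letterRank) (x := x ++ a :: y ++ y') (y := z) (z := z')
          (b := a) fun c hc' => S.rank_lt _ _ (h13 c hc')
        refine RankLT.trans (by simpa using r1) (by simpa using r2)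
  · obtain ⟨bs'', A', h6, h7, h8, h9, h10⟩ := hdel (Set.Subset.trans hlt.le hbt) fun c hc' => hc c (by simp [hc'])
    have h11 : HasPath LetterStep (a :: (y' ++ b :: z)) A' F' := ⟨A, h9, h4⟩
    refine hmin (bs'', y' ++ b :: z, A') ⟨h7, h2, h8,
      S.absorb_right hlt (fun c hc' => hc c (by simp [hc'])) h11, h10⟩ ?_
    simp only [h6, hx]
    simpa using rankLT_delete (rank := letterRank) (x := x) (b := a) (y := y ++ (y' ++ b :: z))
  -- Here the larger letter `a` of the blocks absorbs `b`. The end of the blocks moves from `A` to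
  -- `A'`, which `Thinning.shift` permits.
  · have h6 : HasPath LetterStep (b :: y' ++ z) A F' := by
      rw [show y' ++ b :: z = (y' ++ [b]) ++ z by simp, hasPath_append] at h4
      obtain ⟨K, h7, h8⟩ := h4
      exact hasPath_append.2 ⟨K, S.swap.move_left
        (fun c hc' => (hc c (by simp [hc'])).symm) h7, h8⟩
    obtain ⟨A', h7, h8⟩ := h6
    have h9 : HasPath LetterStep (flat bs') F A' := by
      rw [hx] at h3 ⊢
      rw [hasPath_append] at h3 ⊢
      obtain ⟨K, h10, h11⟩ := h3
      refine ⟨K, h10, ?_⟩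
      have := S.absorb_left (x := []) (y := y) hlt (fun c hc' => hc c (by simp [hc']))
        (p := K) (q := A') (by
          simpa using hasPath_append.2 ⟨A, h11, hasPath_singleton.2 h7⟩)
      simpa using this
    refine hmin (bs', y' ++ z, A') ⟨h1.shift hM hx hlt.le hbt (fun c hc' => hc c (by simp [hc']))
      (diffColours_symm h7.1.2.le), fun c hc' => h2 c ?_, h9, h8, h5⟩ ?_
    · simp only [List.mem_append, List.mem_cons] at hc' ⊢
      tauto
    · simpa using rankLT_delete (rank := letterRank) (x := flat bs' ++ y') (b := b) (y := z)

-- A path that avoids `δ` amounts to one change at a proper subset.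
omit [Finite V] in
theorem Tight.exists_mem {m : ℕ} (hm : 1 ≤ m) {b : Set V × List (Letter Γ)} (h : Tight M m b)
    (hb : ∀ a ∈ b.2, a.1 ⊆ b.1) {δ : V} (hδ : δ ∈ b.1) : ∃ a ∈ b.2, δ ∈ a.1 := by
  by_contra hne
  push Not at hne
  obtain ⟨F, G, h1, h2⟩ := h
  have hss : b.1 \ {δ} ⊂ b.1 := Set.sdiff_singleton_ssubset.2 hδ
  refine h2 (Chain.mono ⟨_, hss⟩ hm (Chain.single hss ?_))
  refine diffColours_of_path (t := b.1 \ {δ}) (fun a ha γ hγ => ⟨hb a ha hγ, ?_⟩) h1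
  rintro rfl
  exact hne a ha hγ

-- Tight blocks use every colour of their set. So if the colours that a block `s` may lose were all
-- of `s` or all of `t`, they would commute with all the sets in between, against reducedness. Being
-- proper in both, they cost the block one unit of tightness, and they contribute one proper change
-- of `t` on the way from `A` to `B`.
omit [Finite V] in
theorem Thinning.tight {t : Set V} {m : ℕ} (hm : 1 ≤ m)
    {bs bs' : List (Set V × List (Letter Γ))} {A B : Flag Γ M}
    (h : Thinning t bs bs' A B) (hT : ∀ b ∈ bs, Tight M (m + 1) b)
    (hred : Red (· ⊆ ·) (LetterCommute Γ) (bs.map Prod.fst ++ [t])) :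
    (∀ b ∈ bs', Tight M m b) ∧ Chain (properSubsets t) bs.length A B := by
  induction h with
  | nil => exact ⟨by simp, rfl⟩
  | @cons s w w' bs bs' A H B h1 h2 h3 h4 ih =>
    obtain ⟨h5, h6⟩ := ih (fun b hb => hT b (by simp [hb])) (Red.right (u := [s]) (by simpa using hred))
    have key : ∀ q : Set V, q ⊆ freeSet t s (flat bs') →
        ∀ r ∈ bs.map Prod.fst, LetterCommute Γ q r := by
      intro q hq r hr γ hγ δ hδ
      rw [← h4.map_fst] at hr
      obtain ⟨b, hb, rfl⟩ := List.mem_map.1 hr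
      obtain ⟨a, ha, hδa⟩ := (h5 b hb).exists_mem hm (h4.letters b hb) hδ
      exact (hq hγ).2.2 a (List.mem_flatMap.2 ⟨b, hb, ha⟩) δ hδa
    have hqs : freeSet t s (flat bs') ⊂ s := by
      refine ssubset_of_subset_of_ne (fun γ hγ => hγ.1) fun he => ?_
      refine hred [] s (bs.map Prod.fst) t [] (by simp) (Or.inl ⟨?_, key s he.ge⟩)
      rw [← he]
      exact fun γ hγ => hγ.2.1
    have hqt : freeSet t s (flat bs') ⊂ t := by
      refine ssubset_of_subset_of_ne (fun γ hγ => hγ.2.1) fun he => ?_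
      refine hred [] s (bs.map Prod.fst) t [] (by simp) (Or.inr ⟨?_, key t he.ge⟩)
      intro γ hγ
      exact (he.ge hγ).1
    refine ⟨fun b hb => ?_, H, ⟨_, hqt, h3⟩, h6⟩
    rcases List.mem_cons.1 hb with rfl | hb
    · obtain ⟨F, G, h7, h8⟩ := hT (s, w) (by simp)
      obtain ⟨K, h9, h10⟩ := h2 F G h7
      refine ⟨F, K, h9, fun hc => h8 ?_⟩
      have := hc.trans (Chain.single (𝒯 := properSubsets s) hqs h10)
      rwa [add_comm] at this
    · exact h5 b hb

/-- Each step is replaced by a genuine flag path in its letter so that the whole word becomes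
reduced. Every added step costs each earlier block one unit of tightness, so a bound above the
length of `u` leaves all blocks tight. -/
theorem exists_blocks (hM : IsGammaGraph Γ M) (N : ℕ) (u : List (Set V))
    (hN : u.length < N) (hu : ∀ s ∈ u, IsLetter Γ s) (hred : Red (· ⊆ ·) (LetterCommute Γ) u)
    {F : Flag Γ M} : ∀ {B : Flag Γ M}, HasPath (TightStep N) u F B →
    ∃ bs : List (Set V × List (Letter Γ)), bs.map Prod.fst = u ∧ (∀ b ∈ bs, ∀ a ∈ b.2, a.1 ⊆ b.1) ∧
      (∀ b ∈ bs, Tight M (N - u.length) b) ∧ Red (· ≤ ·) LetterComm (flat bs) ∧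
      HasPath LetterStep (flat bs) F B := by
  induction u using List.reverseRecOn with
  | nil => exact fun {B} hp => ⟨[], rfl, by simp, by simp, red_nil, hp⟩
  | append_singleton u t ih =>
    intro F' hp
    obtain ⟨B, h1, h2⟩ := hasPath_append.1 hp
    rw [hasPath_singleton] at h2
    simp only [List.length_append, List.length_singleton] at hN ⊢
    obtain ⟨bs, rfl, h4, h5, h6, h7⟩ := ih (by omega) (fun s hs => hu s (by simp [hs])) hred.left h1
    obtain ⟨bs', v, A, h8, h9, h10, h11, h12⟩ := exists_thinning hM h4 h6 h7 h2.1
    rw [List.length_map] at hN h5 ⊢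
    obtain ⟨h13, h14⟩ := h8.tight (m := N - (bs.length + 1)) (by omega)
      (by rwa [show N - (bs.length + 1) + 1 = N - bs.length by omega]) hred
    have hflat : flat (bs' ++ [(t, v)]) = flat bs' ++ v := by simp [flat]
    refine ⟨bs' ++ [(t, v)], by simp [h8.map_fst], ?_, ?_, hflat ▸ h12, hflat ▸ h10⟩
    · intro b hb
      rcases List.mem_append.1 hb with hb | hb
      · exact h8.letters b hb
      · rw [List.mem_singleton.1 hb]; exact h9
    · intro b hb
      rcases List.mem_append.1 hb with hb | hb
      · exact h13 b hb
      · rw [List.mem_singleton.1 hb]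
        refine ⟨A, F', h11, fun hc => h2.2 ?_⟩
        -- The chain from `B` through `A` to `F'` has `N - 1` links, within the bound `N` excluded
        -- for this step.
        exact Chain.mono (hu t (by simp)).properSubsets_nonempty (by omega) (h14.symm.trans hc)

/-- The blocks compose to a closed reduced flag path, which has to be empty, while a tight block
uses every colour of its letter. -/
theorem not_tight_path (hM : IsGammaGraph Γ M) (hsc : SimplyConnected Γ M) {u : List (Set V)}
    (hne : u ≠ []) (hu : ∀ s ∈ u, IsLetter Γ s) (hred : Red (· ⊆ ·) (LetterCommute Γ) u)
    (F : Flag Γ M) : ¬ HasPath (TightStep (u.length + 1)) u F F := by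
  intro hp
  obtain ⟨bs, h1, h2, h3, h4, h5⟩ := exists_blocks hM (u.length + 1) u (by omega) hu hred hp
  have h6 := closed_path_eq_nil hsc _ F h4 h5
  rcases bs with _ | ⟨⟨s, w⟩, bs⟩
  · exact hne h1.symm
  have hs : IsLetter Γ s := hu s (by rw [← h1]; simp)
  have h7 := h3 (s, w) (by simp)
  rw [flat_cons, List.append_eq_nil_iff] at h6
  obtain ⟨γ, hγ⟩ := hs.nonempty
  obtain ⟨a, ha, -⟩ := h7.exists_mem (by omega) (h2 (s, w) (by simp)) hγ
  rw [h6.1] at ha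
  simp at ha

/-- Simple connectedness, in terms of bounded splittings only. -/
theorem simplyConnected_iff (hM : IsGammaGraph Γ M) : SimplyConnected Γ M ↔
    ∀ u : List (Set V), u ≠ [] → (∀ s ∈ u, IsLetter Γ s) → IsReducedWord Γ u →
      ∀ F : Flag Γ M, ¬ HasPath (TightStep (u.length + 1)) u F F := by
  refine ⟨fun hsc u hne hu hr F => not_tight_path hM hsc hne hu (isReducedWord_iff.1 hr) F,
    fun h F u hr hp => ?_⟩
  by_contra hne
  refine h u hne ?_ hr F (hp.mono fun s F G hs => ?_)
  · clear h hr hne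
    suffices ∀ G, FlagPath u F G → ∀ s ∈ u, IsLetter Γ s from this F hp
    clear hp
    induction u generalizing F with
    | nil => simp
    | cons s u ih =>
      rintro G ⟨H, h1, h2⟩ t ht
      rcases List.mem_cons.1 ht with rfl | ht
      · exact h1.1.1
      · exact ih H G h2 t ht
  · rw [flagStep_iff hM] at hs
    exact ⟨hs.2.1, hs.2.2 _⟩

end Rounds

/-! ### Nice partial isomorphisms -/

theorem final_of_swaps {α : Type*} {comm : α → α → Prop} {u x : List α} {c : α}
    (h : Swaps comm u (x ++ [c])) : ∃ p q, u = p ++ c :: q ∧ ∀ d ∈ q, comm c d := by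
  have key : ∀ v, Relation.ReflTransGen (SwapStep comm) u v →
      (∃ p q, v = p ++ c :: q ∧ ∀ d ∈ q, comm c d) → ∃ p q, u = p ++ c :: q ∧ ∀ d ∈ q, comm c d := by
    intro v hv
    induction hv with
    | refl => exact id
    | tail _ hs ih =>
      rintro ⟨p, q, he, hq⟩
      refine ih ?_
      obtain ⟨x, y, a, b, hab⟩ := hs
      rcases append_eq_append_cons he with ⟨e, rfl, h1⟩ | ⟨e, rfl, rfl⟩
      · rcases e with _ | ⟨e₁, e⟩
        · simp only [List.nil_append, List.cons.injEq] at h1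
          obtain ⟨rfl, rfl⟩ := h1
          exact ⟨x ++ [a], y, by simp, fun d hd => hq d (by simp [hd])⟩
        · simp only [List.cons_append, List.cons.injEq] at h1
          obtain ⟨rfl, h1⟩ := h1
          rcases e with _ | ⟨e₂, e⟩
          · simp only [List.nil_append, List.cons.injEq] at h1
            obtain ⟨rfl, rfl⟩ := h1
            refine ⟨x, b :: y, by simp, fun d hd => ?_⟩
            rcases List.mem_cons.1 hd with rfl | hd
            · exact hab
            · exact hq d hd
          · simp only [List.cons_append, List.cons.injEq] at h1
            obtain ⟨rfl, rfl⟩ := h1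
            exact ⟨x ++ a :: b :: e, q, by simp, hq⟩
      · refine ⟨p, e ++ a :: b :: y, by simp, fun d hd => hq d ?_⟩
        simp only [List.mem_append, List.mem_cons] at hd ⊢
        tauto
  exact key _ h ⟨x, [], by simp, by simp⟩

/-- A set of colours that contains an element of a letter and is closed under adjacency in the
letter contains the letter. -/
theorem IsLetter.subset_of_closed {V : Type*} {Γ : SimpleGraph V} {s D : Set V} (hs : IsLetter Γ s)
    {γ : V} (hγ : γ ∈ s) (hD : γ ∈ D) (hc : ∀ δ ∈ s, δ ∈ D → ∀ ε ∈ s, Γ.Adj δ ε → ε ∈ D) :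
    s ⊆ D := by
  intro ε hε
  obtain ⟨p⟩ := SimpleGraph.Connected.preconnected hs ⟨γ, hγ⟩ ⟨ε, hε⟩
  have key : ∀ {a b : s} (_ : (Γ.induce s).Walk a b), a.1 ∈ D → b.1 ∈ D := by
    intro a b p
    induction p with
    | nil => exact id
    | cons h _ ih => exact fun ha => ih (hc _ (Subtype.prop _) ha _ (Subtype.prop _) h)
  exact key p hD

section NiceIso

variable {V : Type*} {Γ : SimpleGraph V} {M N : Type*} [(lang V).Structure M] [(lang V).Structure N]

/-- Corresponding vertices of two flags are related. -/
def IsPair (R : M → N → Prop) (p : Flag Γ M × Flag Γ N) : Prop :=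
  ∀ γ, R (p.1.vertex γ) (p.2.vertex γ)

/-- Parallel steps of flag paths between related flags. -/
def PairStep (R : M → N → Prop) (a : Letter Γ) (p q : Flag Γ M × Flag Γ N) : Prop :=
  LetterStep a p.1 q.1 ∧ LetterStep a p.2 q.2 ∧ IsPair R p ∧ IsPair R q

variable (Γ) in
/-- A partial isomorphism that relates flags, any two of which are joined by a reduced flag path
on both sides. -/
structure NiceIso (R : M → N → Prop) : Prop where
  func : ∀ {x y y'}, R x y → R x y' → y = y'
  inj : ∀ {x x' y}, R x y → R x' y → x = x'
  cover : ∀ {x y}, R x y → ∃ (p : Flag Γ M × Flag Γ N) (γ : V), IsPair R p ∧ p.1.vertex γ = x ∧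
    p.2.vertex γ = y
  conn : ∀ {p q : Flag Γ M × Flag Γ N}, IsPair R p → IsPair R q →
    ∃ u, Red (· ≤ ·) LetterComm u ∧ HasPath (PairStep R) u p q

variable {R R' : M → N → Prop}

theorem PairStep.mono (h : ∀ x y, R x y → R' x y) {a : Letter Γ} {p q : Flag Γ M × Flag Γ N}
    (hs : PairStep R a p q) : PairStep R' a p q :=
  ⟨hs.1, hs.2.1, fun γ => h _ _ (hs.2.2.1 γ), fun γ => h _ _ (hs.2.2.2 γ)⟩

theorem path_fst {u : List (Letter Γ)} {p q : Flag Γ M × Flag Γ N} (h : HasPath (PairStep R) u p q) :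
    HasPath LetterStep u p.1 q.1 := by
  induction u generalizing p with
  | nil => exact congrArg Prod.fst h
  | cons a u ih =>
    obtain ⟨r, h1, h2⟩ := h
    exact ⟨r.1, h1.1, ih h2⟩

theorem path_snd {u : List (Letter Γ)} {p q : Flag Γ M × Flag Γ N} (h : HasPath (PairStep R) u p q) :
    HasPath LetterStep u p.2 q.2 := by
  induction u generalizing p with
  | nil => exact congrArg Prod.snd h
  | cons a u ih =>
    obtain ⟨r, h1, h2⟩ := h
    exact ⟨r.2, h1.2.1, ih h2⟩

theorem FlagStep.symm {s : Set V} {F G : Flag Γ M} (h : FlagStep s F G) : FlagStep s G F := by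
  refine ⟨⟨h.1.1, by rw [diffColours_comm]; exact h.1.2⟩, fun ⟨u, h1, h2⟩ => h.2 ⟨u.reverse,
    by simpa using h1, hasPath_reverse (fun s F G h => ⟨h.1, ?_⟩) h2⟩⟩
  rw [diffColours_comm]
  exact h.2

theorem pairStep_symm (a : Letter Γ) (p q : Flag Γ M × Flag Γ N) (h : PairStep R a p q) :
    PairStep R a q p := ⟨h.1.symm, h.2.1.symm, h.2.2.2, h.2.2.1⟩

theorem path_flip {u : List (Letter Γ)} {p q : Flag Γ M × Flag Γ N}
    (h : HasPath (PairStep R) u p q) : HasPath (PairStep (flip R)) u p.swap q.swap := by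
  induction u generalizing p with
  | nil => exact congrArg Prod.swap h
  | cons a u ih =>
    obtain ⟨r, h1, h2⟩ := h
    exact ⟨r.swap, ⟨h1.2.1, h1.1, h1.2.2⟩, ih h2⟩

theorem NiceIso.flip (h : NiceIso Γ R) : NiceIso Γ (flip R) where
  func h1 h2 := h.inj h1 h2
  inj h1 h2 := h.func h1 h2
  cover h1 := by
    obtain ⟨p, γ, h2, h3, h4⟩ := h.cover h1
    exact ⟨p.swap, γ, h2, h4, h3⟩
  conn {p q} hp hq := by
    obtain ⟨u, hu, h1⟩ := h.conn (p := p.swap) (q := q.swap) hp hq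
    exact ⟨u, hu, path_flip h1⟩

theorem NiceIso.diffColours_eq (h : NiceIso Γ R) {p q : Flag Γ M × Flag Γ N} (hp : IsPair R p)
    (hq : IsPair R q) : diffColours p.1 q.1 = diffColours p.2 q.2 := by
  ext γ
  refine not_congr ⟨fun he => ?_, fun he => ?_⟩
  · exact h.func (hp γ) (he ▸ hq γ)
  · exact h.inj (hp γ) (he ▸ hq γ)

/-- The extension `p` of the relation `R`, with respect to the letter `s` and the pair `g`, is
as generic as possible. -/
structure IsFree (R : M → N → Prop) (s : Set V) (g p : Flag Γ M × Flag Γ N) : Prop where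
  isPair : IsPair R g
  fst : ∀ {h : Flag Γ M × Flag Γ N}, IsPair R h → diffColours h.1 g.1 ⊆ s → FlagStep s h.1 p.1
  snd : ∀ {h : Flag Γ M × Flag Γ N}, IsPair R h → diffColours h.2 g.2 ⊆ s → FlagStep s h.2 p.2

theorem IsFree.flip {s : Set V} {g p : Flag Γ M × Flag Γ N} (h : IsFree R s g p) :
    IsFree (flip R) s g.swap p.swap :=
  ⟨h.1, fun {q} hq hd => h.snd (h := q.swap) hq hd, fun {q} hq hd => h.fst (h := q.swap) hq hd⟩

theorem IsFree.step {s : Set V} {g p : Flag Γ M × Flag Γ N} (h : IsFree R s g p) :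
    FlagStep s g.1 p.1 := h.fst h.isPair (by simp [diffColours_self])

theorem IsFree.isLetter {s : Set V} {g p : Flag Γ M × Flag Γ N} (h : IsFree R s g p) :
    IsLetter Γ s := h.step.1.1

/-- The extension of a relation by corresponding vertices of two flags. -/
def extendRel (R : M → N → Prop) (s : Set V) (p : Flag Γ M × Flag Γ N) (x : M) (y : N) : Prop :=
  R x y ∨ ∃ γ ∈ s, x = p.1.vertex γ ∧ y = p.2.vertex γ

theorem IsFree.isPair_extendRel {s : Set V} {g p : Flag Γ M × Flag Γ N} (h : IsFree R s g p) :
    IsPair (extendRel R s p) p := by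
  intro γ
  by_cases hγ : γ ∈ s
  · exact Or.inr ⟨γ, hγ, rfl, rfl⟩
  · refine Or.inl ?_
    have h1 := diffColours_subset_iff.1 (h.fst h.isPair (by simp [diffColours_self])).1.2.le γ hγ
    have h2 := diffColours_subset_iff.1 (h.snd h.isPair (by simp [diffColours_self])).1.2.le γ hγ
    rw [← h1, ← h2]
    exact h.isPair γ

theorem exists_mixFlag (hM : IsGammaGraph Γ M) (s : Set V) (F G : Flag Γ M)
    (h : ∀ γ ∈ s, ∀ δ ∉ s, Γ.Adj γ δ → F.vertex δ = G.vertex δ) :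
    ∃ H : Flag Γ M, (∀ γ ∈ s, H.vertex γ = G.vertex γ) ∧ (∀ γ ∉ s, H.vertex γ = F.vertex γ) ∧
      diffColours H F ⊆ s :=
  ⟨mixFlag hM s F G fun γ hγ δ hδ hadj => Or.inr (h γ hγ δ hδ hadj), fun _ => mixFlag_mem,
    fun _ => mixFlag_notMem, diffColours_symm diffColours_mixFlag_left⟩

theorem colour_unique (hM : IsGammaGraph Γ M) {F G : Flag Γ M} {γ δ : V}
    (h : F.vertex γ = G.vertex δ) : γ = δ :=
  (hM.colour (F.vertex γ)).unique (F.hasColour γ) (h ▸ G.hasColour δ)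

variable [Finite V]

/-- Exchanging two steps takes each vertex of the new flag from one of the old ones, in the same way
on both sides, so the new flags are related. -/
theorem swappable_pairStep (hM : IsGammaGraph Γ M) (hN : IsGammaGraph Γ N) :
    Swappable (LetterComm (Γ := Γ)) (PairStep R) := by
  intro a b p q r hab h1 h2
  obtain ⟨F, h3, h4, h5, h6⟩ := flagStep_swap hM hab h1.1 h2.1
  obtain ⟨F', h3', h4', h5', h6'⟩ := flagStep_swap hN hab h1.2.1 h2.2.1
  have hF : IsPair R (F, F') := by
    intro γ
    by_cases hγ : γ ∈ b.1
    · simp only [h5 γ hγ, h5' γ hγ]; exact h2.2.2.2 γ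
    · simp only [h6 γ hγ, h6' γ hγ]; exact h1.2.2.1 γ
  exact ⟨(F, F'), ⟨h3, h3', h1.2.2.1, hF⟩, ⟨h4, h4', hF, h2.2.2.2⟩⟩

/-- The word of a reduced path is blocked by every chain of sets connecting its endpoints. -/
theorem exists_split (hM : IsGammaGraph Γ M) (hsc : SimplyConnected Γ M) {F E G : Flag Γ M}
    {s t : Set V} (h1 : diffColours F E ⊆ s) (h2 : diffColours E G ⊆ t) {u : List (Letter Γ)}
    (hu : Red (· ≤ ·) LetterComm u) (hp : HasPath LetterStep u F G) :
    ∃ v w, Swaps LetterComm u (v ++ w) ∧ (∀ a ∈ v, a.1 ⊆ s) ∧ ∀ a ∈ w, a.1 ⊆ t := by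
  obtain ⟨v, hv, hpv⟩ := exists_path_of_diffColours hM s F E h1
  obtain ⟨w, hw, hpw⟩ := exists_path_of_diffColours hM t E G h2
  obtain ⟨x, h3, h4, h5⟩ := (stepSystem_flag hM).exists_red (hasPath_append.2 ⟨E, hpv, hpw⟩)
  have h6 := h5.blocked (Ps := [fun a : Letter Γ => a.1 ⊆ s, fun a : Letter Γ => a.1 ⊆ t]) (by
    simp only [List.mem_cons, List.not_mem_nil, or_false]
    rintro P (rfl | rfl) a b hab hb
    · exact Set.Subset.trans hab hb
    · exact Set.Subset.trans hab hb) ⟨v, w, rfl, hv, w, [], by simp, hw, rfl⟩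
  obtain ⟨v', x, rfl, hv', w', y, rfl, hw', rfl⟩ := h6
  rw [List.append_nil] at h4 h3
  exact ⟨v', w', flag_swaps hM hsc hu h4 hp h3, hv', hw'⟩

variable (hM : IsRichSimplyConnected Γ M) (hN : IsRichSimplyConnected Γ N)
include hM hN

/-- A flag through the edge splits the path between the two pairs into a part avoiding the colour of
`x` and a part avoiding the colour of `y`. The pair reached in between contains both edges. -/
theorem NiceIso.adj (h : NiceIso Γ R) {x y : M} {x' y' : N} (hx : R x x') (hy : R y y')
    (hadj : Adj V x y) : Adj V x' y' := by
  have hM' := hM.isGammaSpace.isGammaGraph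
  obtain ⟨p, γ, hp, rfl, rfl⟩ := h.cover hx
  obtain ⟨q, δ, hq, rfl, rfl⟩ := h.cover hy
  obtain ⟨E, γ', δ', h1, h2⟩ := hM.isGammaSpace.edge_mem_flag _ _ hadj
  obtain rfl := colour_unique hM' h1
  obtain rfl := colour_unique hM' h2
  obtain ⟨u, hu, hpu⟩ := h.conn hp hq
  obtain ⟨v, w, h3, h4, h5⟩ := exists_split hM' hM.simplyConnected (s := {γ'}ᶜ) (t := {δ'}ᶜ) (E := E)
    (diffColours_subset_iff.2 fun ε hε => by
      obtain rfl : ε = γ' := by simpa using hε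
      exact h1.symm)
    (diffColours_subset_iff.2 fun ε hε => by
      obtain rfl : ε = δ' := by simpa using hε
      exact h2) hu (path_fst hpu)
  obtain ⟨k, h6, h7⟩ := hasPath_append.1
    (h3.hasPath (swappable_pairStep hM' hN.isGammaSpace.isGammaGraph) hpu)
  rw [diffColours_subset_iff.1 (diffColours_of_path h4 (path_snd h6)) γ' (by simp),
    ← diffColours_subset_iff.1 (diffColours_of_path h5 (path_snd h7)) δ' (by simp),
    k.2.adj_iff, ← E.adj_iff, h1, h2]
  exact hadj

/-- Shortest paths from a free extension to the pairs with a given property. -/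
theorem IsFree.exists_min_path (hRR' : ∀ x y, R x y → R' x y) (hR : NiceIso Γ R) {s : Set V}
    {g f : Flag Γ M × Flag Γ N} (hfree : IsFree R s g f) (hf : IsPair R' f)
    {Q : Flag Γ M × Flag Γ N → Prop} (hQ : ∃ h, IsPair R h ∧ Q h) :
    ∃ k h v, IsPair R k ∧ diffColours k.1 g.1 ⊆ s ∧ IsPair R h ∧ Q h ∧ HasPath (PairStep R) v k h ∧
      ((Red (· ≤ ·) LetterComm (⟨s, hfree.isLetter⟩ :: v) ∧
          HasPath (PairStep R') (⟨s, hfree.isLetter⟩ :: v) f h) ∨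
        (Red (· ≤ ·) LetterComm v ∧ (∃ a ∈ v, s ⊆ a.1) ∧ HasPath (PairStep R') v f h)) ∧
      ∀ p c q, v = p ++ c :: q → (∀ d ∈ q, LetterComm c d) → ∃ l, PairStep R c l h ∧ ¬ Q l := by
  have hM' := hM.isGammaSpace.isGammaGraph
  have hN' := hN.isGammaSpace.isGammaGraph
  have hsw := swappable_pairStep (R := R) hM' hN'
  have hsw' := swappable_pairStep (R := R') hM' hN'
  obtain ⟨h₀, hh₀, hQ₀⟩ := hQ
  obtain ⟨v₀, hv₀, hpv₀⟩ := hR.conn hfree.isPair hh₀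
  -- The start `k` may be any related pair that agrees with `g` off `s`, so a minimal path cannot
  -- begin with a letter contained in `s`.
  obtain ⟨⟨k, h, v⟩, ⟨hk, hkg, hh, hQh, hv, hp⟩, hmin⟩ := exists_rank_min
    (fun T : (Flag Γ M × Flag Γ N) × (Flag Γ M × Flag Γ N) × List (Letter Γ) =>
      IsPair R T.1 ∧ diffColours T.1.1 g.1 ⊆ s ∧ IsPair R T.2.1 ∧ Q T.2.1 ∧
      Red (· ≤ ·) LetterComm T.2.2 ∧ HasPath (PairStep R) T.2.2 T.1 T.2.1)
    (fun T => wordRank letterRank T.2.2)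
    ⟨(g, h₀, v₀), hfree.isPair, by simp [diffColours_self], hh₀, hQ₀, hv₀, hpv₀⟩
  simp only at hk hkg hh hQh hv hp
  set a : Letter Γ := ⟨s, hfree.isLetter⟩
  have hstep : PairStep R' a f k := ⟨(hfree.fst hk hkg).symm,
    (hfree.snd hk (by rwa [← hR.diffColours_eq hk hfree.isPair])).symm, hf,
    fun γ => hRR' _ _ (hk γ)⟩
  have hp' : HasPath (PairStep R') v k h := hp.mono fun _ _ _ => PairStep.mono hRR'
  refine ⟨k, h, v, hk, hkg, hh, hQh, hp, ?_, ?_⟩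
  · by_cases hred : Red (· ≤ ·) LetterComm (a :: v)
    · exact Or.inl ⟨hred, k, hstep, hp'⟩
    refine Or.inr ⟨hv, ?_⟩
    rw [red_cons] at hred
    have hmeet : Meets LetterComm a v := by
      by_contra hm; exact hred ⟨hv, hm⟩
    obtain ⟨y, b, z, rfl, hb⟩ := hmeet
    -- a letter contained in `s` can be removed from the beginning of `v`
    have hno : ¬ (b ≤ a ∧ ∀ c ∈ y, LetterComm b c) := by
      rintro ⟨hba, hby⟩
      have hS : Swaps LetterComm (y ++ b :: z) (b :: y ++ z) :=
        Swaps.symm letterSystem.symm (by simpa using swaps_move_right hby [] z)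
      obtain ⟨k', h1, h2⟩ := hS.hasPath hsw hp
      refine hmin (k', h, y ++ z) ⟨h1.2.2.2, ?_, hh, hQh,
        (hS.red letterSystem hv).right (u := [b]), h2⟩ rankLT_delete
      exact diffColours_trans (diffColours_symm (h1.1.1.2.le.trans hba)) hkg
    have hab : a < b ∧ ∀ c ∈ y, LetterComm a c := by
      rcases hb with hb | hb
      · refine ⟨lt_of_le_of_ne hb.1 ?_, hb.2⟩
        intro he
        exact hno ⟨he.ge, fun c hc => he ▸ hb.2 c hc⟩
      · exact absurd hb hno
    -- The step from `f` to `k` is absorbed by the larger letter `b`, so `v` itself leads from `f`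
    -- to `h`.
    refine ⟨⟨b, by simp, hab.1.le⟩, ?_⟩
    have h1 : HasPath (PairStep R') ((a :: y) ++ b :: z) f h := ⟨k, hstep, hp'⟩
    obtain ⟨l, h2, l', h3, h4⟩ := hasPath_append.1 h1
    obtain ⟨m, h5, h6⟩ := hasPath_append.1 (hsw'.move_right hab.2 h2)
    rw [hasPath_singleton] at h6
    refine hasPath_append.2 ⟨m, h5, l', ⟨?_, ?_, h6.2.2.1, h3.2.2.2⟩, h4⟩
    · exact (stepSystem_flag hM').absorb _ _ _ _ _ hab.1 h6.1 h3.1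
    · exact (stepSystem_flag hN').absorb _ _ _ _ _ hab.1 h6.2.1 h3.2.1
  · rintro p c q rfl hq
    have hS : Swaps LetterComm (p ++ c :: q) (p ++ q ++ [c]) := by
      simpa using swaps_move_right hq p []
    obtain ⟨l, h1, h2⟩ := hasPath_append.1 (hS.hasPath hsw hp)
    rw [hasPath_singleton] at h2
    exact ⟨l, h2, fun hQl => hmin (k, l, p ++ q) ⟨hk, hkg, h2.2.2.1, hQl,
      (hS.red letterSystem hv).left, h1⟩ rankLT_delete⟩

/-- A minimal path from `f` to a pair sharing its vertex of colour `γ` has a letter containing `s`,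
yet reduced paths between flags with that vertex in common avoid `γ`. -/
theorem IsFree.vertex_ne (hR : NiceIso Γ R) {s : Set V} {g f : Flag Γ M × Flag Γ N}
    (hfree : IsFree R s g f) {γ : V} (hγ : γ ∈ s) {h : Flag Γ M × Flag Γ N} (hh : IsPair R h) :
    h.1.vertex γ ≠ f.1.vertex γ := by
  intro he
  have hM' := hM.isGammaSpace.isGammaGraph
  obtain ⟨k, h, v, -, -, -, hQ, -, hw, -⟩ := hfree.exists_min_path hM hN (R' := extendRel R s f)
    (fun _ _ => Or.inl) hR hfree.isPair_extendRel (Q := fun p => p.1.vertex γ = f.1.vertex γ)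
    ⟨h, hh, he⟩
  have hd : diffColours f.1 h.1 ⊆ {γ}ᶜ := diffColours_subset_iff.2 fun δ hδ => by
    obtain rfl : δ = γ := by simpa using hδ
    exact hQ.symm
  rcases hw with ⟨h1, h2⟩ | ⟨h1, ⟨a, ha, hsa⟩, h2⟩
  · exact subset_of_diffColours hM' hM.simplyConnected hd h1 (path_fst h2) _ List.mem_cons_self hγ rfl
  · exact subset_of_diffColours hM' hM.simplyConnected hd h1 (path_fst h2) a ha (hsa hγ) rfl

/-- A flag through the edge splits a minimal path from `f` into a part avoiding `γ` and a part
avoiding `δ`. The letter containing `s` is in the second part, so `δ ∉ s`, and some final letter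
avoids `δ`. By minimality this cannot be a letter of `v`, so it is the initial `s`, which then
commutes with all of `v`; hence `v` avoids the neighbour `δ` of `γ`, and the vertex comes from `g`.
-/
theorem IsFree.vertex_eq_of_adj (hR : NiceIso Γ R) {s : Set V} {g f : Flag Γ M × Flag Γ N}
    (hfree : IsFree R s g f) {γ δ : V} (hγ : γ ∈ s) {h : Flag Γ M × Flag Γ N} (hh : IsPair R h)
    (hadj : Adj V (f.1.vertex γ) (h.1.vertex δ)) : δ ∉ s ∧ h.1.vertex δ = g.1.vertex δ := by
  have hM' := hM.isGammaSpace.isGammaGraph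
  obtain ⟨E, γ', δ', h1, h2⟩ := hM.isGammaSpace.edge_mem_flag _ _ hadj
  obtain rfl := colour_unique hM' h1
  obtain rfl := colour_unique hM' h2
  have hγδ : Γ.Adj γ' δ' := by rw [← E.adj_iff, h1, h2]; exact hadj
  obtain ⟨k, h', v, hk, hkg, -, hQ, hpv, hw, hmin⟩ := hfree.exists_min_path hM hN
    (R' := extendRel R s f) (fun _ _ => Or.inl) hR hfree.isPair_extendRel
    (Q := fun p => p.1.vertex δ' = h.1.vertex δ') ⟨h, hh, rfl⟩
  have key : ∀ w : List (Letter Γ), Red (· ≤ ·) LetterComm w →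
      HasPath (PairStep (extendRel R s f)) w f h' → (∃ a ∈ w, s ⊆ a.1) →
      δ' ∉ s ∧ ∃ p c q, w = p ++ c :: q ∧ (∀ d ∈ q, LetterComm c d) ∧ δ' ∉ c.1 := by
    rintro w hw hp ⟨a, ha, hsa⟩
    obtain ⟨v₁, v₂, h3, h4, h5⟩ := exists_split hM' hM.simplyConnected (s := {γ'}ᶜ) (t := {δ'}ᶜ)
      (E := E) (diffColours_subset_iff.2 fun ε hε => by
        obtain rfl : ε = γ' := by simpa using hε
        exact h1.symm)
      (diffColours_subset_iff.2 fun ε hε => by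
        obtain rfl : ε = δ' := by simpa using hε
        exact h2.trans hQ.symm) hw (path_fst hp)
    have ha2 : a ∈ v₂ := by
      rcases List.mem_append.1 (h3.perm.mem_iff.1 ha) with h6 | h6
      · exact absurd rfl (h4 a h6 (hsa hγ))
      · exact h6
    refine ⟨fun hδ => h5 a ha2 (hsa hδ) rfl, ?_⟩
    rcases List.eq_nil_or_concat v₂ with rfl | ⟨x, c, rfl⟩
    · simp at ha2
    · rw [List.concat_eq_append, ← List.append_assoc] at h3
      obtain ⟨p, q, h6, h7⟩ := final_of_swaps h3
      exact ⟨p, c, q, h6, h7, fun hδ => h5 c (by simp) hδ rfl⟩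
  have hno : ∀ p c q, v = p ++ c :: q → (∀ d ∈ q, LetterComm c d) → δ' ∈ c.1 := by
    intro p c q he hq
    by_contra hδ
    obtain ⟨l, h3, h4⟩ := hmin p c q he hq
    exact h4 ((diffColours_subset_iff.1 h3.1.1.2.le δ' hδ).trans hQ)
  rcases hw with ⟨h3, h4⟩ | ⟨h3, h4, h5⟩
  · obtain ⟨h5, p, c, q, h6, h7, h8⟩ := key _ h3 h4 ⟨_, List.mem_cons_self, subset_rfl⟩
    refine ⟨h5, ?_⟩
    rcases p with _ | ⟨p₁, p⟩
    · simp only [List.nil_append, List.cons.injEq] at h6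
      obtain ⟨rfl, rfl⟩ := h6
      have h9 := diffColours_of_path (t := {δ'}ᶜ) (fun a ha ε hε he => by
        obtain rfl : ε = δ' := he
        exact (h7 a ha γ' hγ ε hε).2 hγδ) (path_fst hpv)
      exact hQ.symm.trans ((diffColours_subset_iff.1 h9 δ' (by simp)).symm.trans
        (diffColours_subset_iff.1 hkg δ' h5))
    · simp only [List.cons_append, List.cons.injEq] at h6
      exact absurd (hno p c q h6.2 h7) h8
  · obtain ⟨-, p, c, q, h6, h7, h8⟩ := key v h3 h5 h4
    exact absurd (hno p c q h6 h7) h8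

omit hM hN [Finite V] in
/-- The pair `e` agrees with `f` on `s`, and `k` agrees with `g` on `s` and its neighbours. -/
structure IsTranslate (R : M → N → Prop) (s : Set V) (g f k e : Flag Γ M × Flag Γ N) : Prop where
  isPair : IsPair R k
  sub_fst : diffColours k.1 e.1 ⊆ s
  sub_snd : diffColours k.2 e.2 ⊆ s
  eq_fst : ∀ γ ∈ s, e.1.vertex γ = f.1.vertex γ
  eq_snd : ∀ γ ∈ s, e.2.vertex γ = f.2.vertex γ
  agree : ∀ γ ∈ s, k.1.vertex γ = g.1.vertex γ
  boundary : ∀ γ ∈ s, ∀ δ ∉ s, Γ.Adj γ δ → k.1.vertex δ = g.1.vertex δ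

/-- By `vertex_eq_of_adj` an old vertex next to a new one has its colour outside `s`. As `s` is
connected, `e` is new on all of `s` if anywhere, and replacing these vertices by those of `g` gives
an old pair. -/
theorem IsFree.exists_translate (hR : NiceIso Γ R) {s : Set V} {g f : Flag Γ M × Flag Γ N}
    (hfree : IsFree R s g f) {e : Flag Γ M × Flag Γ N} (he : IsPair (extendRel R s f) e) :
    IsPair R e ∨ ∃ k, IsTranslate R s g f k e := by
  have hM' := hM.isGammaSpace.isGammaGraph
  have hN' := hN.isGammaSpace.isGammaGraph
  by_cases hpair : IsPair R e
  · exact Or.inl hpair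
  refine Or.inr ?_
  simp only [IsPair, not_forall] at hpair
  obtain ⟨γ₀, hγ₀⟩ := hpair
  have hD : ∀ γ, ¬ R (e.1.vertex γ) (e.2.vertex γ) →
      γ ∈ s ∧ e.1.vertex γ = f.1.vertex γ ∧ e.2.vertex γ = f.2.vertex γ := by
    intro γ hγ
    rcases he γ with h | ⟨γ', h1, h2, h3⟩
    · exact absurd h hγ
    · obtain rfl := colour_unique hM' h2
      exact ⟨h1, h2, h3⟩
  have hbd : ∀ γ, ¬ R (e.1.vertex γ) (e.2.vertex γ) → ∀ δ, Γ.Adj γ δ →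
      R (e.1.vertex δ) (e.2.vertex δ) → δ ∉ s ∧ e.1.vertex δ = g.1.vertex δ := by
    intro γ hγ δ hadj hδ
    obtain ⟨h1, h2, h3⟩ := hD γ hγ
    obtain ⟨p, δ', h4, h5, h6⟩ := hR.cover hδ
    obtain rfl := colour_unique hM' h5
    rw [← h5]
    refine hfree.vertex_eq_of_adj hM hN hR h1 h4 ?_
    rw [← h2, h5, e.1.adj_iff]
    exact hadj
  have hsD : s ⊆ {γ | ¬ R (e.1.vertex γ) (e.2.vertex γ)} :=
    hfree.isLetter.subset_of_closed (hD γ₀ hγ₀).1 hγ₀ fun γ hγ hγD δ hδ hadj hR' =>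
      (hbd γ hγD δ hadj hR').1 hδ
  have hR' : ∀ γ ∉ s, R (e.1.vertex γ) (e.2.vertex γ) := fun γ hγ => by
    by_contra h
    exact hγ (hD γ h).1
  have hb1 : ∀ γ ∈ s, ∀ δ ∉ s, Γ.Adj γ δ → e.1.vertex δ = g.1.vertex δ := fun γ hγ δ hδ hadj =>
    (hbd γ (hsD hγ) δ hadj (hR' δ hδ)).2
  have hb2 : ∀ γ ∈ s, ∀ δ ∉ s, Γ.Adj γ δ → e.2.vertex δ = g.2.vertex δ := fun γ hγ δ hδ hadj => by
    refine hR.func (hR' δ hδ) ?_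
    rw [hb1 γ hγ δ hδ hadj]
    exact hfree.isPair δ
  obtain ⟨K, h1, h2, h3⟩ := exists_mixFlag hM' s e.1 g.1 hb1
  obtain ⟨K', h1', h2', h3'⟩ := exists_mixFlag hN' s e.2 g.2 hb2
  refine ⟨(K, K'), fun γ => ?_, h3, h3', fun γ hγ => (hD γ (hsD hγ)).2.1,
    fun γ hγ => (hD γ (hsD hγ)).2.2, h1, fun γ hγ δ hδ hadj => ?_⟩
  · by_cases hγ : γ ∈ s
    · simp only [h1 γ hγ, h1' γ hγ]
      exact hfree.isPair γ
    · simp only [h2 γ hγ, h2' γ hγ]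
      exact hR' γ hγ
  · exact (h2 δ hδ).trans (hb1 γ hγ δ hδ hadj)

/-- For an old pair `h` that agrees with `k` off `s`, planting its vertices in `s` into `g` gives an
old pair whose step to `f` is parallel to that from `h` to `e`. -/
theorem IsTranslate.isFree (hR : NiceIso Γ R) {s : Set V} {g f k e : Flag Γ M × Flag Γ N}
    (hfree : IsFree R s g f) (ht : IsTranslate R s g f k e) : IsFree R s k e := by
  have hM' := hM.isGammaSpace.isGammaGraph
  have hN' := hN.isGammaSpace.isGammaGraph
  have key : ∀ {h : Flag Γ M × Flag Γ N}, IsPair R h → diffColours h.1 k.1 ⊆ s →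
      FlagStep s h.1 e.1 ∧ FlagStep s h.2 e.2 := by
    intro h hh hd
    have hd2 : diffColours h.2 k.2 ⊆ s := by rwa [← hR.diffColours_eq hh ht.isPair]
    have hb1 : ∀ γ ∈ s, ∀ δ ∉ s, Γ.Adj γ δ → g.1.vertex δ = h.1.vertex δ := fun γ hγ δ hδ hadj =>
      ((diffColours_subset_iff.1 hd δ hδ).trans (ht.boundary γ hγ δ hδ hadj)).symm
    have hb2 : ∀ γ ∈ s, ∀ δ ∉ s, Γ.Adj γ δ → g.2.vertex δ = h.2.vertex δ := fun γ hγ δ hδ hadj =>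
      hR.func (hfree.isPair δ) (hb1 γ hγ δ hδ hadj ▸ hh δ)
    obtain ⟨K, h1, h2, h3⟩ := exists_mixFlag hM' s g.1 h.1 hb1
    obtain ⟨K', h1', h2', h3'⟩ := exists_mixFlag hN' s g.2 h.2 hb2
    have hm : IsPair R (K, K') := fun γ => by
      by_cases hγ : γ ∈ s
      · simp only [h1 γ hγ, h1' γ hγ]
        exact hh γ
      · simp only [h2 γ hγ, h2' γ hγ]
        exact hfree.isPair γ
    have h4 := hfree.fst hm h3
    have h4' := hfree.snd hm h3'
    exact ⟨Parallel.flagStep hM' ⟨h4.1.2.le, diffColours_trans hd ht.sub_fst,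
      h1, fun γ hγ => (ht.eq_fst γ hγ).symm,
      fun γ hγ δ hδ hadj => (h2 δ hδ).trans (hb1 γ hγ δ hδ hadj)⟩ h4,
      Parallel.flagStep hN' ⟨h4'.1.2.le, diffColours_trans hd2 ht.sub_snd,
      h1', fun γ hγ => (ht.eq_snd γ hγ).symm,
      fun γ hγ δ hδ hadj => (h2' δ hδ).trans (hb2 γ hγ δ hδ hadj)⟩ h4'⟩
  exact ⟨ht.isPair, fun hh hd => (key hh hd).1, fun hh hd =>
    (key hh (by rwa [hR.diffColours_eq hh ht.isPair])).2⟩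

theorem IsFree.exists_red_path (hRR' : ∀ x y, R x y → R' x y) (hR : NiceIso Γ R) {s : Set V}
    {g f h : Flag Γ M × Flag Γ N} (hfree : IsFree R s g f) (hf : IsPair R' f) (hh : IsPair R h) :
    ∃ u, Red (· ≤ ·) LetterComm u ∧ HasPath (PairStep R') u f h := by
  obtain ⟨k, h', v, -, -, -, rfl, -, hw, -⟩ := hfree.exists_min_path hM hN hRR' hR hf
    (Q := fun p => p = h) ⟨h, hh, rfl⟩
  rcases hw with ⟨h1, h2⟩ | ⟨h1, -, h2⟩
  · exact ⟨_, h1, h2⟩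
  · exact ⟨_, h1, h2⟩

/-- Both `k` and `k'` agree with `g` on `s` and its neighbours, so the letters of a reduced path
between them commute with `s`. Moving the step from `e` to `k` behind that path yields a path from
`e` to `e'` with the same word. -/
theorem IsTranslate.exists_red_path (hR : NiceIso Γ R) {s : Set V}
    {g f k e k' e' : Flag Γ M × Flag Γ N} (hfree : IsFree R s g f)
    (ht : IsTranslate R s g f k e) (ht' : IsTranslate R s g f k' e')
    (he : IsPair (extendRel R s f) e) :
    ∃ u, Red (· ≤ ·) LetterComm u ∧ HasPath (PairStep (extendRel R s f)) u e e' := by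
  have hM' := hM.isGammaSpace.isGammaGraph
  have hN' := hN.isGammaSpace.isGammaGraph
  obtain ⟨u, hu, hp⟩ := hR.conn ht.isPair ht'.isPair
  set t : Set V := {δ | δ ∉ s ∧ ∀ γ ∈ s, ¬ Γ.Adj γ δ}
  have hd : diffColours k.1 k'.1 ⊆ t := by
    rw [diffColours_subset_iff]
    intro δ hδ
    by_cases hδs : δ ∈ s
    · exact (ht.agree δ hδs).trans (ht'.agree δ hδs).symm
    · simp only [t, Set.mem_ofPred_eq, not_and, not_forall, not_not] at hδ
      obtain ⟨γ, hγ, hadj⟩ := hδ hδs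
      exact (ht.boundary γ hγ δ hδs hadj).trans (ht'.boundary γ hγ δ hδs hadj).symm
  have hut := subset_of_diffColours hM' hM.simplyConnected hd hu (path_fst hp)
  set a : Letter Γ := ⟨s, hfree.isLetter⟩
  have hst : ∀ b ∈ u, LetterComm a b := fun b hb γ hγ δ hδ =>
    ⟨fun h => (hut b hb hδ).1 (h ▸ hγ), (hut b hb hδ).2 γ hγ⟩
  have hfe := ht.isFree hM hN hR hfree
  have hstep : PairStep (extendRel R s f) a e k := ⟨hfe.step.symm,
    (hfe.snd ht.isPair (by simp [diffColours_self])).symm, he, fun γ => Or.inl (ht.isPair γ)⟩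
  have hp' : HasPath (PairStep (extendRel R s f)) (a :: u) e k' :=
    ⟨k, hstep, hp.mono fun _ _ _ => PairStep.mono fun _ _ => Or.inl⟩
  obtain ⟨m, h1, h2⟩ := hasPath_append.1 ((swappable_pairStep hM' hN').move_right hst hp')
  rw [hasPath_singleton] at h2
  refine ⟨u, hu, ?_⟩
  have hm : m = e' := by
    refine Prod.ext (Flag.ext (funext fun γ => ?_)) (Flag.ext (funext fun γ => ?_))
    · by_cases hγ : γ ∈ s
      · rw [ht'.eq_fst γ hγ, ← ht.eq_fst γ hγ]
        exact (diffColours_subset_iff.1 (diffColours_of_path hut (path_fst h1)) γ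
          fun h => h.1 hγ).symm
      · rw [← diffColours_subset_iff.1 ht'.sub_fst γ hγ]
        exact diffColours_subset_iff.1 h2.1.1.2.le γ hγ
    · by_cases hγ : γ ∈ s
      · rw [ht'.eq_snd γ hγ, ← ht.eq_snd γ hγ]
        exact (diffColours_subset_iff.1 (diffColours_of_path hut (path_snd h1)) γ
          fun h => h.1 hγ).symm
      · rw [← diffColours_subset_iff.1 ht'.sub_snd γ hγ]
        exact diffColours_subset_iff.1 h2.2.1.1.2.le γ hγ
  exact hm ▸ h1

/-- Free extensions of nice partial isomorphisms are nice. -/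
theorem IsFree.niceIso (hR : NiceIso Γ R) {s : Set V} {g f : Flag Γ M × Flag Γ N}
    (hfree : IsFree R s g f) : NiceIso Γ (extendRel R s f) where
  func {x y y'} h h' := by
    rcases h with h | ⟨γ, h1, rfl, rfl⟩ <;> rcases h' with h' | ⟨γ', h1', h2', h3'⟩
    · exact hR.func h h'
    · obtain ⟨p, δ, h4, h5, h6⟩ := hR.cover h
      obtain rfl := colour_unique hM.isGammaSpace.isGammaGraph (h5.trans h2')
      exact absurd (h5.trans h2') (hfree.vertex_ne hM hN hR h1' h4)
    · obtain ⟨p, δ, h4, h5, h6⟩ := hR.cover h'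
      obtain rfl := colour_unique hM.isGammaSpace.isGammaGraph h5
      exact absurd h5 (hfree.vertex_ne hM hN hR h1 h4)
    · obtain rfl := colour_unique hM.isGammaSpace.isGammaGraph h2'
      exact h3'.symm
  inj {x x' y} h h' := by
    rcases h with h | ⟨γ, h1, rfl, rfl⟩ <;> rcases h' with h' | ⟨γ', h1', h2', h3'⟩
    · exact hR.inj h h'
    · obtain ⟨p, δ, h4, h5, h6⟩ := hR.cover h
      obtain rfl := colour_unique hN.isGammaSpace.isGammaGraph (h6.trans h3')
      exact absurd (h6.trans h3') (hfree.flip.vertex_ne hN hM hR.flip h1' (h := p.swap) h4)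
    · obtain ⟨p, δ, h4, h5, h6⟩ := hR.cover h'
      obtain rfl := colour_unique hN.isGammaSpace.isGammaGraph h6
      exact absurd h6 (hfree.flip.vertex_ne hN hM hR.flip h1 (h := p.swap) h4)
    · obtain rfl := colour_unique hN.isGammaSpace.isGammaGraph h3'
      exact h2'.symm
  cover {x y} h := by
    rcases h with h | ⟨γ, h1, rfl, rfl⟩
    · obtain ⟨p, δ, h4, h5, h6⟩ := hR.cover h
      exact ⟨p, δ, fun γ => Or.inl (h4 γ), h5, h6⟩
    · exact ⟨f, γ, hfree.isPair_extendRel, rfl, rfl⟩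
  conn {p q} hp hq := by
    have hle : ∀ x y, R x y → extendRel R s f x y := fun _ _ => Or.inl
    rcases hfree.exists_translate hM hN hR hp with hp' | ⟨k, hk⟩ <;>
      rcases hfree.exists_translate hM hN hR hq with hq' | ⟨k', hk'⟩
    · obtain ⟨u, hu, h1⟩ := hR.conn hp' hq'
      exact ⟨u, hu, h1.mono fun _ _ _ => PairStep.mono hle⟩
    · obtain ⟨u, hu, h1⟩ := (hk'.isFree hM hN hR hfree).exists_red_path hM hN hle hR hq hp'
      exact ⟨u.reverse, hu.reverse, hasPath_reverse pairStep_symm h1⟩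
    · exact (hk.isFree hM hN hR hfree).exists_red_path hM hN hle hR hp hq'
    · exact hk.exists_red_path hM hN hR hfree hk' hp

omit hN in
/-- The first step of a shortest path from the domain of a partial isomorphism to a flag is
free. -/
theorem free_of_min {g : Flag Γ M × Flag Γ N} {F F₁ : Flag Γ M} {s : Letter Γ}
    {v : List (Letter Γ)} (h1 : LetterStep s g.1 F₁) (h2 : HasPath LetterStep v F₁ F)
    (hmin : ∀ (h : Flag Γ M × Flag Γ N) w, IsPair R h → HasPath LetterStep w h.1 F →
        ¬ RankLT (wordRank letterRank w) (wordRank letterRank (s :: v)))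
    {h : Flag Γ M × Flag Γ N} (hh : IsPair R h) (hd : diffColours h.1 g.1 ⊆ s.1) :
    FlagStep s.1 h.1 F₁ := by
  have hM' := hM.isGammaSpace.isGammaGraph
  rw [flagStep_iff hM']
  refine ⟨s.2, diffColours_trans hd h1.1.2.le, fun n hc => ?_⟩
  obtain ⟨w, hw, hpw⟩ := Chain.exists_path hM' hc
  refine hmin h (w ++ v) hh (hasPath_append.2 ⟨F₁, hpw, h2⟩) ?_
  exact rankLT_replace (x := []) fun c hc => Set.ncard_lt_ncard (hw c hc)

/-- The forth property, for a class of nice partial isomorphisms with free extensions. -/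
theorem NiceIso.forth {𝒞 : (M → N → Prop) → Prop}
    (hext : ∀ R, NiceIso Γ R → 𝒞 R → ∀ (s : Set V) (g : Flag Γ M × Flag Γ N) (F : Flag Γ M),
      IsPair R g → (∀ {h : Flag Γ M × Flag Γ N}, IsPair R h → diffColours h.1 g.1 ⊆ s →
        FlagStep s h.1 F) →
      ∃ F' : Flag Γ N, (∀ {h : Flag Γ M × Flag Γ N}, IsPair R h → diffColours h.2 g.2 ⊆ s →
        FlagStep s h.2 F') ∧ 𝒞 (extendRel R s (F, F')))
    (F : Flag Γ M) : ∀ {R : M → N → Prop}, NiceIso Γ R → 𝒞 R →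
      (∃ p : Flag Γ M × Flag Γ N, IsPair R p) →
      ∃ R', NiceIso Γ R' ∧ 𝒞 R' ∧ (∀ x y, R x y → R' x y) ∧ ∃ F', IsPair R' (F, F') := by
  -- Induction on the rank of a path from a related pair to `F`: if no related pair admits a smaller
  -- one, the first step is free, and adding its end point to the domain leaves a shorter path.
  suffices ∀ (m : Multiset ℕ) (R : M → N → Prop), NiceIso Γ R → 𝒞 R →
      (∃ (p : Flag Γ M × Flag Γ N) (u : List (Letter Γ)), IsPair R p ∧
        HasPath LetterStep u p.1 F ∧ wordRank letterRank u = m) →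
      ∃ R', NiceIso Γ R' ∧ 𝒞 R' ∧ (∀ x y, R x y → R' x y) ∧ ∃ F', IsPair R' (F, F') by
    rintro R hR hC ⟨p, hp⟩
    obtain ⟨u, -, hu⟩ := exists_path_of_diffColours hM.isGammaSpace.isGammaGraph Set.univ p.1 F
      (Set.subset_univ _)
    exact this _ R hR hC ⟨p, u, hp, hu, rfl⟩
  intro m
  induction m using wellFounded_rankLT.induction with
  | _ m ih =>
  rintro R hR hC ⟨g, u, hg, hu, rfl⟩
  by_cases hmin : ∀ (h : Flag Γ M × Flag Γ N) w, IsPair R h → HasPath LetterStep w h.1 F →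
      ¬ RankLT (wordRank letterRank w) (wordRank letterRank u)
  · rcases u with _ | ⟨s, v⟩
    · obtain ⟨G, G'⟩ := g
      obtain rfl : G = F := hu
      exact ⟨R, hR, hC, fun _ _ => id, G', hg⟩
    obtain ⟨F₁, h1, hv⟩ := hu
    have hF₁ : ∀ {h : Flag Γ M × Flag Γ N}, IsPair R h → diffColours h.1 g.1 ⊆ s.1 →
        FlagStep s.1 h.1 F₁ := fun hh hd => free_of_min hM h1 hv hmin hh hd
    obtain ⟨F', hF', hC'⟩ := hext R hR hC s.1 g F₁ hg hF₁
    have hfree : IsFree R s.1 g (F₁, F') := ⟨hg, hF₁, hF'⟩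
    obtain ⟨R', h1, h2, h3, h4⟩ := ih _ (rankLT_delete (x := [])) _ (hfree.niceIso hM hN hR) hC'
      ⟨(F₁, F'), v, hfree.isPair_extendRel, hv, rfl⟩
    exact ⟨R', h1, h2, fun x y h => h3 x y (Or.inl h), h4⟩
  · push Not at hmin
    obtain ⟨h, w, hh, hw, hlt⟩ := hmin
    exact ih _ hlt R hR hC ⟨h, w, hh, hw, rfl⟩

end NiceIso

/-! ### Flags far away from finitely many flags -/

section Far

variable {V : Type*} {Γ : SimpleGraph V} {M : Type*} [(lang V).Structure M]

theorem red_of_isChain {u : List (Letter Γ)}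
    (h : u.IsChain fun a b => ¬ LetterComm a b ∧ ¬ a ≤ b ∧ ¬ b ≤ a) :
    Red (· ≤ ·) LetterComm u := by
  rintro x a y b z rfl hc
  have h1 := (List.isChain_append.1 h).2.1
  rcases List.eq_nil_or_concat y with rfl | ⟨y, d, rfl⟩
  · have h2 := (List.isChain_cons_cons.1 h1).1
    rcases hc with hc | hc
    · exact h2.2.1 hc.1
    · exact h2.2.2 hc.1
  rw [List.concat_eq_append] at h1 hc
  rcases hc with hc | hc
  · cases y with
    | nil => exact (List.isChain_cons_cons.1 h1).1.1 (hc.2 d (by simp))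
    | cons e y => exact (List.isChain_cons_cons.1 h1).1.1 (hc.2 e (by simp))
  · have h2 : (([a] ++ y) ++ ([d] ++ (b :: z))).IsChain
        fun a b => ¬ LetterComm a b ∧ ¬ a ≤ b ∧ ¬ b ≤ a := by simpa using h1
    exact (List.isChain_cons_cons.1 (List.isChain_append.1 h2).2.1).1.1 (hc.2 d (by simp)).symm

theorem eq_of_swaps_of_isChain {u v : List (Letter Γ)}
    (h : u.IsChain fun a b => ¬ LetterComm a b ∧ ¬ a ≤ b ∧ ¬ b ≤ a) (hs : Swaps LetterComm u v) :
    u = v := by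
  rcases Relation.ReflTransGen.cases_head hs with he | ⟨w, h1, -⟩
  · exact he
  · obtain ⟨x, y, a, b, hab⟩ := h1
    exact absurd hab (List.isChain_cons_cons.1 (List.isChain_append.1 h).2.1).1.1

/-- A sequence that runs through the elements of a connected set. -/
theorem IsLetter.exists_tour [Finite V] {s : Set V} (hs : IsLetter Γ s) (h2 : s.Nontrivial) :
    ∃ (c : ℕ → V) (l : ℕ), (∀ i, c i ∈ s) ∧ (∀ i, Γ.Adj (c i) (c (i + 1))) ∧
      ∀ δ ∈ s, ∀ i, ∃ j, i ≤ j ∧ j < i + l ∧ c j = δ := by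
  classical
  obtain ⟨γ, hγ, γ', hγ', hne⟩ := h2
  have := Fintype.ofFinite s
  let v : s := ⟨γ, hγ⟩
  have key : ∀ S : Finset s, ∃ p : (Γ.induce s).Walk v v, ∀ x ∈ S, x ∈ p.support := by
    intro S
    induction S using Finset.induction_on with
    | empty => exact ⟨.nil, by simp⟩
    | insert x S _ ih =>
      obtain ⟨p, hp⟩ := ih
      obtain ⟨q⟩ := SimpleGraph.Connected.preconnected hs v x
      refine ⟨(q.append q.reverse).append p, fun y hy => ?_⟩
      rw [SimpleGraph.Walk.mem_support_append_iff, SimpleGraph.Walk.mem_support_append_iff]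
      rcases Finset.mem_insert.1 hy with rfl | hy
      · exact Or.inl (Or.inl q.end_mem_support)
      · exact Or.inr (hp y hy)
  obtain ⟨p, hp⟩ := key Finset.univ
  have hpos : 0 < p.length := by
    rw [Nat.pos_iff_ne_zero]
    intro h0
    have h1 := SimpleGraph.Walk.length_eq_zero_iff.1 h0
    have h2 := hp ⟨γ', hγ'⟩ (Finset.mem_univ _)
    rw [SimpleGraph.Walk.nil_iff_support_eq.1 h1] at h2
    exact hne (congrArg Subtype.val (List.mem_singleton.1 h2)).symm
  -- The closed walk `p` through all elements is repeated periodically, so each window of its length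
  -- is a full tour.
  refine ⟨fun i => (p.getVert (i % p.length)).1, p.length, fun i => Subtype.prop _, fun i => ?_,
    fun δ hδ i => ?_⟩
  · have h1 := p.adj_getVert_succ (Nat.mod_lt i hpos)
    have h2 : p.getVert ((i + 1) % p.length) = p.getVert (i % p.length + 1) := by
      rcases Nat.lt_or_ge (i % p.length + 1) p.length with h | h
      · rw [← Nat.mod_add_mod, Nat.mod_eq_of_lt h]
      · have h4 := Nat.mod_lt i hpos
        have h5 : i % p.length + 1 = p.length := by omega
        rw [← Nat.mod_add_mod, h5, Nat.mod_self, SimpleGraph.Walk.getVert_zero,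
          SimpleGraph.Walk.getVert_length]
    simp only [h2]
    exact h1
  · obtain ⟨n, hn, hle⟩ := SimpleGraph.Walk.mem_support_iff_exists_getVert.1
      (hp ⟨δ, hδ⟩ (Finset.mem_univ _))
    obtain ⟨n, hn, hlt⟩ : ∃ n, p.getVert n = ⟨δ, hδ⟩ ∧ n < p.length := by
      rcases hle.lt_or_eq with h | rfl
      · exact ⟨n, hn, h⟩
      · exact ⟨0, by rw [← hn]; simp, hpos⟩
    refine ⟨i + (n + (p.length - i % p.length)) % p.length, by omega,
      by have := Nat.mod_lt (n + (p.length - i % p.length)) hpos; omega, ?_⟩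
    have h4 := Nat.mod_lt i hpos
    have h5 : (i + (n + (p.length - i % p.length)) % p.length) % p.length = n := by
      rw [Nat.add_mod_mod, Nat.add_mod, ← Nat.mod_add_mod]
      simp only [Nat.mod_mod]
      rw [Nat.add_mod_mod, show i % p.length + (n + (p.length - i % p.length)) = n + p.length by omega,
        Nat.add_mod_right, Nat.mod_eq_of_lt hlt]
    simp only [h5, hn]

/-- A segment of a sequence of colours, as a word. -/
def segment (Γ : SimpleGraph V) (c : ℕ → V) : ℕ → ℕ → List (Letter Γ)
  | _, 0 => []
  | i, n + 1 => ⟨{c i}, isLetter_singleton _⟩ :: segment Γ c (i + 1) n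

theorem mem_segment {c : ℕ → V} {n i j : ℕ} (h1 : i ≤ j) (h2 : j < i + n) :
    (⟨{c j}, isLetter_singleton _⟩ : Letter Γ) ∈ segment Γ c i n := by
  induction n generalizing i with
  | zero => omega
  | succ n ih =>
    rcases h1.eq_or_lt with rfl | h1
    · exact List.mem_cons_self
    · exact List.mem_cons_of_mem _ (ih h1 (by omega))

theorem segment_append {c : ℕ → V} {n i : ℕ} {v w : List (Letter Γ)}
    (h : segment Γ c i n = v ++ w) :
    ∃ k l, v = segment Γ c i k ∧ w = segment Γ c (i + k) l ∧ n = k + l := by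
  induction n generalizing i v with
  | zero =>
    obtain ⟨rfl, rfl⟩ := List.append_eq_nil_iff.1 h.symm
    exact ⟨0, 0, rfl, rfl, rfl⟩
  | succ n ih =>
    rcases v with _ | ⟨a, v⟩
    · exact ⟨0, n + 1, rfl, h.symm, by omega⟩
    · simp only [segment, List.cons_append, List.cons.injEq] at h
      obtain ⟨k, l, rfl, rfl, rfl⟩ := ih h.2
      exact ⟨k + 1, l, by rw [segment, h.1], by rw [add_assoc, add_comm 1 k], by omega⟩

theorem isChain_segment {c : ℕ → V} (hc : ∀ i, Γ.Adj (c i) (c (i + 1))) (i n : ℕ) :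
    (segment Γ c i n).IsChain fun a b => ¬ LetterComm a b ∧ ¬ a ≤ b ∧ ¬ b ≤ a := by
  induction n generalizing i with
  | zero => exact .nil
  | succ n ih =>
    cases n with
    | zero => exact .singleton _
    | succ n =>
      refine List.isChain_cons_cons.2 ⟨⟨fun h => (h _ rfl _ rfl).2 (hc i), fun h => ?_, fun h => ?_⟩,
        ih (i + 1)⟩
      · exact (hc i).ne (h rfl)
      · exact (hc i).ne' (h rfl)

/-- A block that excludes some colour of `s` contains no full tour and so has length at most `l`. -/
theorem le_of_blocked_segment {c : ℕ → V} {s : Set V} {l : ℕ}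
    (hl : ∀ δ ∈ s, ∀ i, ∃ j, i ≤ j ∧ j < i + l ∧ c j = δ) {Ps : List (Letter Γ → Prop)}
    (hP : ∀ P ∈ Ps, ∃ δ ∈ s, ¬ P ⟨{δ}, isLetter_singleton _⟩) {i n : ℕ}
    (h : Blocked Ps (segment Γ c i n)) : n ≤ Ps.length * l := by
  induction Ps generalizing i n with
  | nil =>
    cases n with
    | zero => simp
    | succ n => simp [Blocked, segment] at h
  | cons P Ps ih =>
    obtain ⟨v, w, he, h1, h2⟩ := h
    obtain ⟨k, m, rfl, rfl, rfl⟩ := segment_append he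
    have h3 := ih (fun P hP' => hP P (by simp [hP'])) h2
    have h4 : k ≤ l := by
      by_contra hlt
      obtain ⟨δ, hδ, hPδ⟩ := hP P (by simp)
      obtain ⟨j, h5, h6, rfl⟩ := hl δ hδ i
      exact hPδ (h1 _ (mem_segment h5 (by omega)))
    rw [List.length_cons, Nat.succ_mul]
    omega

theorem flagStep_singleton_iff [Finite V] (hM : IsGammaGraph Γ M) {γ : V} {F G : Flag Γ M} :
    FlagStep {γ} F G ↔ F ≠ G ∧ diffColours F G ⊆ {γ} := by
  rw [flagStep_iff hM]
  refine ⟨fun h => ⟨?_, h.2.1⟩, fun h => ⟨isLetter_singleton γ, h.2, fun n hc => h.1 ?_⟩⟩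
  · rintro rfl
    exact h.2.2 0 rfl
  · refine eq_of_diffColours_subset_empty (hc.diffColours_subset fun t ht => ?_)
    rw [Set.ssubset_singleton_iff.1 ht]

variable [Finite V] (hM : IsRichSimplyConnected Γ M)
include hM

theorem exists_flagStep_singleton (γ : V) (F : Flag Γ M) : ∃ G, FlagStep {γ} F G := by
  obtain ⟨G, h1, h2⟩ := (hM.rich γ F).exists_notMem_finset {F}
  exact ⟨G, (flagStep_singleton_iff hM.isGammaSpace.isGammaGraph).2
    ⟨fun h => h2 (by simp [h]), diffColours_symm h1⟩⟩

omit hM in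
theorem Chain.exists_blocked_path (hM : IsGammaGraph Γ M) {𝒯 : Set (Set V)} {n : ℕ}
    {F G : Flag Γ M} (h : Chain 𝒯 n F G) :
    ∃ (Ps : List (Letter Γ → Prop)) (u : List (Letter Γ)), Ps.length = n ∧
      (∀ P ∈ Ps, ∃ t ∈ 𝒯, P = fun a => a.1 ⊆ t) ∧ Blocked Ps u ∧ HasPath LetterStep u F G := by
  induction n generalizing F with
  | zero => exact ⟨[], [], rfl, by simp, rfl, h⟩
  | succ n ih =>
    obtain ⟨H, ⟨t, ht, h1⟩, h2⟩ := h
    obtain ⟨Ps, u, h3, h4, h5, h6⟩ := ih h2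
    obtain ⟨v, hv, hpv⟩ := exists_path_of_diffColours hM t F H h1
    refine ⟨(fun a => a.1 ⊆ t) :: Ps, v ++ u, by simp [h3], fun P hP => ?_, ⟨v, u, rfl, hv, h5⟩,
      hasPath_append.2 ⟨H, hpv, h6⟩⟩
    rcases List.mem_cons.1 hP with rfl | hP
    · exact ⟨t, ht, rfl⟩
    · exact h4 P hP

/-- There are flags that differ from a given flag only at a given letter, and are far away from
finitely many given flags. -/
theorem exists_far {s : Set V} (hs : IsLetter Γ s) (G : Flag Γ M) (T : Set (Flag Γ M))
    (hT : T.Finite) (k : ℕ) :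
    ∃ F, diffColours G F ⊆ s ∧ ∀ H ∈ T, ¬ Chain (properSubsets s) k H F := by
  have hM' := hM.isGammaSpace.isGammaGraph
  rcases Set.subsingleton_or_nontrivial s with h1 | h2
  · obtain ⟨γ, hγ⟩ := hs.nonempty
    obtain rfl := h1.eq_singleton_of_mem hγ
    obtain ⟨F, h1, h2⟩ := (hM.rich γ G).exists_notMem_finite hT
    refine ⟨F, diffColours_symm h1, fun H hH hc => h2 ?_⟩
    have : H = F := eq_of_diffColours_subset_empty (hc.diffColours_subset fun t ht => by
      rw [Set.ssubset_singleton_iff.1 ht])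
    exact this ▸ hH
  obtain ⟨c, l, hcs, hadj, hl⟩ := hs.exists_tour h2
  choose f hf using fun γ F => exists_flagStep_singleton hM γ F
  let E : ℕ → Flag Γ M := fun n => Nat.rec G (fun i F => f (c i) F) n
  have hE : ∀ i, FlagStep {c i} (E i) (E (i + 1)) := fun i => hf _ _
  have hpath : ∀ n i, HasPath LetterStep (segment Γ c i n) (E i) (E (i + n)) := by
    intro n
    induction n with
    | zero => exact fun i => rfl
    | succ n ih =>
      intro i
      refine ⟨E (i + 1), hE i, ?_⟩
      rw [show i + (n + 1) = i + 1 + n by omega]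
      exact ih (i + 1)
  have hGE : ∀ n, diffColours G (E n) ⊆ s := by
    intro n
    induction n with
    | zero => exact (diffColours_self G).le.trans (Set.empty_subset _)
    | succ n ih =>
      exact diffColours_trans ih ((hE n).1.2.le.trans (Set.singleton_subset_iff.2 (hcs n)))
  have hbound : ∀ i n m, Chain (properSubsets s) m (E i) (E (i + n)) → n ≤ m * l := by
    intro i n m hc
    obtain ⟨Ps, u, h3, h4, h5, h6⟩ := hc.exists_blocked_path hM'
    obtain ⟨w, h7, h8, h9⟩ := (stepSystem_flag hM').exists_red h6
    have h10 := h9.blocked (fun P hP a b hab hb => by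
      obtain ⟨t, -, rfl⟩ := h4 P hP
      exact Set.Subset.trans hab hb) h5
    rw [← eq_of_swaps_of_isChain (isChain_segment hadj i n) (flag_swaps hM' hM.simplyConnected
      (red_of_isChain (isChain_segment hadj i n)) h8 (hpath n i) h7)] at h10
    rw [← h3]
    refine le_of_blocked_segment hl (fun P hP => ?_) h10
    obtain ⟨t, ht, rfl⟩ := h4 P hP
    obtain ⟨δ, hδ, hδt⟩ := Set.exists_of_ssubset ht
    exact ⟨δ, hδ, fun h => hδt (h rfl)⟩
  by_contra hno
  push Not at hno
  have := hT.to_subtype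
  -- The sampled flags are more than `2 * k * l` steps apart, so no two of them lie within `k`
  -- changes of the same flag of the finite set `T`.
  choose g hg using fun n : ℕ => hno (E (n * (2 * k * l + 1))) (hGE _)
  obtain ⟨m, n, hne, he⟩ := Finite.exists_ne_map_eq_of_infinite fun n => (⟨g n, (hg n).1⟩ : T)
  wlog hlt : m < n generalizing m n
  · exact this n m hne.symm he.symm (by omega)
  have h3 := (hg m).2.symm
  rw [show g m = g n from congrArg Subtype.val he] at h3
  have h4 := h3.trans (hg n).2
  obtain ⟨d, rfl⟩ := Nat.exists_eq_add_of_lt hlt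
  have h5 := hbound (m * (2 * k * l + 1)) ((d + 1) * (2 * k * l + 1)) (k + k) (by
    rwa [← add_mul, ← add_assoc])
  nlinarith [Nat.zero_le (d * (2 * k * l + 1))]

end Far

/-! ### Axioms for rich simply connected spaces -/

section Formulas

open FirstOrder.Language

variable {V : Type*} {α : Type*}

/-- Adjacency, as a formula. -/
def adjF (a b : α) : (lang V).Formula α :=
  Relations.formula₂ (L := lang V) (GraphRel.adj : GraphRel V 2) (Term.var a) (Term.var b)

/-- The colour predicates, as formulas. -/
def colF (γ : V) (a : α) : (lang V).Formula α :=
  Relations.formula₁ (L := lang V) (GraphRel.colour γ : GraphRel V 1) (Term.var a)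

/-- Equality of variables, as a formula. -/
def eqF (a b : α) : (lang V).Formula α := Term.equal (Term.var a) (Term.var b)

open Classical in
/-- A proposition, as a formula. -/
noncomputable def propF (p : Prop) : (lang V).Formula α := if p then ⊤ else ⊥

section
variable {M : Type*} [(lang V).Structure M] {v : α → M}

@[simp] theorem realize_adjF {a b : α} : (adjF a b : (lang V).Formula α).Realize v ↔
    Adj V (v a) (v b) := Formula.realize_rel₂

@[simp] theorem realize_colF {γ : V} {a : α} : (colF γ a).Realize v ↔ HasColour γ (v a) :=
  Formula.realize_rel₁

@[simp] theorem realize_eqF {a b : α} : (eqF a b : (lang V).Formula α).Realize v ↔ v a = v b :=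
  Formula.realize_equal

@[simp] theorem realize_propF {p : Prop} : (propF p : (lang V).Formula α).Realize v ↔ p := by
  by_cases hp : p <;> simp [propF, hp]

end

variable [Finite V] (Γ : SimpleGraph V)

/-- The family `x` of variables denotes a flag. -/
noncomputable def flagF (x : V → α) : (lang V).Formula α :=
  Formula.iInf fun γ => colF γ (x γ) ⊓
    Formula.iInf fun δ => (adjF (x γ) (x δ)).iff (propF (Γ.Adj γ δ))

/-- Two families of vertices agree off `s`. -/
noncomputable def agreeF (s : Set V) : (lang V).Formula (V ⊕ V) :=
  Formula.iInf fun γ => propF (γ ∈ s) ⊔ eqF (Sum.inl γ) (Sum.inr γ)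

/-- Composition of relations between flags. -/
noncomputable def compF (φ ψ : (lang V).Formula (V ⊕ V)) : (lang V).Formula (V ⊕ V) :=
  Formula.iExs V (flagF Γ Sum.inr ⊓ (φ.relabel (Sum.elim (Sum.inl ∘ Sum.inl) Sum.inr) ⊓
    ψ.relabel (Sum.elim Sum.inr (Sum.inl ∘ Sum.inr))))

/-- `Chain`, as a formula. -/
noncomputable def chainF (𝒯 : Set (Set V)) : ℕ → (lang V).Formula (V ⊕ V)
  | 0 => agreeF ∅
  | n + 1 => compF Γ (Formula.iSup fun t : 𝒯 => agreeF t) (chainF 𝒯 n)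

/-- Paths of tight steps, as a formula. -/
noncomputable def tightF (N : ℕ) : List (Set V) → (lang V).Formula (V ⊕ V)
  | [] => agreeF ∅
  | s :: u => compF Γ (agreeF s ⊓ (chainF Γ (properSubsets s) N).not) (tightF N u)

section
variable {M : Type*} [(lang V).Structure M] {v : α → M} {Γ}

theorem realize_flagF {x : V → α} : (flagF Γ x).Realize v ↔
    ∃ F : Flag Γ M, F.vertex = v ∘ x := by
  simp only [flagF, Formula.realize_iInf, Formula.realize_inf, realize_colF, Formula.realize_iff,
    realize_adjF, realize_propF]
  constructor
  · exact fun h => ⟨⟨v ∘ x, fun γ => (h γ).1, fun γ => (h γ).2⟩, rfl⟩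
  · rintro ⟨F, hF⟩ γ
    have h1 : ∀ γ, v (x γ) = F.vertex γ := fun γ => by rw [hF]; rfl
    simp only [h1]
    exact ⟨F.hasColour γ, F.adj_iff γ⟩

theorem realize_agreeF {s : Set V} {F G : Flag Γ M} :
    (agreeF s).Realize (Sum.elim F.vertex G.vertex) ↔ diffColours F G ⊆ s := by
  simp only [agreeF, Formula.realize_iInf, Formula.realize_sup, realize_propF, realize_eqF,
    Sum.elim_inl, Sum.elim_inr, diffColours_subset_iff]
  exact forall_congr' fun γ => or_iff_not_imp_left

theorem realize_compF {φ ψ : (lang V).Formula (V ⊕ V)} {F G : Flag Γ M} :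
    (compF Γ φ ψ).Realize (Sum.elim F.vertex G.vertex) ↔
      ∃ H : Flag Γ M, φ.Realize (Sum.elim F.vertex H.vertex) ∧
        ψ.Realize (Sum.elim H.vertex G.vertex) := by
  simp only [compF, Formula.realize_iExs, Formula.realize_inf, realize_flagF,
    Formula.realize_relabel]
  have h1 : ∀ i : V → M, Sum.elim (Sum.elim F.vertex G.vertex) i ∘
      Sum.elim (Sum.inl ∘ Sum.inl) Sum.inr = Sum.elim F.vertex i := fun i => by
    funext γ; cases γ <;> rfl
  have h2 : ∀ i : V → M, Sum.elim (Sum.elim F.vertex G.vertex) i ∘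
      Sum.elim Sum.inr (Sum.inl ∘ Sum.inr) = Sum.elim i G.vertex := fun i => by
    funext γ; cases γ <;> rfl
  simp only [h1, h2, Sum.elim_comp_inr]
  constructor
  · rintro ⟨_, ⟨H, rfl⟩, h⟩
    exact ⟨H, h⟩
  · rintro ⟨H, h⟩
    exact ⟨_, ⟨H, rfl⟩, h⟩

theorem realize_chainF {𝒯 : Set (Set V)} {n : ℕ} {F G : Flag Γ M} :
    (chainF Γ 𝒯 n).Realize (Sum.elim F.vertex G.vertex) ↔ Chain 𝒯 n F G := by
  induction n generalizing F with
  | zero =>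
    rw [chainF, realize_agreeF]
    refine ⟨eq_of_diffColours_subset_empty, ?_⟩
    rintro (rfl : F = G)
    exact (diffColours_self F).le
  | succ n ih =>
    rw [chainF, realize_compF]
    simp only [ih, Formula.realize_iSup, realize_agreeF, Chain, Subtype.exists, exists_prop]

theorem realize_tightF {N : ℕ} {u : List (Set V)} {F G : Flag Γ M} :
    (tightF Γ N u).Realize (Sum.elim F.vertex G.vertex) ↔ HasPath (TightStep N) u F G := by
  induction u generalizing F with
  | nil =>
    rw [tightF, realize_agreeF]
    refine ⟨eq_of_diffColours_subset_empty, ?_⟩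
    rintro (rfl : F = G)
    exact (diffColours_self F).le
  | cons s u ih =>
    rw [tightF, realize_compF]
    simp only [ih, Formula.realize_inf, Formula.realize_not, realize_agreeF, realize_chainF,
      HasPath, TightStep]

end

/-- There is no closed tight path with word `u`. -/
noncomputable def notClosedS (u : List (Set V)) : (lang V).Sentence :=
  Formula.iAlls (α := Empty) V ((flagF Γ Sum.inr).imp
    ((tightF Γ (u.length + 1) u).relabel (Sum.elim Sum.inr Sum.inr)).not)

/-- Every flag has `n` variations at the colour `γ`. -/
noncomputable def richS (γ : V) (n : ℕ) : (lang V).Sentence :=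
  Formula.iAlls (α := Empty) V ((flagF Γ Sum.inr).imp (Formula.iExs (Fin n × V)
    (Formula.iInf fun i : Fin n => flagF Γ (fun δ => Sum.inr (i, δ)) ⊓
      ((agreeF {γ}).relabel (Sum.elim (fun δ => Sum.inr (i, δ)) fun δ => Sum.inl (Sum.inr δ)) ⊓
        Formula.iInf fun j : Fin n => propF (i = j) ⊔
          (eqF (Sum.inr (i, γ)) (Sum.inr (j, γ))).not))))

/-- Adjacency is symmetric. -/
noncomputable def symmS : (lang V).Sentence :=
  Formula.iAlls (α := Empty) Bool
    ((adjF (Sum.inr true) (Sum.inr false)).imp (adjF (Sum.inr false) (Sum.inr true)))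

/-- Adjacency is irreflexive. -/
noncomputable def irreflS : (lang V).Sentence :=
  Formula.iAlls (α := Empty) Unit (adjF (Sum.inr ()) (Sum.inr ())).not

/-- Every vertex has exactly one colour. -/
noncomputable def colourS : (lang V).Sentence :=
  Formula.iAlls (α := Empty) Unit (Formula.iSup fun γ : V => colF γ (Sum.inr ()) ⊓
    Formula.iInf fun δ : V => (colF δ (Sum.inr ())).imp (propF (δ = γ)))

/-- The colours of adjacent vertices are adjacent. -/
noncomputable def adjColourS : (lang V).Sentence :=
  Formula.iAlls (α := Empty) Bool (Formula.iInf fun γ : V => Formula.iInf fun δ : V =>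
    (colF γ (Sum.inr true)).imp ((colF δ (Sum.inr false)).imp
      ((adjF (Sum.inr true) (Sum.inr false)).imp (propF (Γ.Adj γ δ)))))

/-- Every vertex lies in a flag. -/
noncomputable def vertexS : (lang V).Sentence :=
  Formula.iAlls (α := Empty) Unit (Formula.iExs V (flagF Γ Sum.inr ⊓
    Formula.iSup fun γ : V => eqF (Sum.inr γ) (Sum.inl (Sum.inr ()))))

/-- Every edge lies in a flag. -/
noncomputable def edgeS : (lang V).Sentence :=
  Formula.iAlls (α := Empty) Bool ((adjF (Sum.inr true) (Sum.inr false)).imp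
    (Formula.iExs V (flagF Γ Sum.inr ⊓ Formula.iSup fun γ : V => Formula.iSup fun δ : V =>
      eqF (Sum.inr γ) (Sum.inl (Sum.inr true)) ⊓ eqF (Sum.inr δ) (Sum.inl (Sum.inr false)))))

/-- Axioms for rich simply connected spaces. -/
inductive IsAxiom : (lang V).Sentence → Prop
  | symm : IsAxiom symmS
  | irrefl : IsAxiom irreflS
  | colour : IsAxiom colourS
  | adjColour : IsAxiom (adjColourS Γ)
  | vertex : IsAxiom (vertexS Γ)
  | edge : IsAxiom (edgeS Γ)
  | notClosed (u : List (Set V)) : u ≠ [] → (∀ s ∈ u, IsLetter Γ s) → IsReducedWord Γ u →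
      IsAxiom (notClosedS Γ u)
  | rich (γ : V) (n : ℕ) : IsAxiom (richS Γ γ n)

variable {Γ} (M : Type*) [(lang V).Structure M]

omit [Finite V] in
theorem realize_symmS : M ⊨ (symmS : (lang V).Sentence) ↔ ∀ x y : M, Adj V x y → Adj V y x := by
  simp only [symmS, Sentence.Realize, Formula.realize_iAlls, Formula.realize_imp, realize_adjF,
    Sum.elim_inr]
  exact ⟨fun h x y => h fun b => cond b x y, fun h i => h _ _⟩

omit [Finite V] in
theorem realize_irreflS : M ⊨ (irreflS : (lang V).Sentence) ↔ ∀ x : M, ¬ Adj V x x := by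
  simp only [irreflS, Sentence.Realize, Formula.realize_iAlls, Formula.realize_not, realize_adjF,
    Sum.elim_inr]
  exact ⟨fun h x => h fun _ => x, fun h i => h _⟩

theorem realize_colourS : M ⊨ (colourS : (lang V).Sentence) ↔ ∀ x : M, ∃! γ : V, HasColour γ x := by
  simp only [colourS, Sentence.Realize, Formula.realize_iAlls, Formula.realize_iSup,
    Formula.realize_inf, Formula.realize_iInf, Formula.realize_imp, realize_colF, realize_propF,
    Sum.elim_inr]
  exact ⟨fun h x => h fun _ => x, fun h i => h _⟩

theorem realize_adjColourS : M ⊨ adjColourS Γ ↔ ∀ (x y : M) (γ δ : V), HasColour γ x →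
    HasColour δ y → Adj V x y → Γ.Adj γ δ := by
  simp only [adjColourS, Sentence.Realize, Formula.realize_iAlls, Formula.realize_iInf,
    Formula.realize_imp, realize_colF, realize_adjF, realize_propF, Sum.elim_inr]
  exact ⟨fun h x y => h fun b => cond b x y, fun h i => h _ _⟩

theorem realize_vertexS : M ⊨ vertexS Γ ↔ ∀ x : M, ∃ (F : Flag Γ M) (γ : V), F.vertex γ = x := by
  simp only [vertexS, Sentence.Realize, Formula.realize_iAlls, Formula.realize_iExs,
    Formula.realize_inf, Formula.realize_iSup, realize_flagF, realize_eqF, Sum.elim_inr,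
    Sum.elim_inl, Sum.elim_comp_inr]
  refine ⟨fun h x => ?_, fun h i => ?_⟩
  · obtain ⟨_, ⟨F, rfl⟩, γ, h1⟩ := h fun _ => x
    exact ⟨F, γ, h1⟩
  · obtain ⟨F, γ, h1⟩ := h (i ())
    exact ⟨_, ⟨F, rfl⟩, γ, h1⟩

theorem realize_edgeS : M ⊨ edgeS Γ ↔ ∀ x y : M, Adj V x y →
    ∃ (F : Flag Γ M) (γ δ : V), F.vertex γ = x ∧ F.vertex δ = y := by
  simp only [edgeS, Sentence.Realize, Formula.realize_iAlls, Formula.realize_iExs,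
    Formula.realize_inf, Formula.realize_iSup, Formula.realize_imp, realize_adjF, realize_flagF,
    realize_eqF, Sum.elim_inr, Sum.elim_inl, Sum.elim_comp_inr]
  refine ⟨fun h x y hxy => ?_, fun h i hi => ?_⟩
  · obtain ⟨_, ⟨F, rfl⟩, γ, δ, h1⟩ := h (fun b => cond b x y) hxy
    exact ⟨F, γ, δ, h1⟩
  · obtain ⟨F, γ, δ, h1⟩ := h _ _ hi
    exact ⟨_, ⟨F, rfl⟩, γ, δ, h1⟩

theorem realize_notClosedS {u : List (Set V)} : M ⊨ notClosedS Γ u ↔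
    ∀ F : Flag Γ M, ¬ HasPath (TightStep (u.length + 1)) u F F := by
  simp only [notClosedS, Sentence.Realize, Formula.realize_iAlls, Formula.realize_imp,
    Formula.realize_not, Formula.realize_relabel, realize_flagF, Sum.elim_comp_inr]
  have h1 : ∀ i : V → M, (Sum.elim (default : Empty → M) i ∘ Sum.elim Sum.inr Sum.inr : V ⊕ V → M)
      = Sum.elim i i := fun i => by
    funext γ; cases γ <;> rfl
  simp only [h1, forall_exists_index]
  refine ⟨fun h F hp => h _ F rfl (realize_tightF.2 hp), ?_⟩
  rintro h _ F rfl hp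
  exact h F (realize_tightF.1 hp)

theorem realize_richS {γ : V} {n : ℕ} : M ⊨ richS Γ γ n ↔ ∀ G : Flag Γ M,
    ∃ f : Fin n → Flag Γ M, Function.Injective f ∧ ∀ i, diffColours (f i) G ⊆ {γ} := by
  simp only [richS, Sentence.Realize, Formula.realize_iAlls, Formula.realize_imp,
    Formula.realize_iExs, Formula.realize_iInf, Formula.realize_inf, Formula.realize_sup,
    Formula.realize_not, Formula.realize_relabel, realize_flagF, Sum.elim_comp_inr, realize_propF,
    realize_eqF, Sum.elim_inr]
  have h1 : ∀ (F : V → M) (g : Fin n × V → M) (i : Fin n),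
      (Sum.elim (Sum.elim (default : Empty → M) F) g ∘
        Sum.elim (fun δ => Sum.inr (i, δ)) fun δ => Sum.inl (Sum.inr δ) : V ⊕ V → M) =
      Sum.elim (fun δ => g (i, δ)) F := fun F g i => by
    funext γ; cases γ <;> rfl
  have h2 : ∀ (F : V → M) (g : Fin n × V → M) (i : Fin n),
      (Sum.elim (Sum.elim (default : Empty → M) F) g ∘ fun δ => Sum.inr (i, δ)) =
      fun δ => g (i, δ) := fun F g i => rfl
  simp only [h1, h2, forall_exists_index]
  constructor
  · intro h G
    obtain ⟨g, hg⟩ := h _ G rfl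
    choose f hf using fun i => (hg i).1
    refine ⟨f, fun i j hij => ?_, fun i => ?_⟩
    · by_contra hne
      refine ((hg i).2.2 j).elim hne fun h => h ?_
      have h3 := congrFun (hf i) γ
      have h4 := congrFun (hf j) γ
      rw [← h3, ← h4, hij]
    · have := (hg i).2.1
      rw [← hf i] at this
      exact realize_agreeF.1 this
  · rintro h _ G rfl
    obtain ⟨f, hf, hfG⟩ := h G
    refine ⟨fun p => (f p.1).vertex p.2, fun i => ⟨⟨f i, rfl⟩, realize_agreeF.2 (hfG i), fun j => ?_⟩⟩
    refine or_iff_not_imp_left.2 fun hij he => hij (hf (Flag.ext (funext fun δ => ?_)))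
    by_cases hδ : δ = γ
    · rw [hδ]; exact he
    · rw [diffColours_subset_iff.1 (hfG i) δ hδ, diffColours_subset_iff.1 (hfG j) δ hδ]

/-- Simple connectedness becomes the scheme `notClosedS` by `simplyConnected_iff`, and infinitude
becomes the scheme `richS`. That the class is elementary is what allows the passage to ultrapowers.
-/
theorem forall_isAxiom_iff : (∀ φ, IsAxiom Γ φ → M ⊨ φ) ↔ IsRichSimplyConnected Γ M := by
  constructor
  · intro h
    have hM : IsGammaGraph Γ M := ⟨(realize_symmS M).1 (h _ .symm),
      (realize_irreflS M).1 (h _ .irrefl), (realize_colourS M).1 (h _ .colour),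
      (realize_adjColourS M).1 (h _ .adjColour)⟩
    refine ⟨⟨hM, (realize_vertexS M).1 (h _ .vertex), (realize_edgeS M).1 (h _ .edge)⟩,
      (simplyConnected_iff hM).2 fun u hne hu hr =>
        (realize_notClosedS M).1 (h _ (.notClosed u hne hu hr)), fun γ G hfin => ?_⟩
    obtain ⟨f, hf, hfG⟩ := (realize_richS M).1 (h _ (.rich γ (hfin.toFinset.card + 1))) G
    have := Finset.card_le_card_of_injOn (s := Finset.univ) f
      (fun i _ => hfin.mem_toFinset.2 (hfG i)) hf.injOn
    simp at this
  · intro h φ hφ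
    have hM := h.isGammaSpace.isGammaGraph
    cases hφ with
    | symm => exact (realize_symmS M).2 hM.symm
    | irrefl => exact (realize_irreflS M).2 hM.irrefl
    | colour => exact (realize_colourS M).2 hM.colour
    | adjColour => exact (realize_adjColourS M).2 hM.adj_colour
    | vertex => exact (realize_vertexS M).2 h.isGammaSpace.vertex_mem_flag
    | edge => exact (realize_edgeS M).2 h.isGammaSpace.edge_mem_flag
    | notClosed u hne hu hr =>
      exact (realize_notClosedS M).2 ((simplyConnected_iff hM).1 h.simplyConnected u hne hu hr)
    | rich γ n =>
      refine (realize_richS M).2 fun G => ?_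
      have e := (h.rich γ G).natEmbedding
      exact ⟨fun i => (e i).1, fun i j hij => Fin.ext (e.injective (Subtype.ext hij)),
        fun i => (e i).2⟩

end Formulas

/-! ### Ultrapowers -/

section Ultrapower

open FirstOrder.Language Filter

/-- The ultrapower along a non-principal ultrafilter on `ℕ`. -/
abbrev Ultrapower (M : Type*) : Type _ := (hyperfilter ℕ : Filter ℕ).Product fun _ : ℕ => M

/-- The class of a sequence. -/
noncomputable abbrev ofSeq {M : Type*} (x : ℕ → M) : Ultrapower M := (x : Ultrapower M)

/-- The diagonal embedding. -/
noncomputable abbrev diag {M : Type*} (x : M) : Ultrapower M := ofSeq fun _ => x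

theorem exists_ofSeq {M : Type*} (x : Ultrapower M) : ∃ f : ℕ → M, ofSeq f = x :=
  Quotient.exists_rep x

theorem diag_injective {M : Type*} : Function.Injective (diag (M := M)) := by
  intro x y h
  have h1 : ∀ᶠ _ in (hyperfilter ℕ : Filter ℕ), x = y := Quotient.exact h
  exact eventually_const.1 h1

section
variable {L : Language} {M : Type*} [L.Structure M] [Nonempty M]

theorem realize_ofSeq {β : Type*} (φ : L.Formula β) (x : β → ℕ → M) :
    (φ.Realize fun i => ofSeq (x i)) ↔ ∀ᶠ n in (hyperfilter ℕ : Filter ℕ), φ.Realize fun i => x i n :=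
  Ultraproduct.realize_formula_cast φ x

theorem realize_diag {β : Type*} (φ : L.Formula β) (x : β → M) :
    (φ.Realize fun i => diag (x i)) ↔ φ.Realize x := by
  rw [realize_ofSeq φ fun i _ => x i]
  exact eventually_const

theorem realize_sentence_ultrapower (φ : L.Sentence) : Ultrapower M ⊨ φ ↔ M ⊨ φ := by
  rw [Ultraproduct.sentence_realize]
  exact eventually_const

end

variable {V : Type*} [Finite V] {Γ : SimpleGraph V} {M : Type*} [(lang V).Structure M]

omit [Finite V] in
theorem IsRichSimplyConnected.nonempty_flag [Nonempty M] (hM : IsRichSimplyConnected Γ M) :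
    Nonempty (Flag Γ M) := by
  obtain ⟨F, -⟩ := hM.isGammaSpace.vertex_mem_flag (Classical.arbitrary M)
  exact ⟨F⟩

theorem IsRichSimplyConnected.ultrapower [Nonempty M] (hM : IsRichSimplyConnected Γ M) :
    IsRichSimplyConnected Γ (Ultrapower M) :=
  (forall_isAxiom_iff _).1 fun φ hφ =>
    (realize_sentence_ultrapower φ).2 ((forall_isAxiom_iff M).2 hM φ hφ)

theorem exists_flag_ofSeq [Nonempty M] (f : ℕ → Flag Γ M) :
    ∃ F : Flag Γ (Ultrapower M), ∀ γ, F.vertex γ = ofSeq fun n => (f n).vertex γ := by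
  have h : (flagF Γ (id : V → V)).Realize fun γ => ofSeq fun n => (f n).vertex γ := by
    rw [realize_ofSeq (flagF Γ (id : V → V)) fun γ n => (f n).vertex γ]
    exact Eventually.of_forall fun n => realize_flagF.2 ⟨f n, rfl⟩
  obtain ⟨F, hF⟩ := realize_flagF.1 h
  exact ⟨F, fun γ => congrFun hF γ⟩

theorem exists_seq_flag [Nonempty M] (F : Flag Γ (Ultrapower M)) (F₀ : Flag Γ M) :
    ∃ f : ℕ → Flag Γ M, ∀ γ, F.vertex γ = ofSeq fun n => (f n).vertex γ := by
  choose x hx using fun γ => exists_ofSeq (F.vertex γ)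
  have h : (flagF Γ (id : V → V)).Realize fun γ => ofSeq (x γ) := realize_flagF.2
    ⟨F, funext fun γ => (hx γ).symm⟩
  rw [realize_ofSeq (flagF Γ (id : V → V)) x] at h
  have h1 : ∀ n, ∃ G : Flag Γ M, ((flagF Γ (id : V → V)).Realize fun γ => x γ n) →
      ∀ γ, G.vertex γ = x γ n := fun n => by
    by_cases hn : (flagF Γ (id : V → V)).Realize fun γ => x γ n
    · obtain ⟨G, hG⟩ := realize_flagF.1 hn
      exact ⟨G, fun _ γ => congrFun hG γ⟩
    -- Outside a set of the ultrafilter the tuple need not be a flag; `F₀` is a default there.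
    · exact ⟨F₀, fun h => absurd h hn⟩
  choose f hf using h1
  refine ⟨f, fun γ => ?_⟩
  rw [← hx γ]
  refine Quotient.sound ?_
  filter_upwards [h] with n hn
  exact (hf n hn γ).symm

omit [Finite V] in
theorem realize_flag_ofSeq [Nonempty M] {F G : Flag Γ (Ultrapower M)} {f g : ℕ → Flag Γ M}
    (hf : ∀ γ, F.vertex γ = ofSeq fun n => (f n).vertex γ)
    (hg : ∀ γ, G.vertex γ = ofSeq fun n => (g n).vertex γ) (φ : (lang V).Formula (V ⊕ V)) :
    φ.Realize (Sum.elim F.vertex G.vertex) ↔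
      ∀ᶠ n in (hyperfilter ℕ : Filter ℕ), φ.Realize (Sum.elim (f n).vertex (g n).vertex) := by
  have h1 : Sum.elim F.vertex G.vertex = fun i : V ⊕ V =>
      ofSeq (fun n => Sum.elim (f n).vertex (g n).vertex i) := by
    funext i
    cases i
    · exact hf _
    · exact hg _
  rw [h1]
  exact realize_ofSeq φ fun i n => Sum.elim (f n).vertex (g n).vertex i

/-- Every countable set of flags is far from some flag that differs from a given flag only at a
given letter. -/
def Saturated (Γ : SimpleGraph V) (M : Type*) [(lang V).Structure M] : Prop :=
  ∀ s : Set V, IsLetter Γ s → ∀ (G : Flag Γ M) (T : Set (Flag Γ M)), T.Countable →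
    ∃ F : Flag Γ M, diffColours G F ⊆ s ∧ ∀ H ∈ T, ∀ k, ¬ Chain (properSubsets s) k H F

/-- A diagonal choice: the coordinate `n` of the new flag is far, with bound `n`, from that of the
flags of `T` with index at most `n`. Any fixed flag and bound are thus dealt with at almost all
coordinates. -/
theorem IsRichSimplyConnected.saturated_ultrapower [Nonempty M] (hM : IsRichSimplyConnected Γ M) :
    Saturated Γ (Ultrapower M) := by
  intro s hs G T hT
  obtain ⟨F₀⟩ := hM.nonempty_flag
  rcases T.eq_empty_or_nonempty with rfl | hne
  · exact ⟨G, by simp [diffColours_self], by simp⟩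
  obtain ⟨H, rfl⟩ := hT.exists_eq_range hne
  obtain ⟨g, hg⟩ := exists_seq_flag G F₀
  choose h hh using fun i => exists_seq_flag (H i) F₀
  choose f hf1 hf2 using fun n => exists_far hM hs (g n) ((fun i => h i n) '' Set.Iic n)
    ((Set.finite_Iic n).image _) n
  obtain ⟨F, hF⟩ := exists_flag_ofSeq f
  refine ⟨F, realize_agreeF.1 ((realize_flag_ofSeq hg hF _).2
    (Eventually.of_forall fun n => realize_agreeF.2 (hf1 n))), ?_⟩
  rintro _ ⟨i, rfl⟩ k hc
  have h1 := (realize_flag_ofSeq (hh i) hF _).1 (realize_chainF.2 hc)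
  have h2 : ∀ᶠ n in (hyperfilter ℕ : Filter ℕ), max i k ≤ n := by
    refine hyperfilter_le_cofinite ?_
    rw [Nat.cofinite_eq_atTop]
    exact eventually_ge_atTop _
  obtain ⟨n, h3, h4⟩ := (h1.and h2).exists
  exact hf2 n _ ⟨i, (le_max_left _ _).trans h4, rfl⟩
    (Chain.mono hs.properSubsets_nonempty ((le_max_right _ _).trans h4) (realize_chainF.1 h3))

/-- The image of a flag in the ultrapower. -/
theorem exists_flag_diag [Nonempty M] (F : Flag Γ M) :
    ∃ F' : Flag Γ (Ultrapower M), ∀ γ, F'.vertex γ = diag (F.vertex γ) :=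
  exists_flag_ofSeq fun _ => F

/-- A flag step is an infinite conjunction of negated formulas `chainF` with `agreeF s`, and the
diagonal embedding preserves each of them. -/
theorem flagStep_diag_iff [Nonempty M] (hM : IsRichSimplyConnected Γ M) {s : Set V} {F G : Flag Γ M}
    {F' G' : Flag Γ (Ultrapower M)} (hF : ∀ γ, F'.vertex γ = diag (F.vertex γ))
    (hG : ∀ γ, G'.vertex γ = diag (G.vertex γ)) : FlagStep s F' G' ↔ FlagStep s F G := by
  have key : ∀ φ : (lang V).Formula (V ⊕ V), φ.Realize (Sum.elim F'.vertex G'.vertex) ↔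
      φ.Realize (Sum.elim F.vertex G.vertex) := fun φ => by
    rw [realize_flag_ofSeq (f := fun _ => F) (g := fun _ => G) hF hG]
    exact eventually_const
  rw [flagStep_iff hM.isGammaSpace.isGammaGraph, flagStep_iff hM.ultrapower.isGammaSpace.isGammaGraph,
    ← realize_agreeF, key, realize_agreeF]
  simp only [← realize_chainF, key]

end Ultrapower

/-! ### Back and forth -/

section BackAndForth

open FirstOrder.Language

variable {V : Type*} {M N : Type*} [(lang V).Structure M] [(lang V).Structure N]

omit [(lang V).Structure N] in
theorem relMap_adj (x : Fin 2 → M) :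
    Structure.RelMap (L := lang V) (GraphRel.adj : GraphRel V 2) x ↔ Adj V (x 0) (x 1) :=
  iff_of_eq (congrArg _ (funext fun i => match i with | 0 => rfl | 1 => rfl))

omit [(lang V).Structure N] in
theorem relMap_colour {γ : V} (x : Fin 1 → M) :
    Structure.RelMap (L := lang V) (GraphRel.colour γ : GraphRel V 1) x ↔ HasColour γ (x 0) :=
  iff_of_eq (congrArg _ (funext fun i => match i with | 0 => rfl))

/-- Relations with the back-and-forth property preserve all formulas. -/
theorem realize_iff_of_backAndForth (𝒮 : (M → N → Prop) → Prop)
    (heq : ∀ R, 𝒮 R → ∀ x y x' y', R x x' → R y y' → (x = y ↔ x' = y'))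
    (hadj : ∀ R, 𝒮 R → ∀ x y x' y', R x x' → R y y' → (Adj V x y ↔ Adj V x' y'))
    (hcol : ∀ R, 𝒮 R → ∀ x x' (γ : V), R x x' → (HasColour γ x ↔ HasColour γ x'))
    (forth : ∀ R, 𝒮 R → ∀ x, ∃ R', 𝒮 R' ∧ (∀ x y, R x y → R' x y) ∧ ∃ y, R' x y)
    (back : ∀ R, 𝒮 R → ∀ y, ∃ R', 𝒮 R' ∧ (∀ x y, R x y → R' x y) ∧ ∃ x, R' x y)
    {α : Type*} {n : ℕ} (φ : (lang V).BoundedFormula α n) : ∀ (R : M → N → Prop), 𝒮 R →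
      ∀ (v : α → M) (v' : α → N) (xs : Fin n → M) (xs' : Fin n → N), (∀ i, R (v i) (v' i)) →
      (∀ i, R (xs i) (xs' i)) → (φ.Realize v xs ↔ φ.Realize v' xs') := by
  have hterm : ∀ {n : ℕ} (t : (lang V).Term (α ⊕ Fin n)) (R : M → N → Prop) (v : α → M)
      (v' : α → N) (xs : Fin n → M) (xs' : Fin n → N), (∀ i, R (v i) (v' i)) →
      (∀ i, R (xs i) (xs' i)) → R (t.realize (Sum.elim v xs)) (t.realize (Sum.elim v' xs')) := by
    intro n t R v v' xs xs' h1 h2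
    cases t with
    | var i => rcases i with i | i; exacts [h1 i, h2 i]
    | func f => exact nomatch f
  induction φ with
  | falsum => exact fun _ _ _ _ _ _ _ _ => Iff.rfl
  | equal t₁ t₂ =>
    intro R hR v v' xs xs' h1 h2
    exact heq R hR _ _ _ _ (hterm t₁ R v v' xs xs' h1 h2) (hterm t₂ R v v' xs xs' h1 h2)
  | rel r ts =>
    intro R hR v v' xs xs' h1 h2
    have h3 := fun i => hterm (ts i) R v v' xs xs' h1 h2
    cases r with
    | adj =>
      have h4 := hadj R hR _ _ _ _ (h3 0) (h3 1)
      exact (relMap_adj fun i => (ts i).realize (Sum.elim v xs)).trans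
        (h4.trans (relMap_adj fun i => (ts i).realize (Sum.elim v' xs')).symm)
    | colour γ =>
      have h4 := hcol R hR _ _ γ (h3 0)
      exact (relMap_colour fun i => (ts i).realize (Sum.elim v xs)).trans
        (h4.trans (relMap_colour fun i => (ts i).realize (Sum.elim v' xs')).symm)
  | imp φ ψ ih₁ ih₂ =>
    intro R hR v v' xs xs' h1 h2
    rw [BoundedFormula.realize_imp, BoundedFormula.realize_imp, ih₁ R hR v v' xs xs' h1 h2,
      ih₂ R hR v v' xs xs' h1 h2]
  | all φ ih =>
    intro R hR v v' xs xs' h1 h2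
    rw [BoundedFormula.realize_all, BoundedFormula.realize_all]
    have hsnoc : ∀ R' : M → N → Prop, (∀ x y, R x y → R' x y) → ∀ x y, R' x y →
        ∀ i, R' (Fin.snoc (α := fun _ => M) xs x i) (Fin.snoc (α := fun _ => N) xs' y i) := by
      intro R' hRR' x y hxy i
      refine Fin.lastCases ?_ (fun i => ?_) i
      · simpa using hxy
      · simpa using hRR' _ _ (h2 i)
    constructor
    · intro h y
      obtain ⟨R', hR', hRR', x, hxy⟩ := back R hR y
      exact (ih R' hR' v v' _ _ (fun i => hRR' _ _ (h1 i)) (hsnoc R' hRR' x y hxy)).1 (h x)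
    · intro h x
      obtain ⟨R', hR', hRR', y, hxy⟩ := forth R hR x
      exact (ih R' hR' v v' _ _ (fun i => hRR' _ _ (h1 i)) (hsnoc R' hRR' x y hxy)).2 (h y)

variable [Finite V] {Γ : SimpleGraph V}

/-- The pairs of a relation. -/
abbrev graphOf (R : M → N → Prop) : Set (M × N) := {z | R z.1 z.2}

theorem countable_isPair {R : M → N → Prop} (h : (graphOf R).Countable) :
    {p : Flag Γ M × Flag Γ N | IsPair R p}.Countable := by
  have : Countable (graphOf R) := h.to_subtype
  refine Set.MapsTo.countable_of_injOn (f := fun p : Flag Γ M × Flag Γ N => fun γ =>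
    (p.1.vertex γ, p.2.vertex γ)) (t := {f | ∀ γ, f γ ∈ graphOf R}) (fun p hp γ => hp γ) ?_ ?_
  · intro p _ q _ h
    refine Prod.ext (Flag.ext (funext fun γ => ?_)) (Flag.ext (funext fun γ => ?_))
    · exact congrArg Prod.fst (congrFun h γ)
    · exact congrArg Prod.snd (congrFun h γ)
  · have : Set.range (fun (f : V → graphOf R) γ => (f γ).1) = {f | ∀ γ, f γ ∈ graphOf R} := by
      ext f
      exact ⟨by rintro ⟨f, rfl⟩ γ; exact (f γ).2, fun hf => ⟨fun γ => ⟨f γ, hf γ⟩, rfl⟩⟩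
    rw [← this]
    exact Set.countable_range _

omit [Finite V] [(lang V).Structure M] [(lang V).Structure N] in
theorem graphOf_extendRel {Γ : SimpleGraph V} [(lang V).Structure M] [(lang V).Structure N]
    (R : M → N → Prop) (s : Set V) (p : Flag Γ M × Flag Γ N) :
    graphOf (extendRel R s p) = graphOf R ∪ (fun γ => (p.1.vertex γ, p.2.vertex γ)) '' s := by
  ext ⟨x, y⟩
  simp only [extendRel, graphOf, Set.mem_ofPred_eq, Set.mem_union, Set.mem_image, Prod.mk.injEq]
  refine or_congr Iff.rfl (exists_congr fun γ => and_congr Iff.rfl ?_)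
  rw [eq_comm, @eq_comm _ y]

theorem Saturated.exists_free (hN : IsRichSimplyConnected Γ N) (hs : Saturated Γ N)
    {T : Set (Flag Γ N)} (hT : T.Countable) {s : Set V} (hl : IsLetter Γ s) (G : Flag Γ N) :
    ∃ F, ∀ H ∈ T, diffColours H G ⊆ s → FlagStep s H F := by
  obtain ⟨F, h1, h2⟩ := hs s hl G T hT
  refine ⟨F, fun H hH hd => ?_⟩
  rw [flagStep_iff hN.isGammaSpace.isGammaGraph]
  exact ⟨hl, diffColours_trans hd h1, h2 H hH⟩

theorem NiceIso.forth_saturated (hM : IsRichSimplyConnected Γ M) (hN : IsRichSimplyConnected Γ N)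
    (hs : Saturated Γ N) {R : M → N → Prop} (hR : NiceIso Γ R) (hc : (graphOf R).Countable)
    (hne : ∃ p : Flag Γ M × Flag Γ N, IsPair R p) (x : M) :
    ∃ R', NiceIso Γ R' ∧ (graphOf R').Countable ∧ (∀ x y, R x y → R' x y) ∧ ∃ y, R' x y := by
  obtain ⟨F, γ, rfl⟩ := hM.isGammaSpace.vertex_mem_flag x
  obtain ⟨R', h1, h2, h3, F', h4⟩ := NiceIso.forth hM hN (𝒞 := fun R => (graphOf R).Countable)
    (fun R _ hc s g F hg hF => by
      obtain ⟨F', hF'⟩ := hs.exists_free hN ((countable_isPair (Γ := Γ) hc).image Prod.snd)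
        (s := s) (hF hg (by simp [diffColours_self])).1.1 g.2
      refine ⟨F', fun {h} hh hd => hF' h.2 ⟨h, hh, rfl⟩ hd, ?_⟩
      rw [graphOf_extendRel]
      exact hc.union (Set.toFinite _).countable) F hR hc hne
  exact ⟨R', h1, h2, h3, _, h4 γ⟩

omit [Finite V] in
theorem graphOf_flip {M N : Type*} {R : M → N → Prop} (h : (graphOf R).Countable) :
    (graphOf (flip R)).Countable := by
  have : graphOf (flip R) = Prod.swap '' graphOf R := by
    ext ⟨x, y⟩
    simp [graphOf, flip]
  rw [this]
  exact h.image _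

omit [Finite V] in
theorem NiceIso.hasColour_iff (hM : IsGammaGraph Γ M) (hN : IsGammaGraph Γ N) {R : M → N → Prop}
    (hR : NiceIso Γ R) {x : M} {x' : N} (hx : R x x') (γ : V) :
    HasColour γ x ↔ HasColour γ x' := by
  obtain ⟨p, δ, -, rfl, rfl⟩ := hR.cover hx
  refine ⟨fun h => ?_, fun h => ?_⟩
  · obtain rfl := (hM.colour _).unique h (p.1.hasColour δ)
    exact p.2.hasColour _
  · obtain rfl := (hN.colour _).unique h (p.2.hasColour δ)
    exact p.1.hasColour _

theorem NiceIso.realize_iff_of_saturated (hM : IsRichSimplyConnected Γ M)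
    (hN : IsRichSimplyConnected Γ N) (hsM : Saturated Γ M) (hsN : Saturated Γ N)
    {R : M → N → Prop} (hR : NiceIso Γ R) (hc : (graphOf R).Countable)
    (hne : ∃ p : Flag Γ M × Flag Γ N, IsPair R p) {α : Type*} (φ : (lang V).Formula α)
    {v : α → M} {v' : α → N} (hv : ∀ i, R (v i) (v' i)) : φ.Realize v ↔ φ.Realize v' := by
  refine realize_iff_of_backAndForth (𝒮 := fun R : M → N → Prop => NiceIso Γ R ∧
    (graphOf R).Countable ∧ ∃ p : Flag Γ M × Flag Γ N, IsPair R p) ?_ ?_ ?_ ?_ ?_ φ R ⟨hR, hc, hne⟩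
    v v' default default hv (fun i => i.elim0)
  · rintro R ⟨hR, -⟩ x y x' y' hx hy
    refine ⟨?_, ?_⟩
    · rintro rfl; exact hR.func hx hy
    · rintro rfl; exact hR.inj hx hy
  · rintro R ⟨hR, -⟩ x y x' y' hx hy
    exact ⟨hR.adj hM hN hx hy, hR.flip.adj hN hM hx hy⟩
  · rintro R ⟨hR, -⟩ x x' γ hx
    exact hR.hasColour_iff hM.isGammaSpace.isGammaGraph hN.isGammaSpace.isGammaGraph hx γ
  · rintro R ⟨hR, hc, p, hp⟩ x
    obtain ⟨R', h1, h2, h3, h4⟩ := hR.forth_saturated hM hN hsN hc ⟨p, hp⟩ x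
    exact ⟨R', ⟨h1, h2, p, fun γ => h3 _ _ (hp γ)⟩, h3, h4⟩
  · rintro R ⟨hR, hc, p, hp⟩ y
    obtain ⟨R', h1, h2, h3, h4⟩ := hR.flip.forth_saturated hN hM hsM (graphOf_flip hc)
      ⟨p.swap, hp⟩ y
    exact ⟨fun x y => R' y x, ⟨h1.flip, graphOf_flip h2, p, fun γ => h3 _ _ (hp γ)⟩,
      fun x y h => h3 y x h, h4⟩

/-- The relation on the ultrapowers induced by a relation. -/
def diagRel (R : M → N → Prop) (x : Ultrapower M) (y : Ultrapower N) : Prop :=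
  ∃ a b, R a b ∧ diag a = x ∧ diag b = y

omit [(lang V).Structure N] in
theorem exists_flag_of_diag [Nonempty M] (F : Flag Γ (Ultrapower M)) (x : V → M)
    (hx : ∀ γ, diag (x γ) = F.vertex γ) : ∃ G : Flag Γ M, G.vertex = x := by
  have h : (flagF Γ (id : V → V)).Realize fun γ => diag (x γ) :=
    realize_flagF.2 ⟨F, funext fun γ => (hx γ).symm⟩
  rw [realize_diag] at h
  exact realize_flagF.1 h

theorem exists_pair_of_diagRel [Nonempty M] [Nonempty N] {R : M → N → Prop}
    {p : Flag Γ (Ultrapower M) × Flag Γ (Ultrapower N)} (hp : IsPair (diagRel R) p) :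
    ∃ q : Flag Γ M × Flag Γ N, IsPair R q ∧ (∀ γ, p.1.vertex γ = diag (q.1.vertex γ)) ∧
      ∀ γ, p.2.vertex γ = diag (q.2.vertex γ) := by
  choose x y h1 h2 h3 using hp
  obtain ⟨F, rfl⟩ := exists_flag_of_diag p.1 x h2
  obtain ⟨G, rfl⟩ := exists_flag_of_diag p.2 y h3
  exact ⟨(F, G), h1, fun γ => (h2 γ).symm, fun γ => (h3 γ).symm⟩

theorem NiceIso.diagRel [Nonempty M] [Nonempty N] (hM : IsRichSimplyConnected Γ M)
    (hN : IsRichSimplyConnected Γ N) {R : M → N → Prop} (hR : NiceIso Γ R) :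
    NiceIso Γ (diagRel R) where
  func := by
    rintro x _ _ ⟨a, b, h1, rfl, rfl⟩ ⟨a', b', h2, h3, rfl⟩
    obtain rfl := diag_injective h3
    rw [hR.func h1 h2]
  inj := by
    rintro _ _ y ⟨a, b, h1, rfl, rfl⟩ ⟨a', b', h2, rfl, h3⟩
    obtain rfl := diag_injective h3
    rw [hR.inj h1 h2]
  cover := by
    rintro _ _ ⟨a, b, h1, rfl, rfl⟩
    obtain ⟨p, γ, h2, rfl, rfl⟩ := hR.cover h1
    obtain ⟨F, hF⟩ := exists_flag_diag p.1
    obtain ⟨G, hG⟩ := exists_flag_diag p.2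
    exact ⟨(F, G), γ, fun γ => ⟨_, _, h2 γ, (hF γ).symm, (hG γ).symm⟩, hF γ, hG γ⟩
  conn := by
    intro p q hp hq
    obtain ⟨p', hp', h1, h2⟩ := exists_pair_of_diagRel hp
    obtain ⟨q', hq', h3, h4⟩ := exists_pair_of_diagRel hq
    obtain ⟨u, hu, hpath⟩ := hR.conn hp' hq'
    refine ⟨u, hu, ?_⟩
    clear hp hp' hu
    induction u generalizing p p' with
    | nil =>
      obtain rfl : p' = q' := hpath
      refine Prod.ext (Flag.ext (funext fun γ => ?_)) (Flag.ext (funext fun γ => ?_))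
      · rw [h1, h3]
      · rw [h2, h4]
    | cons a u ih =>
      obtain ⟨r', h5, h6⟩ := hpath
      obtain ⟨F, hF⟩ := exists_flag_diag r'.1
      obtain ⟨G, hG⟩ := exists_flag_diag r'.2
      exact ⟨(F, G), ⟨(flagStep_diag_iff hM h1 hF).2 h5.1, (flagStep_diag_iff hN h2 hG).2 h5.2.1,
        fun γ => ⟨_, _, h5.2.2.1 γ, (h1 γ).symm, (h2 γ).symm⟩,
        fun γ => ⟨_, _, h5.2.2.2 γ, (hF γ).symm, (hG γ).symm⟩⟩, ih r' hF hG h6⟩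

/-- Countable nice partial isomorphisms preserve all formulas. -/
theorem NiceIso.realize_iff [Nonempty M] [Nonempty N] (hM : IsRichSimplyConnected Γ M)
    (hN : IsRichSimplyConnected Γ N) {R : M → N → Prop} (hR : NiceIso Γ R)
    (hc : (graphOf R).Countable) (hne : ∃ p : Flag Γ M × Flag Γ N, IsPair R p) {α : Type*}
    (φ : (lang V).Formula α) {v : α → M} {v' : α → N} (hv : ∀ i, R (v i) (v' i)) :
    φ.Realize v ↔ φ.Realize v' := by
  -- The spaces themselves need not be saturated; the comparison takes place in their ultrapowers.
  rw [← realize_diag φ v, ← realize_diag φ v']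
  refine NiceIso.realize_iff_of_saturated hM.ultrapower hN.ultrapower hM.saturated_ultrapower
    hN.saturated_ultrapower (NiceIso.diagRel hM hN hR) ?_ ?_ φ fun i => ⟨_, _, hv i, rfl, rfl⟩
  · have : graphOf (RABuilding.diagRel R) = (fun z => (diag z.1, diag z.2)) '' graphOf R := by
      ext ⟨x, y⟩
      simp [graphOf, RABuilding.diagRel]
    rw [this]
    exact hc.image _
  · obtain ⟨p, hp⟩ := hne
    obtain ⟨F, hF⟩ := exists_flag_diag p.1
    obtain ⟨G, hG⟩ := exists_flag_diag p.2
    exact ⟨(F, G), fun γ => ⟨_, _, hp γ, (hF γ).symm, (hG γ).symm⟩⟩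

end BackAndForth

/-! ### The models of the theory -/

section Models

open FirstOrder.Language

section
variable {V : Type*} {Γ : SimpleGraph V} {M N : Type*} [(lang V).Structure M] [(lang V).Structure N]

/-- The relation between corresponding vertices of two flags. -/
def flagRel (F : Flag Γ M) (F' : Flag Γ N) (x : M) (y : N) : Prop :=
  ∃ γ, F.vertex γ = x ∧ F'.vertex γ = y

theorem isPair_flagRel (F : Flag Γ M) (F' : Flag Γ N) : IsPair (flagRel F F') (F, F') :=
  fun γ => ⟨γ, rfl, rfl⟩

theorem graphOf_flagRel (F : Flag Γ M) (F' : Flag Γ N) :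
    graphOf (flagRel F F') = Set.range fun γ => (F.vertex γ, F'.vertex γ) := by
  ext ⟨x, y⟩
  simp [graphOf, flagRel]

variable [Finite V]

theorem finite_graphOf_flagRel (F : Flag Γ M) (F' : Flag Γ N) : (graphOf (flagRel F F')).Finite := by
  rw [graphOf_flagRel]
  exact Set.finite_range _

-- Colours tell the vertices of a flag apart, so `(F, F')` is the only related pair. This starts
-- every back-and-forth construction between two spaces.
omit [Finite V] in
theorem niceIso_flagRel (hM : IsGammaGraph Γ M) (hN : IsGammaGraph Γ N) (F : Flag Γ M)
    (F' : Flag Γ N) : NiceIso Γ (flagRel F F') where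
  func := by
    rintro _ _ _ ⟨γ, rfl, rfl⟩ ⟨δ, h, rfl⟩
    rw [colour_unique hM h]
  inj := by
    rintro _ _ _ ⟨γ, rfl, rfl⟩ ⟨δ, rfl, h⟩
    rw [colour_unique hN h]
  cover := by
    rintro _ _ ⟨γ, rfl, rfl⟩
    exact ⟨(F, F'), γ, isPair_flagRel F F', rfl, rfl⟩
  conn := by
    have key : ∀ {p : Flag Γ M × Flag Γ N}, IsPair (flagRel F F') p → p = (F, F') := by
      intro p hp
      refine Prod.ext (Flag.ext (funext fun γ => ?_)) (Flag.ext (funext fun γ => ?_)) <;>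
        obtain ⟨δ, h1, h2⟩ := hp γ
      · rw [colour_unique hM h1] at h1; exact h1.symm
      · rw [colour_unique hN h2] at h2; exact h2.symm
    intro p q hp hq
    obtain rfl := key hp
    obtain rfl := key hq
    exact ⟨[], fun x a y b z h => by simp at h, rfl⟩

theorem IsRichSimplyConnected.realize_sentence_iff [Nonempty M] [Nonempty N]
    (hM : IsRichSimplyConnected Γ M) (hN : IsRichSimplyConnected Γ N) (φ : (lang V).Sentence) :
    M ⊨ φ ↔ N ⊨ φ := by
  obtain ⟨F⟩ := hM.nonempty_flag
  obtain ⟨F'⟩ := hN.nonempty_flag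
  exact NiceIso.realize_iff hM hN
    (niceIso_flagRel hM.isGammaSpace.isGammaGraph hN.isGammaSpace.isGammaGraph F F')
    (finite_graphOf_flagRel F F').countable ⟨_, isPair_flagRel F F'⟩ φ fun i => i.elim

end

variable {V : Type u} [Finite V] [Nonempty V] {Γ : SimpleGraph V}

/-- The definition of `PS` quantifies over one universe only. The rich building supplies a space in
it, and rich simply connected spaces in all universes satisfy the same sentences. -/
theorem mem_PS_iff {M : Type*} [Nonempty M] [(lang V).Structure M]
    (hM : IsRichSimplyConnected Γ M) {φ : (lang V).Sentence} : φ ∈ PS Γ ↔ M ⊨ φ := by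
  have hC := isCountableRichBuilding_richRel (Γ := Γ)
  have := hC.nonempty_colouredGraph
  refine ⟨fun h => ?_, fun h => ?_⟩
  · exact (hC.isRichSimplyConnected.realize_sentence_iff hM φ).1 (h _ hC.isRichSimplyConnected)
  · intro N _ _ hN
    exact (hM.realize_sentence_iff hN φ).1 h

variable (Γ) in
theorem models_PS_iff (M : Type*) [Nonempty M] [(lang V).Structure M] :
    M ⊨ PS Γ ↔ IsRichSimplyConnected Γ M := by
  refine ⟨fun h => ?_, fun h => ⟨fun φ hφ => (mem_PS_iff h).1 hφ⟩⟩
  refine (forall_isAxiom_iff M).1 fun φ hφ => h.realize_of_mem φ ?_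
  exact fun N _ _ hN => (forall_isAxiom_iff N).2 hN φ hφ

variable (Γ) in
theorem isComplete_PS : (PS Γ).IsComplete := by
  have hC := isCountableRichBuilding_richRel (Γ := Γ)
  have := hC.nonempty_colouredGraph
  have hm : ColouredGraph Γ (richRel Γ) ⊨ PS Γ := (models_PS_iff Γ _).2 hC.isRichSimplyConnected
  refine ⟨Theory.Model.isSatisfiable (ColouredGraph Γ (richRel Γ)), fun φ => ?_⟩
  by_cases h : ColouredGraph Γ (richRel Γ) ⊨ φ
  · exact Or.inl (Theory.models_sentence_of_mem ((mem_PS_iff hC.isRichSimplyConnected).2 h))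
  · exact Or.inr (Theory.models_sentence_of_mem ((mem_PS_iff hC.isRichSimplyConnected).2
      ((Sentence.realize_not _).2 h)))

end Models

/-! ### Unions of nice partial isomorphisms -/

section Union

variable {V : Type*} [Finite V] {Γ : SimpleGraph V} {M N : Type*} [(lang V).Structure M]
  [(lang V).Structure N]

/-- A pair of flags involves finitely many vertices and so is related at some stage. -/
theorem NiceIso.iUnion {R : ℕ → M → N → Prop} (hR : ∀ n, NiceIso Γ (R n))
    (hmono : ∀ m n, m ≤ n → ∀ x y, R m x y → R n x y) :
    NiceIso Γ fun x y => ∃ n, R n x y := by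
  have hpair : ∀ {p : Flag Γ M × Flag Γ N}, IsPair (fun x y => ∃ n, R n x y) p →
      ∃ n, IsPair (R n) p := by
    intro p hp
    choose n hn using hp
    obtain ⟨k, hk⟩ := (Set.finite_range n).bddAbove
    exact ⟨k, fun γ => hmono _ _ (hk ⟨γ, rfl⟩) _ _ (hn γ)⟩
  constructor
  · rintro x y y' ⟨m, hm⟩ ⟨n, hn⟩
    exact (hR (max m n)).func (hmono _ _ (le_max_left _ _) _ _ hm)
      (hmono _ _ (le_max_right _ _) _ _ hn)
  · rintro x y y' ⟨m, hm⟩ ⟨n, hn⟩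
    exact (hR (max m n)).inj (hmono _ _ (le_max_left _ _) _ _ hm)
      (hmono _ _ (le_max_right _ _) _ _ hn)
  · rintro x y ⟨n, hn⟩
    obtain ⟨p, γ, h1, h2⟩ := (hR n).cover hn
    exact ⟨p, γ, fun γ => ⟨n, h1 γ⟩, h2⟩
  · intro p q hp hq
    obtain ⟨m, hm⟩ := hpair hp
    obtain ⟨n, hn⟩ := hpair hq
    obtain ⟨u, h1, h2⟩ := (hR (max m n)).conn (p := p) (q := q)
      (fun γ => hmono _ _ (le_max_left _ _) _ _ (hm γ))
      (fun γ => hmono _ _ (le_max_right _ _) _ _ (hn γ))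
    exact ⟨u, h1, h2.mono fun _ _ _ => PairStep.mono fun _ _ h => ⟨_, h⟩⟩

/-- Countably many extension tasks can be carried out one after another. -/
theorem NiceIso.exists_union {𝒮 : (M → N → Prop) → Prop} (h𝒮 : ∀ R, 𝒮 R → NiceIso Γ R)
    {R : M → N → Prop} (hR : 𝒮 R) {ι : Type*} [Countable ι] (P : ι → (M → N → Prop) → Prop)
    (hP : ∀ i R R', (∀ x y, R x y → R' x y) → P i R → P i R')
    (hext : ∀ R i, 𝒮 R → ∃ R', 𝒮 R' ∧ (∀ x y, R x y → R' x y) ∧ P i R') :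
    ∃ S : ℕ → M → N → Prop, (∀ n, 𝒮 (S n)) ∧ NiceIso Γ (fun x y => ∃ n, S n x y) ∧
      (∀ x y, R x y → ∃ n, S n x y) ∧ ∀ i, P i fun x y => ∃ n, S n x y := by
  cases isEmpty_or_nonempty ι with
  | inl h =>
    exact ⟨fun _ => R, fun _ => hR, NiceIso.iUnion (fun _ => h𝒮 R hR) fun _ _ _ _ _ => id,
      fun x y h => ⟨0, h⟩, isEmptyElim⟩
  | inr h =>
    obtain ⟨f, hf⟩ := exists_surjective_nat ι
    choose E h1 h2 h3 using fun (R : {R // 𝒮 R}) i => hext R.1 i R.2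
    let S : ℕ → {R // 𝒮 R} := fun n => Nat.rec ⟨R, hR⟩ (fun k R => ⟨E R (f k), h1 R (f k)⟩) n
    have hmono : ∀ m n, m ≤ n → ∀ x y, (S m).1 x y → (S n).1 x y := by
      intro m n hmn x y hxy
      induction n, hmn using Nat.le_induction with
      | base => exact hxy
      | succ n _ ih => exact h2 (S n) (f n) x y ih
    refine ⟨fun n => (S n).1, fun n => (S n).2, NiceIso.iUnion (fun n => h𝒮 _ (S n).2) hmono,
      fun x y h => ⟨0, h⟩, fun i => ?_⟩
    obtain ⟨n, rfl⟩ := hf i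
    exact hP _ _ _ (fun x y h => ⟨n + 1, h⟩) (h3 (S n) (f n))

end Union

/-! ### Spaces in which flags are joined by steps in single colours -/

section Singles

variable {V : Type*} [Finite V] {Γ : SimpleGraph V} {M N : Type*} [(lang V).Structure M]
  [(lang V).Structure N]

theorem Chain.exists_path_singletons (hM : IsRichSimplyConnected Γ M) {n : ℕ} {F G : Flag Γ M}
    (h : Chain {t | ∃ γ, t = {γ}} n F G) :
    ∃ v : List (Letter Γ), (∀ a ∈ v, ∃ γ, a.1 ⊆ {γ}) ∧ HasPath LetterStep v F G := by
  induction n generalizing F with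
  | zero => exact ⟨[], by simp, h⟩
  | succ n ih =>
    obtain ⟨H, ⟨_, ⟨γ, rfl⟩, h1⟩, h2⟩ := h
    obtain ⟨v, hv, hp⟩ := ih h2
    obtain ⟨w, hw, hq⟩ := exists_path_of_diffColours hM.isGammaSpace.isGammaGraph _ _ _ h1
    refine ⟨w ++ v, fun a ha => ?_, hasPath_append.2 ⟨H, hq, hp⟩⟩
    rcases List.mem_append.1 ha with ha | ha
    · exact ⟨γ, hw a ha⟩
    · exact hv a ha

/-- A path with one letter is reduced, so its letter is contained in some letter of any other path
with the same end points. -/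
theorem SinglesConnected.exists_eq_singleton (hM : IsRichSimplyConnected Γ M)
    (hs : SinglesConnected Γ M) {s : Set V} {F G : Flag Γ M} (h : FlagStep s F G) :
    ∃ γ, s = {γ} := by
  obtain ⟨n, hn⟩ := hs F G
  obtain ⟨v, hv, hp⟩ := hn.exists_path_singletons hM
  have h1 : HasPath LetterStep [(⟨s, h.1.1⟩ : Letter Γ)] F G := ⟨G, h, rfl⟩
  have h2 := forall_of_path hM.isGammaSpace.isGammaGraph hM.simplyConnected
    (P := fun a : Letter Γ => ∃ γ, a.1 ⊆ {γ}) (fun a b hab ⟨γ, hb⟩ => ⟨γ, Set.Subset.trans hab hb⟩)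
    (u := [⟨s, h.1.1⟩]) (by
      intro x a y b z he
      have := congrArg List.length he
      simp at this
      omega) h1 hp hv
  obtain ⟨γ, hγ⟩ := h2 _ (List.mem_singleton_self _)
  exact ⟨γ, (Set.Nonempty.subset_singleton_iff h.1.1.nonempty).1 hγ⟩

/-- A step at a single colour is free as soon as it avoids the finitely many flags of the range, so
the richness of `N` replaces saturation. -/
theorem NiceIso.forth_singles (hM : IsRichSimplyConnected Γ M) (hN : IsRichSimplyConnected Γ N)
    (hs : SinglesConnected Γ M) {R : M → N → Prop} (hR : NiceIso Γ R) (hc : (graphOf R).Finite)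
    (hne : ∃ p : Flag Γ M × Flag Γ N, IsPair R p) (x : M) :
    ∃ R', (NiceIso Γ R' ∧ (graphOf R').Finite ∧ ∃ p : Flag Γ M × Flag Γ N, IsPair R' p) ∧
      (∀ x y, R x y → R' x y) ∧ ∃ y, R' x y := by
  obtain ⟨F, γ, rfl⟩ := hM.isGammaSpace.vertex_mem_flag x
  obtain ⟨R', h1, h2, h3, F', h4⟩ := NiceIso.forth hM hN (𝒞 := fun R => (graphOf R).Finite)
    (fun R _ hc s g F hg hF => by
      obtain ⟨δ, rfl⟩ := hs.exists_eq_singleton hM (hF hg (by simp [diffColours_self]))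
      have hfin : {H : Flag Γ N | ∃ h : Flag Γ M × Flag Γ N, IsPair R h ∧ h.2 = H}.Finite := by
        have : ∀ H : Flag Γ N, (∃ h : Flag Γ M × Flag Γ N, IsPair R h ∧ h.2 = H) →
            ∀ γ, H.vertex γ ∈ Prod.snd '' graphOf R := by
          rintro _ ⟨h, hh, rfl⟩ γ
          exact ⟨(h.1.vertex γ, h.2.vertex γ), hh γ, rfl⟩
        refine Set.Finite.of_finite_image (f := Flag.vertex) (Set.Finite.subset
          (Set.Finite.pi fun _ : V => hc.image Prod.snd) ?_) fun H _ H' _ h => Flag.ext h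
        rintro _ ⟨H, hH, rfl⟩ γ -
        exact this H hH γ
      obtain ⟨F', hF1, hF2⟩ := ((hN.rich δ g.2).sdiff hfin).nonempty
      refine ⟨F', fun {h} hh hd => (flagStep_singleton_iff hN.isGammaSpace.isGammaGraph).2 ⟨?_, ?_⟩, ?_⟩
      · rintro rfl
        exact hF2 ⟨h, hh, rfl⟩
      · exact diffColours_trans hd (by rw [diffColours_comm]; exact hF1)
      · rw [graphOf_extendRel]
        exact hc.union (Set.toFinite _)) F hR hc hne
  exact ⟨R', ⟨h1, h2, _, h4⟩, h3, _, h4 γ⟩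

end Singles

/-! ### Prime models -/

section Prime

open FirstOrder.Language

variable {V : Type*} [Finite V] {Γ : SimpleGraph V} {M N : Type*} [(lang V).Structure M]
  [(lang V).Structure N]

/-- Partial isomorphisms whose domain is the union of finitely many flags. -/
structure FiniteNice (Γ : SimpleGraph V) (R : M → N → Prop) : Prop where
  niceIso : NiceIso Γ R
  finite : (graphOf R).Finite
  exists_isPair : ∃ p : Flag Γ M × Flag Γ N, IsPair R p

omit [Finite V] in
theorem FiniteNice.flip {R : M → N → Prop} (h : FiniteNice Γ R) : FiniteNice Γ (flip R) := by
  obtain ⟨h1, h2, p, hp⟩ := h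
  refine ⟨h1.flip, ?_, p.swap, hp⟩
  have : graphOf (_root_.flip R) = Prod.swap '' graphOf R := by
    ext ⟨x, y⟩
    simp [graphOf, _root_.flip]
  rw [this]
  exact h2.image _

theorem FiniteNice.forth (hM : IsRichSimplyConnected Γ M) (hN : IsRichSimplyConnected Γ N)
    (hs : SinglesConnected Γ M) {R : M → N → Prop} (h : FiniteNice Γ R) (x : M) :
    ∃ R', FiniteNice Γ R' ∧ (∀ x y, R x y → R' x y) ∧ ∃ y, R' x y := by
  obtain ⟨R', ⟨h1, h2, h3⟩, h4⟩ := h.niceIso.forth_singles hM hN hs h.finite h.exists_isPair x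
  exact ⟨R', ⟨h1, h2, h3⟩, h4⟩

theorem exists_finiteNice [Nonempty M] [Nonempty N] (hM : IsRichSimplyConnected Γ M)
    (hN : IsRichSimplyConnected Γ N) : ∃ R : M → N → Prop, FiniteNice Γ R := by
  obtain ⟨F⟩ := hM.nonempty_flag
  obtain ⟨F'⟩ := hN.nonempty_flag
  exact ⟨flagRel F F', niceIso_flagRel hM.isGammaSpace.isGammaGraph hN.isGammaSpace.isGammaGraph
    F F', finite_graphOf_flagRel F F', _, isPair_flagRel F F'⟩

theorem exists_elementaryEmbedding [Nonempty M] [Nonempty N] [Countable M]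
    (hM : IsRichSimplyConnected Γ M) (hN : IsRichSimplyConnected Γ N)
    (hs : SinglesConnected Γ M) : Nonempty (M ↪ₑ[lang V] N) := by
  obtain ⟨R, hR⟩ := exists_finiteNice hM hN
  obtain ⟨S, h1, h2, h3, h4⟩ := NiceIso.exists_union (fun _ h => FiniteNice.niceIso h) hR
    (fun (x : M) R => ∃ y, R x y) (fun x R R' h ⟨y, hy⟩ => ⟨y, h _ _ hy⟩)
    (fun R x hR => hR.forth hM hN hs x)
  choose f hf using h4
  obtain ⟨p, hp⟩ := hR.exists_isPair
  have hc : (graphOf fun x y => ∃ n, S n x y).Countable := by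
    have : graphOf (fun x y => ∃ n, S n x y) = ⋃ n, graphOf (S n) := by
      ext ⟨x, y⟩
      simp [graphOf]
    rw [this]
    exact Set.countable_iUnion fun n => (h1 n).finite.countable
  exact ⟨f, fun n φ x => (NiceIso.realize_iff hM hN h2 hc ⟨p, fun γ => h3 _ _ (hp γ)⟩ φ
    fun i => hf (x i)).symm⟩

theorem exists_equiv [Nonempty M] [Nonempty N] [Countable M] [Countable N]
    (hM : IsRichSimplyConnected Γ M) (hN : IsRichSimplyConnected Γ N)
    (hs : SinglesConnected Γ M) (hs' : SinglesConnected Γ N) : Nonempty (M ≃[lang V] N) := by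
  obtain ⟨R, hR⟩ := exists_finiteNice hM hN
  obtain ⟨S, -, h2, -, h4⟩ := NiceIso.exists_union (fun _ h => FiniteNice.niceIso h) hR
    (fun (i : M ⊕ N) R => Sum.elim (fun x => ∃ y, R x y) (fun y => ∃ x, R x y) i)
    (by
      rintro (x | y) R R' h ⟨z, hz⟩
      · exact ⟨z, h _ _ hz⟩
      · exact ⟨z, h _ _ hz⟩)
    (by
      rintro R (x | y) hR
      · exact hR.forth hM hN hs x
      · obtain ⟨R', h1, h2, h3⟩ := hR.flip.forth hN hM hs' y
        exact ⟨_root_.flip R', h1.flip, fun x y h => h2 y x h, h3⟩)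
  choose f hf using fun x => h4 (Sum.inl x)
  choose g hg using fun y => h4 (Sum.inr y)
  have hM' := hM.isGammaSpace.isGammaGraph
  have hN' := hN.isGammaSpace.isGammaGraph
  exact ⟨{
    toFun := f
    invFun := g
    left_inv := fun x => h2.inj (hg _) (hf x)
    right_inv := fun y => h2.func (hf _) (hg y)
    map_fun' := fun h => nomatch h
    map_rel' := by
      rintro _ (_ | γ) x
      · exact (relMap_adj fun i => f (x i)).trans
          (Iff.trans ⟨h2.flip.adj hN hM (hf _) (hf _), h2.adj hM hN (hf _) (hf _)⟩
            (relMap_adj x).symm)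
      · exact (relMap_colour fun i => f (x i)).trans
          (Iff.trans (h2.hasColour_iff hM' hN' (hf _) γ).symm (relMap_colour x).symm) }⟩

/-- The images of two given flags are joined by a chain of some fixed length, whose existence is
expressed by a formula. -/
theorem SinglesConnected.of_elementaryEmbedding (hs : SinglesConnected Γ N)
    (f : M ↪ₑ[lang V] N) : SinglesConnected Γ M := by
  intro F G
  have h1 : ∀ F : Flag Γ M, ∃ F' : Flag Γ N, F'.vertex = f ∘ F.vertex := fun F => by
    have h : (flagF Γ (id : V → V)).Realize F.vertex := realize_flagF.2 ⟨F, rfl⟩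
    rw [← f.map_formula] at h
    exact (realize_flagF (x := id)).1 h
  obtain ⟨F', hF⟩ := h1 F
  obtain ⟨G', hG⟩ := h1 G
  obtain ⟨n, hn⟩ := hs F' G'
  refine ⟨n, realize_chainF.1 ((f.map_formula _ _).1 ?_)⟩
  rw [Sum.comp_elim, ← hF, ← hG]
  exact realize_chainF.2 hn

end Prime

/-! ### The graph of a rich building is the unique prime model -/

section PrimeModel

open FirstOrder.Language

variable {V : Type u} [Finite V] [Nonempty V] {Γ : SimpleGraph V} {X : Type v} {r : V → Setoid X}

theorem IsCountableRichBuilding.isPrimeModel (h : IsCountableRichBuilding Γ r) :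
    IsPrimeModel.{0, u, w} (PS Γ) (ColouredGraph Γ r) := by
  have hne := h.nonempty_colouredGraph
  have := h.countable_colouredGraph
  refine ⟨hne, (models_PS_iff Γ _).2 h.isRichSimplyConnected, fun N => ?_⟩
  exact exists_elementaryEmbedding h.isRichSimplyConnected ((models_PS_iff Γ N).1 N.is_model)
    h.singlesConnected

theorem IsCountableRichBuilding.nonempty_equiv (h : IsCountableRichBuilding Γ r) (N : Type w')
    [(lang V).Structure N] (hN : IsPrimeModel.{0, u, w} (PS Γ) N) :
    Nonempty (N ≃[lang V] ColouredGraph Γ r) := by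
  have := h.nonempty_colouredGraph
  have := h.countable_colouredGraph
  obtain ⟨hne, hm, hp⟩ := hN
  have hm' : ColouredGraph Γ r ⊨ PS Γ := (models_PS_iff Γ _).2 h.isRichSimplyConnected
  -- Primeness of `N` concerns models in the universe `w`, so the countable graph is copied there.
  let e := equivShrink.{w} (ColouredGraph Γ r)
  let _ : (lang V).Structure (Shrink.{w} (ColouredGraph Γ r)) := e.inducedStructure
  let e' : ColouredGraph Γ r ≃[lang V] Shrink.{w} (ColouredGraph Γ r) := e.inducedStructureEquiv
  have : Nonempty (Shrink.{w} (ColouredGraph Γ r)) := e.symm.nonempty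
  have : Shrink.{w} (ColouredGraph Γ r) ⊨ PS Γ :=
    (e'.toElementaryEmbedding.elementarilyEquivalent.theory_model_iff).1 hm'
  obtain ⟨f⟩ := hp (Theory.ModelType.of (PS Γ) (Shrink.{w} (ColouredGraph Γ r)))
  let g : N ↪ₑ[lang V] ColouredGraph Γ r := e'.symm.toElementaryEmbedding.comp f
  have : Countable N := g.injective.countable
  exact exists_equiv ((models_PS_iff Γ N).1 hm) h.isRichSimplyConnected
    (h.singlesConnected.of_elementaryEmbedding g) h.singlesConnected

end PrimeModel

/-! ### Realizing types by sequences -/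

section Types

open FirstOrder.Language Filter

theorem realize_iExs_iInf {L : Language} {M : Type*} [L.Structure M] {n m : ℕ}
    (ψ : Fin m → L.Formula (Fin n)) :
    M ⊨ Formula.iExs (α := Empty) (Fin n)
      (Formula.relabel Sum.inr (BoundedFormula.iInf ψ : L.Formula (Fin n))) ↔
      ∃ a : Fin n → M, ∀ i, (ψ i).Realize a := by
  refine Formula.realize_iExs.trans (exists_congr fun a => ?_)
  rw [Formula.realize_relabel, Sum.elim_comp_inr]
  exact BoundedFormula.realize_iInf

/-- A complete type over a structure is approximated by a sequence of tuples. -/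
theorem exists_seq_of_completeType {L : Language} {M : Type*} [L.Structure M] [Nonempty M]
    [Countable L.Symbols] {n : ℕ}
    (p : (L.completeTheory M).CompleteType (Fin n)) :
    ∃ a : Fin n → ℕ → M, ∀ φ : L.Formula (Fin n), Formula.equivSentence φ ∈ p ↔
      ∀ᶠ m in (hyperfilter ℕ : Filter ℕ), φ.Realize fun i => a i m := by
  classical
  obtain ⟨N, v, rfl⟩ := Theory.exists_modelType_is_realized_in (L.completeTheory M) p
  have : Nonempty (L.Formula (Fin n)) := ⟨⊤⟩
  obtain ⟨f, hf⟩ := exists_surjective_nat (L.Formula (Fin n))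
  -- The existence of a tuple that imitates `v` on the first `m` formulas is a sentence true in `N`,
  -- hence in `M`.
  have key : ∀ m : ℕ, ∃ a : Fin n → M, ∀ i : Fin m, (f i).Realize v ↔ (f i).Realize a := by
    intro m
    let ψ : Fin m → L.Formula (Fin n) := fun i => if (f i).Realize v then f i else (f i).not
    let θ : L.Sentence := Formula.iExs (α := Empty) (Fin n) 
      (Formula.relabel Sum.inr (BoundedFormula.iInf ψ : L.Formula (Fin n)))
    have hN : N ⊨ θ := by
      refine (realize_iExs_iInf ψ).2 ⟨v, fun i => ?_⟩
      by_cases h : (f i).Realize v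
      · simpa only [ψ, if_pos h] using h
      · simpa only [ψ, if_neg h, Formula.realize_not] using h
    have hM : M ⊨ θ := by
      by_contra h
      exact (Sentence.realize_not N).1 (N.is_model.realize_of_mem θ.not
        ((Sentence.realize_not M).2 h)) hN
    obtain ⟨a, ha⟩ := (realize_iExs_iInf ψ).1 hM
    refine ⟨a, fun i => ?_⟩
    have := ha i
    by_cases h : (f i).Realize v
    · simp only [ψ, if_pos h] at this
      exact iff_of_true h this
    · simp only [ψ, if_neg h, Formula.realize_not] at this
      exact iff_of_false h this
  choose a ha using key
  refine ⟨fun i m => a m i, fun φ => ?_⟩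
  rw [Theory.CompleteType.formula_mem_typeOf]
  obtain ⟨k, rfl⟩ := hf φ
  have h1 : ∀ᶠ m in (hyperfilter ℕ : Filter ℕ), k < m := by
    refine hyperfilter_le_cofinite ?_
    rw [Nat.cofinite_eq_atTop]
    exact eventually_gt_atTop _
  have h2 : ∀ᶠ m in (hyperfilter ℕ : Filter ℕ), ((f k).Realize v ↔ (f k).Realize (a m)) :=
    h1.mono fun m hm => ha m ⟨k, hm⟩
  rw [← eventually_congr h2, eventually_const]

/-- A sequence of approximating tuples is a single tuple of the ultrapower. Replacing the constants
for `A` by variables avoids interpreting the larger language there. -/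
theorem exists_realize_ultrapower {L : Language} {M : Type*} [L.Structure M] [Nonempty M]
    [Countable L.Symbols] {A : Set M} (hA : A.Countable) {n : ℕ}
    (p : (L[[A]].completeTheory M).CompleteType (Fin n)) :
    ∃ a : Fin n → Ultrapower M, ∀ φ : L[[A]].Formula (Fin n), Formula.equivSentence φ ∈ p ↔
      Formula.Realize (BoundedFormula.constantsVarsEquiv φ)
        (Sum.elim (fun x : A => diag (x : M)) a) := by
  have : Countable A := hA.to_subtype
  obtain ⟨a, ha⟩ := exists_seq_of_completeType p
  refine ⟨fun i => ofSeq (a i), fun φ => ?_⟩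
  have h1 : (Sum.elim (fun x : A => diag (x : M)) fun i => ofSeq (a i)) =
      fun i : A ⊕ Fin n => ofSeq (Sum.elim (fun (x : A) (_ : ℕ) => (x : M)) a i) := by
    funext i
    cases i <;> rfl
  rw [ha, h1, realize_ofSeq]
  refine Filter.eventually_congr (Filter.Eventually.of_forall fun m => ?_)
  have h2 : (fun i : A ⊕ Fin n => Sum.elim (fun (x : A) (_ : ℕ) => (x : M)) a i m) =
      Sum.elim (fun x : A => ((L.con x : L[[A]].Constants) : M)) fun i => a i m := by
    funext i
    cases i <;> simp
  rw [h2]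
  exact BoundedFormula.realize_constantsVarsEquiv.symm

/-- If the tuples of an ultrapower fall into countably many classes up to formulas with given
parameters, there are countably many types. -/
theorem countable_completeType {L : Language} {M : Type*} [L.Structure M] [Nonempty M]
    [Countable L.Symbols] {A : Set M} (hA : A.Countable) {n : ℕ} {D : Set (Ultrapower M)}
    (hD : D.Countable) (h : ∀ a : Fin n → Ultrapower M, ∃ d : Fin n → Ultrapower M, (∀ i, d i ∈ D) ∧
      ∀ φ : L.Formula (A ⊕ Fin n), φ.Realize (Sum.elim (fun x : A => diag (x : M)) a) ↔
        φ.Realize (Sum.elim (fun x : A => diag (x : M)) d)) :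
    Countable ((L[[A]].completeTheory M).CompleteType (Fin n)) := by
  have : Countable D := hD.to_subtype
  choose a ha using fun p : (L[[A]].completeTheory M).CompleteType (Fin n) =>
    exists_realize_ultrapower hA p
  choose d hd1 hd2 using h
  refine Function.Injective.countable (f := fun p i => (⟨d (a p) i, hd1 _ i⟩ : D)) ?_
  intro p q hpq
  have h1 : d (a p) = d (a q) := funext fun i => congrArg Subtype.val (congrFun hpq i)
  refine SetLike.ext fun φ => ?_
  obtain ⟨φ, rfl⟩ := Formula.equivSentence.surjective φ
  rw [ha p, ha q]
  exact (hd2 _ _).trans (h1 ▸ (hd2 (a q) _).symm)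

end Types

/-! ### Stability -/

section Stability

open FirstOrder.Language

/-- Closing a countable set under an operation on finite subsets. -/
theorem exists_countable_closed {α : Type*} {B : Set α} (hB : B.Countable)
    (Φ : Finset α → Set α) (hΦ : ∀ E, (Φ E).Countable) :
    ∃ D : Set α, D.Countable ∧ B ⊆ D ∧ ∀ E : Finset α, ↑E ⊆ D → Φ E ⊆ D := by
  let S : ℕ → Set α := fun n => Nat.rec B (fun _ D => D ∪ ⋃ E ∈ {E : Finset α | ↑E ⊆ D}, Φ E) n
  have hS : ∀ n, S (n + 1) = S n ∪ ⋃ E ∈ {E : Finset α | ↑E ⊆ S n}, Φ E := fun _ => rfl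
  have hmono : Monotone S := monotone_nat_of_le_succ fun n => by
    rw [hS]
    exact Set.subset_union_left
  refine ⟨⋃ n, S n, Set.countable_iUnion fun n => ?_, Set.subset_iUnion S 0, fun E hE => ?_⟩
  · induction n with
    | zero => exact hB
    | succ n ih =>
      rw [hS]
      refine ih.union (Set.Countable.biUnion ?_ fun E _ => hΦ E)
      refine Set.MapsTo.countable_of_injOn (f := fun E : Finset α => (E : Set α))
        (t := {t | t.Finite ∧ t ⊆ S n}) (fun E hE => ⟨E.finite_toSet, hE⟩)
        Finset.coe_injective.injOn (Set.countable_ofPred_finite_subset ih)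
  · obtain ⟨n, hn⟩ := (hmono.directed_le).exists_mem_subset_of_finset_subset_biUnion hE
    exact (Set.subset_biUnion_of_mem (u := Φ) (show E ∈ {E : Finset α | ↑E ⊆ S n} from hn)).trans
      ((hS n ▸ Set.subset_union_right).trans (Set.subset_iUnion S (n + 1)))

variable {V : Type*} [Finite V] {Γ : SimpleGraph V} {M : Type*} [(lang V).Structure M]

theorem countable_flags {B : Set M} (hB : B.Countable) :
    {F : Flag Γ M | ∀ γ, F.vertex γ ∈ B}.Countable := by
  refine Set.MapsTo.countable_of_injOn (f := Flag.vertex) (t := {f : V → M | ∀ γ, f γ ∈ B})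
    (fun F hF => hF) (fun F _ G _ h => Flag.ext h) ?_
  have : Countable B := hB.to_subtype
  have : Set.range (fun (f : V → B) γ => (f γ).1) = {f | ∀ γ, f γ ∈ B} := by
    ext f
    exact ⟨by rintro ⟨f, rfl⟩ γ; exact (f γ).2, fun hf => ⟨fun γ => ⟨f γ, hf γ⟩, rfl⟩⟩
  rw [← this]
  exact Set.countable_range _

omit [Finite V] [(lang V).Structure M] in
theorem countable_graphOf_iUnion {M N : Type*} {S : ℕ → M → N → Prop}
    (h : ∀ n, (graphOf (S n)).Countable) : (graphOf fun x y => ∃ n, S n x y).Countable := by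
  have : graphOf (fun x y => ∃ n, S n x y) = ⋃ n, graphOf (S n) := by
    ext ⟨x, y⟩
    simp [graphOf]
  rw [this]
  exact Set.countable_iUnion h

/-- Every countable set is contained in a countable nice set. -/
theorem exists_niceIso_le_eq [Nonempty M] (hM : IsRichSimplyConnected Γ M) {A : Set M}
    (hA : A.Countable) : ∃ R : M → M → Prop, NiceIso Γ R ∧ (graphOf R).Countable ∧
      (∀ x y, R x y → x = y) ∧ (∃ p : Flag Γ M × Flag Γ M, IsPair R p) ∧ ∀ x ∈ A, R x x := by
  have : Countable A := hA.to_subtype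
  obtain ⟨F₀⟩ := hM.nonempty_flag
  have heq : ∀ {R : M → M → Prop}, (∀ x y, R x y → x = y) → ∀ {p : Flag Γ M × Flag Γ M},
      IsPair R p → p.1 = p.2 := fun hR p hp => Flag.ext (funext fun γ => hR _ _ (hp γ))
  obtain ⟨S, h1, h2, h3, h4⟩ := NiceIso.exists_union (Γ := Γ) (R := flagRel F₀ F₀)
    (𝒮 := fun R => NiceIso Γ R ∧ ((graphOf R).Countable ∧ ∀ x y, R x y → x = y) ∧
      ∃ p : Flag Γ M × Flag Γ M, IsPair R p) (fun _ h => h.1)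
    ⟨niceIso_flagRel hM.isGammaSpace.isGammaGraph hM.isGammaSpace.isGammaGraph F₀ F₀,
      ⟨(finite_graphOf_flagRel F₀ F₀).countable, by rintro _ _ ⟨γ, rfl, rfl⟩; rfl⟩, _,
      isPair_flagRel F₀ F₀⟩ (fun (x : A) R => R x x) (fun x R R' h => h x x) (by
      rintro R ⟨x, -⟩ ⟨hR, hc, hne⟩
      obtain ⟨F, γ, rfl⟩ := hM.isGammaSpace.vertex_mem_flag x
      obtain ⟨R', h1, h2, h3, F', h4⟩ := NiceIso.forth hM hM
        (𝒞 := fun R => (graphOf R).Countable ∧ ∀ x y, R x y → x = y)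
        (fun R _ hc s g F hg hF => by
          -- The flag `F` serves as its own copy, so the relation remains a restriction of equality.
          refine ⟨F, fun {h} hh hd => ?_, ?_, ?_⟩
          · rw [← heq hc.2 hh]
            exact hF hh (by rwa [heq hc.2 hh, heq hc.2 hg])
          · rw [graphOf_extendRel]
            exact hc.1.union (Set.toFinite _).countable
          · rintro x y (h | ⟨γ, -, h5, h6⟩)
            · exact hc.2 x y h
            · exact h5.trans h6.symm) F hR hc hne
      refine ⟨R', ⟨h1, h2, _, h4⟩, h3, ?_⟩
      have := h4 γ
      rwa [← show F = F' from heq h2.2 h4] at this)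
  obtain ⟨-, -, p, hp⟩ := h1 0
  exact ⟨_, h2, countable_graphOf_iUnion fun n => (h1 n).2.1.1,
    fun x y ⟨n, hn⟩ => (h1 n).2.1.2 x y hn, ⟨p, fun γ => ⟨0, hp γ⟩⟩, fun x hx => h4 ⟨x, hx⟩⟩

/-- Over a countable set, countably many vertices represent all tuples of a saturated space. -/
theorem Saturated.exists_countable_representatives [Nonempty M] (hM : IsRichSimplyConnected Γ M)
    (hs : Saturated Γ M) {A : Set M} (hA : A.Countable) :
    ∃ D : Set M, D.Countable ∧ ∀ (n : ℕ) (a : Fin n → M), ∃ d : Fin n → M, (∀ i, d i ∈ D) ∧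
      ∃ R : M → M → Prop, NiceIso Γ R ∧ (graphOf R).Countable ∧
        (∃ p : Flag Γ M × Flag Γ M, IsPair R p) ∧ (∀ x ∈ A, R x x) ∧ ∀ i, R (a i) (d i) := by
  obtain ⟨R₀, hR₀, hc₀, heq, ⟨p₀, hp₀⟩, hA₀⟩ := exists_niceIso_le_eq hM hA
  let B : Set M := {x | R₀ x x}
  have hB : B.Countable := by
    refine (hc₀.image Prod.fst).mono fun x hx => ?_
    exact ⟨(x, x), hx, rfl⟩
  have hfl : ∀ E : Finset M, {F : Flag Γ M | ∀ γ, F.vertex γ ∈ B ∪ ↑E}.Countable := fun E =>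
    countable_flags (hB.union E.countable_toSet)
  -- One free flag for each finite extension `E` of `B`, each letter and each flag. For fixed `E`
  -- only countably many flags `G` are needed, so a countable `D` can be closed under these choices.
  choose free hfree using fun (E : Finset M) (s : {s : Set V // IsLetter Γ s}) (G : Flag Γ M) =>
    hs.exists_free hM (hfl E) s.2 G
  obtain ⟨D, hD, hBD, hcl⟩ := exists_countable_closed hB
    (fun E => ⋃ s, ⋃ G ∈ {F : Flag Γ M | ∀ γ, F.vertex γ ∈ B ∪ ↑E},
      Set.range (free E s G).vertex)
    (fun E => Set.countable_iUnion fun s => (hfl E).biUnion fun G _ =>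
      (Set.finite_range _).countable)
  refine ⟨D, hD, fun n a => ?_⟩
  classical
  -- The range stays within `B` and finitely many elements of `D`; the chosen free flags are then
  -- free over the range and lie in `D` again.
  let 𝒞 : (M → M → Prop) → Prop := fun R => (graphOf R).Countable ∧
    ∃ E : Finset M, ↑E ⊆ D ∧ ∀ x y, R x y → y ∈ B ∪ ↑E
  obtain ⟨S, h1, h2, h3, h4⟩ := NiceIso.exists_union (Γ := Γ) (R := R₀)
    (𝒮 := fun R => NiceIso Γ R ∧ 𝒞 R ∧ ∃ p : Flag Γ M × Flag Γ M, IsPair R p) (fun _ h => h.1)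
    ⟨hR₀, ⟨hc₀, ∅, by simp, fun x y h => Or.inl (by
      obtain rfl := heq x y h
      exact h)⟩, p₀, hp₀⟩ (fun (i : Fin n) R => ∃ y, R (a i) y)
    (fun i R R' h ⟨y, hy⟩ => ⟨y, h _ _ hy⟩) (by
      rintro R i ⟨hR, hc, hne⟩
      obtain ⟨F, γ, hγ⟩ := hM.isGammaSpace.vertex_mem_flag (a i)
      obtain ⟨R', h1, h2, h3, F', h4⟩ := NiceIso.forth hM hM (𝒞 := 𝒞)
        (fun R _ hc s g F hg hF => by
          obtain ⟨hc, E, hE, hRE⟩ := hc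
          have hl : IsLetter Γ s := (hF hg (by simp [diffColours_self])).1.1
          have hsub : Set.range (free E ⟨s, hl⟩ g.2).vertex ⊆ D :=
            Set.Subset.trans (Set.Subset.trans (Set.subset_biUnion_of_mem
              (u := fun G => Set.range (free E ⟨s, hl⟩ G).vertex)
              (show g.2 ∈ {F : Flag Γ M | ∀ γ, F.vertex γ ∈ B ∪ ↑E} from fun γ => hRE _ _ (hg γ)))
              (Set.subset_iUnion (fun s => ⋃ G ∈ {F : Flag Γ M | ∀ γ, F.vertex γ ∈ B ∪ ↑E},
                Set.range (free E s G).vertex) ⟨s, hl⟩)) (hcl E hE)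
          refine ⟨free E ⟨s, hl⟩ g.2, fun {h} hh hd =>
            hfree E ⟨s, hl⟩ g.2 h.2 (fun γ => hRE _ _ (hh γ)) hd, ?_,
            E ∪ (Set.finite_range (free E ⟨s, hl⟩ g.2).vertex).toFinset, ?_, ?_⟩
          · rw [graphOf_extendRel]
            exact hc.union (Set.toFinite _).countable
          · simpa using ⟨hE, hsub⟩
          · rintro x y (h | ⟨γ, -, -, rfl⟩)
            · rcases hRE x y h with h | h
              · exact Or.inl h
              · exact Or.inr (by simpa using Or.inl h)
            · exact Or.inr (by simp)) F hR hc hne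
      exact ⟨R', ⟨h1, h2, _, h4⟩, h3, F'.vertex γ, hγ ▸ h4 γ⟩)
  choose d hd using h4
  refine ⟨d, fun i => ?_, _, h2, countable_graphOf_iUnion fun n => (h1 n).2.1.1,
    ⟨p₀, fun γ => h3 _ _ (hp₀ γ)⟩, fun x hx => h3 _ _ (hA₀ x hx), hd⟩
  obtain ⟨k, hk⟩ := hd i
  obtain ⟨E, hE, hRE⟩ := (h1 k).2.1.2
  rcases hRE _ _ hk with h | h
  · exact hBD h
  · exact hE h

end Stability

/-! ### Counting types over countable sets -/

section OmegaStable

open FirstOrder.Language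

theorem countable_symbols_lang (V : Type*) [Finite V] : Countable (lang V).Symbols := by
  have : Countable V := Finite.to_countable
  have : ∀ n, Countable ((lang V).Relations n) := fun n => by
    refine Function.Injective.countable (f := fun R : GraphRel V n => match R with
      | GraphRel.adj => (none : Option V)
      | GraphRel.colour γ => some γ) ?_
    intro R S h
    cases R <;> cases S
    · rfl
    · cases Option.some.inj h
      rfl
  have : ∀ n, Countable ((lang V).Functions n) := fun n => inferInstanceAs (Countable Empty)
  unfold Language.Symbols
  infer_instance

variable {V : Type u} [Finite V] [Nonempty V]

theorem isOmegaStable_PS (Γ : SimpleGraph V) : IsOmegaStable.{0, u, w} (PS Γ) := by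
  refine ⟨isComplete_PS Γ, fun M A hA n => ?_⟩
  have hM := (models_PS_iff Γ M).1 M.is_model
  have := countable_symbols_lang V
  obtain ⟨D, hD, h⟩ := hM.saturated_ultrapower.exists_countable_representatives hM.ultrapower
    (hA.image diag)
  refine countable_completeType hA hD fun a => ?_
  obtain ⟨d, hd, R, hR, hc, hne, h1, h2⟩ := h n a
  refine ⟨d, hd, fun φ => NiceIso.realize_iff hM.ultrapower hM.ultrapower hR hc hne φ ?_⟩
  rintro (x | i)
  · exact h1 _ ⟨x, x.2, rfl⟩
  · exact h2 i

end OmegaStable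

end RABuilding

theorem corollary4p16 (V : Type u) [Finite V] [Nonempty V] (Γ : SimpleGraph V) :
    (∀ (M : Type w) [Nonempty M] [(RABuilding.lang V).Structure M],
      M ⊨ RABuilding.PS Γ ↔ RABuilding.IsRichSimplyConnected Γ M) ∧
    RABuilding.IsOmegaStable.{0, u, w} (RABuilding.PS Γ) ∧
    (∃ (X : Type u) (r : V → Setoid X), RABuilding.IsCountableRichBuilding Γ r) ∧
    ∀ (X : Type v) (r : V → Setoid X), RABuilding.IsCountableRichBuilding Γ r →
      Countable (RABuilding.ColouredGraph Γ r) ∧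
      RABuilding.IsPrimeModel.{0, u, w} (RABuilding.PS Γ) (RABuilding.ColouredGraph Γ r) ∧
      ∀ (N : Type w') [(RABuilding.lang V).Structure N],
        RABuilding.IsPrimeModel.{0, u, w} (RABuilding.PS Γ) N →
          Nonempty (N ≃[RABuilding.lang V] RABuilding.ColouredGraph Γ r) :=
  ⟨fun M _ _ => RABuilding.models_PS_iff Γ M, RABuilding.isOmegaStable_PS Γ,
    ⟨_, _, RABuilding.isCountableRichBuilding_richRel⟩,
    fun _ _ h => ⟨h.countable_colouredGraph, h.isPrimeModel, fun N _ hN => h.nonempty_equiv N hN⟩⟩
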